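/- Let $t\ge 1$, let $\underline\xi=(\xi_1,\dots,\xi_t)$ be a tuple of positive integers, $\xi=\xi_1+\dots+\xi_t$, and let $0\le q<n$. Let $D\subset\mathbb C$ be the closed unit disk, $*=-\mathrm i\in\partial D$, and let $\Delta=\Delta_1\sqcup\dots\sqcup\Delta_t$ be a set of $n\xi$ points in the interior of $D$ with $|\Delta_i|=n\xi_i$. An *arc* is a smooth embedding $\gamma\colon[0,1]\to D$ with $\gamma(0)=*$ and $\gamma(1)\in\Delta$, transverse to $\partial D$, with interior in $D\setminus(\partial D\cup\Delta)$. A *colored $\underline\xi$-plant* is an unordered collection of $\xi$ arcs that meet only at $*$, exactly $\xi_i$ of which end in $\Delta_i$ for each $i$; it is identified with the union of its arcs. Two plants are equivalent if a (topological) ambient isotopy of $D$ fixing $\partial D\cup\Delta$ pointwise carries one to the other. The *colored plant complex* $\mathcal O=\mathcal O_{n\cdot\underline\xi}^{\underline\xi}(D)$ is the simplicial complex whose $q$-simplices are the sets of $q+1$ equivalence classes of colored $\underline\xi$-plants that have representatives any two of which meet only at $*$; write $\mathcal O_q$ for the set of $q$-simplices. The *colored braid group* $\mathrm{Br}_{n\cdot\underline\xi}$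 is the group of mapping classes, i.e. of isotopy classes relative to $\partial D\cup\Delta$, of diffeomorphisms of $D$ that fix $\partial D$ pointwise and map each $\Delta_i$ to itself; it acts on $\mathcal O_q$ by taking images. Given a $q$-simplex $\alpha$, represent it by plants that meet pairwise only at $*$ and whose arcs have pairwise distinct tangent directions at $*$, and number all arcs $1,\dots,(q+1)\xi$ in clockwise order of their inward tangent vectors at $*$. Number the plants $0,\dots,q$ in the order in which their first arcs occur. The *IC-sequence* of $\alpha$ is $\omega_\alpha=((i_1,j_1),\dots,(i_{(q+1)\xi},j_{(q+1)\xi}))$, where $i_k\in\{0,\dots,q\}$ is the number of the plant containing the $k$-th arc and $j_k\in\{1,\dots,t\}$ is the color of its end point (the end point lies in $\Delta_{j_k}$). A sequence of $(q+1)\xi$ such pairs is *$q$-feasible* if each index $i$ occurs $\xi$ times, each pair $(i,j)$ occurs $\xi_j$ times, and, for $0\le i<q$, the index $i+1$ does not appear before the index $i$. Then the number of orbits of $\mathrm{Br}_{n\cdot\underline\xi}$ on $\mathcal O_q$ is $$\#\bigl(\mathcal O_q/\mathrm{Br}_{n\cdot\underline\xi}\bigr)=\frac{(\xi(q+1))!}{(q+1)!\,(\xi_1!\cdots\xi_t!)^{q+1}}.$$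 Moreover every $q$-simplex has a well-defined IC-sequence, the IC-sequences that occur for $q$-simplices are exactly the $q$-feasible sequences, and $\alpha\mapsto\omega_\alpha$ induces a bijection from the set of $\mathrm{Br}_{n\cdot\underline\xi}$-orbits on $\mathcal O_q$ to the set of $q$-feasible sequences. -/

import Mathlib

open Set

noncomputable section

namespace PlantComplex

/-- The closed unit disk `D` in the complex plane. -/
abbrev Disk : Type := Metric.closedBall (0 : ℂ) 1

/-- The base point `* = -i` on the boundary of the disk. -/
def base : Disk := ⟨-Complex.I, by simp⟩

/-- Finitely many marked points `Δ = Δ_1 ⊔ ... ⊔ Δ_t` in the interior of the disk, each of them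
having one of `t` colors. -/
structure MarkedPoints (t : ℕ) where
  /-- the set `Δ_i` of marked points of color `i` -/
  pts : Fin t → Finset ℂ
  norm_lt_one : ∀ i, ∀ z ∈ pts i, ‖z‖ < 1
  disjoint : ∀ i j, i ≠ j → Disjoint (pts i) (pts j)

variable {t : ℕ}

/-- An arc: a smooth embedding of `[0,1]` into the disk which starts at `*`, ends in a marked
point, is transverse to the boundary (whose tangent line at `* = -i` is `ℝ`), and whose interior
avoids the boundary of the disk and the marked points. -/
structure Arc (Δ : MarkedPoints t) where
  toFun : ℝ → ℂ
  smooth : ContDiffOn ℝ (⊤ : ℕ∞) toFun (Icc 0 1)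
  injOn : InjOn toFun (Icc 0 1)
  immersion : ∀ s ∈ Icc (0 : ℝ) 1, derivWithin toFun (Icc 0 1) s ≠ 0
  start : toFun 0 = -Complex.I
  finish : ∃ i, toFun 1 ∈ Δ.pts i
  transverse : (derivWithin toFun (Icc 0 1) 0).im ≠ 0
  interior : ∀ s ∈ Ioo (0 : ℝ) 1, ‖toFun s‖ < 1 ∧ ∀ i, toFun s ∉ Δ.pts i

namespace Arc

variable {Δ : MarkedPoints t}

/-- The image of an arc, a subset of the disk. -/
def carrier (a : Arc Δ) : Set Disk := {z | ∃ s ∈ Icc (0 : ℝ) 1, a.toFun s = z}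

/-- The initial velocity of an arc, an inward pointing tangent vector of the disk at `*`. -/
def tangent (a : Arc Δ) : ℂ := derivWithin a.toFun (Icc 0 1) 0

/-- The arc ends in a marked point of color `i`. -/
def HasColor (a : Arc Δ) (i : Fin t) : Prop := a.toFun 1 ∈ Δ.pts i

theorem norm_le_one (a : Arc Δ) {s : ℝ} (hs : s ∈ Icc (0 : ℝ) 1) : ‖a.toFun s‖ ≤ 1 := by
  rcases eq_or_lt_of_le hs.1 with h | h
  · rw [← h, a.start]; simp
  rcases eq_or_lt_of_le hs.2 with h' | h'
  · obtain ⟨i, hi⟩ := a.finish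
    rw [h']; exact (Δ.norm_lt_one i _ hi).le
  · exact (a.interior s ⟨h, h'⟩).1.le

end Arc

/-- A colored `ξ`-plant: a collection of `ξ_1 + ... + ξ_t` arcs which only meet at `*`, exactly
`ξ_i` of which end at marked points of color `i`. As usual, it is regarded as a subset of the
disk, namely the union of its arcs. -/
def IsColoredPlant (Δ : MarkedPoints t) (ξ : Fin t → ℕ) (P : Set Disk) : Prop :=
  ∃ a : (Σ i : Fin t, Fin (ξ i)) → Arc Δ,
    (∀ k, (a k).HasColor k.1) ∧
    (∀ k l, k ≠ l → (a k).carrier ∩ (a l).carrier = {base}) ∧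
    P = ⋃ k, (a k).carrier

/-- The type of colored `ξ`-plants. -/
def Plant (Δ : MarkedPoints t) (ξ : Fin t → ℕ) : Type := {P : Set Disk // IsColoredPlant Δ ξ P}

/-- A homeomorphism of the disk fixes the boundary circle pointwise. -/
def FixesBoundary (φ : Disk ≃ₜ Disk) : Prop := ∀ z : Disk, ‖(z : ℂ)‖ = 1 → φ z = z

/-- A homeomorphism of the disk fixes every marked point. -/
def FixesMarked (Δ : MarkedPoints t) (φ : Disk ≃ₜ Disk) : Prop :=
  ∀ i, ∀ z : Disk, (z : ℂ) ∈ Δ.pts i → φ z = z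

/-- The homeomorphisms of the disk that are isotopic to the identity by an isotopy of the disk
which fixes the boundary and the marked points pointwise. -/
def isotopyGroup (Δ : MarkedPoints t) : Subgroup (Disk ≃ₜ Disk) where
  carrier := {φ | ∃ H : unitInterval → (Disk ≃ₜ Disk),
    Continuous (fun p : unitInterval × Disk => H p.1 p.2) ∧ H 0 = 1 ∧ H 1 = φ ∧
    ∀ s, FixesBoundary (H s) ∧ FixesMarked Δ (H s)}
  one_mem' := ⟨fun _ => 1, continuous_snd, rfl, rfl, fun _ => ⟨fun _ _ => rfl, fun _ _ _ => rfl⟩⟩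
  mul_mem' := by
    rintro φ ψ ⟨H, hc, h0, h1, hf⟩ ⟨K, kc, k0, k1, kf⟩
    refine ⟨fun s => H s * K s, ?_, by simp [h0, k0], by simp [h1, k1], fun s => ⟨?_, ?_⟩⟩
    · exact hc.comp (continuous_fst.prodMk kc)
    · intro z hz
      rw [Homeomorph.mul_apply, (kf s).1 z hz, (hf s).1 z hz]
    · intro i z hz
      rw [Homeomorph.mul_apply, (kf s).2 i z hz, (hf s).2 i z hz]
  inv_mem' := by
    rintro φ ⟨H, hc, h0, h1, hf⟩
    have key : ∀ s z, φ z = z → H s z = z → (H s * φ⁻¹) z = z := by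
      intro s z h1 h2
      have : φ⁻¹ z = z := by
        rw [Homeomorph.inv_apply, Homeomorph.symm_apply_eq, h1]
      rw [Homeomorph.mul_apply, this, h2]
    refine ⟨fun s => H (unitInterval.symm s) * φ⁻¹, ?_, by simp [h1], by simp [h0],
      fun s => ⟨fun z hz => ?_, fun i z hz => ?_⟩⟩
    · exact hc.comp ((unitInterval.continuous_symm.comp continuous_fst).prodMk
        ((φ⁻¹).continuous.comp continuous_snd))
    · exact key _ _ (by rw [← h1]; exact (hf 1).1 z hz) ((hf _).1 z hz)
    · exact key _ _ (by rw [← h1]; exact (hf 1).2 i z hz) ((hf _).2 i z hz)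

/-- A self-map of the disk is smooth (up to the boundary). -/
def IsSmooth (f : Disk → Disk) : Prop :=
  ∃ F : ℂ → ℂ, ContDiffOn ℝ (⊤ : ℕ∞) F (Metric.closedBall 0 1) ∧ ∀ z : Disk, F z = f z

/-- The diffeomorphisms of the disk which fix the boundary pointwise (hence preserve the
orientation) and leave each of the sets `Δ_1, ..., Δ_t` invariant. -/
def coloredDiffeo (Δ : MarkedPoints t) : Subgroup (Disk ≃ₜ Disk) where
  carrier := {φ | IsSmooth φ ∧ IsSmooth φ.symm ∧ FixesBoundary φ ∧
    ∀ i, ∀ z : Disk, (φ z : ℂ) ∈ Δ.pts i ↔ (z : ℂ) ∈ Δ.pts i}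
  one_mem' := ⟨⟨id, contDiffOn_id, fun _ => rfl⟩, ⟨id, contDiffOn_id, fun _ => rfl⟩,
    fun _ _ => rfl, fun _ _ => Iff.rfl⟩
  mul_mem' := by
    have comp : ∀ f g : Disk → Disk, IsSmooth f → IsSmooth g → IsSmooth (fun z => f (g z)) := by
      rintro f g ⟨F, hF, hF'⟩ ⟨G, hG, hG'⟩
      refine ⟨F ∘ G, hF.comp hG fun z hz => ?_, fun z => ?_⟩
      · rw [hG' ⟨z, hz⟩]; exact (g ⟨z, hz⟩).2
      · rw [Function.comp_apply, hG', hF']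
    rintro φ ψ ⟨a1, a2, a3, a4⟩ ⟨b1, b2, b3, b4⟩
    refine ⟨comp φ ψ a1 b1, comp ψ.symm φ.symm b2 a2, fun z hz => ?_, fun i z => ?_⟩
    · rw [Homeomorph.mul_apply, b3 z hz, a3 z hz]
    · rw [Homeomorph.mul_apply, a4, b4]
  inv_mem' := by
    rintro φ ⟨a1, a2, a3, a4⟩
    refine ⟨a2, a1, fun z hz => ?_, fun i z => ?_⟩
    · rw [Homeomorph.inv_apply, Homeomorph.symm_apply_eq, a3 z hz]
    · rw [← a4, Homeomorph.inv_apply, Homeomorph.apply_symm_apply]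

theorem conj_mem_isotopyGroup {Δ : MarkedPoints t} {φ g : Disk ≃ₜ Disk}
    (hφ : φ ∈ isotopyGroup Δ) (hg : g ∈ coloredDiffeo Δ) : g * φ * g⁻¹ ∈ isotopyGroup Δ := by
  obtain ⟨H, hc, h0, h1, hf⟩ := hφ
  have hg' := (coloredDiffeo Δ).inv_mem hg
  refine ⟨fun s => g * H s * g⁻¹, ?_, by simp [h0], by simp [h1],
    fun s => ⟨fun z hz => ?_, fun i z hz => ?_⟩⟩
  · exact g.continuous.comp (hc.comp (continuous_fst.prodMk
      ((g⁻¹).continuous.comp continuous_snd)))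
  · rw [Homeomorph.mul_apply, Homeomorph.mul_apply, hg'.2.2.1 z hz, (hf s).1 z hz,
      hg.2.2.1 z hz]
  · have : ((g⁻¹ z : Disk) : ℂ) ∈ Δ.pts i := (hg'.2.2.2 i z).2 hz
    rw [Homeomorph.mul_apply, Homeomorph.mul_apply, (hf s).2 i _ this, ← Homeomorph.mul_apply,
      mul_inv_cancel]
    rfl

instance isotopy_normal (Δ : MarkedPoints t) :
    ((isotopyGroup Δ).subgroupOf (coloredDiffeo Δ)).Normal where
  conj_mem n hn g := by
    rw [Subgroup.mem_subgroupOf] at hn ⊢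
    exact conj_mem_isotopyGroup hn g.2

/-- The colored braid group, as the group of mapping classes of the disk with marked points
(relative to the boundary) which leave the partition of the set of marked points invariant. -/
abbrev ColoredBraidGroup (Δ : MarkedPoints t) : Type :=
  coloredDiffeo Δ ⧸ (isotopyGroup Δ).subgroupOf (coloredDiffeo Δ)

variable {Δ : MarkedPoints t} {ξ : Fin t → ℕ}

/-- Two plants are equivalent if an isotopy of the disk which fixes the boundary and the marked
points pointwise transforms one into the other. -/
instance plantSetoid (Δ : MarkedPoints t) (ξ : Fin t → ℕ) : Setoid (Plant Δ ξ) where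
  r P Q := ∃ φ ∈ isotopyGroup Δ, φ '' P.1 = Q.1
  iseqv :=
    { refl := fun P => ⟨1, one_mem _, image_id _⟩
      symm := by
        rintro P Q ⟨φ, hφ, h⟩
        refine ⟨φ⁻¹, inv_mem hφ, ?_⟩
        rw [← h, ← image_comp]
        exact (congrArg (· '' P.1) (funext φ.symm_apply_apply)).trans (image_id _)
      trans := by
        rintro P Q R ⟨φ, hφ, h⟩ ⟨ψ, hψ, h'⟩
        refine ⟨ψ * φ, mul_mem hψ hφ, ?_⟩
        rw [← h', ← h, ← image_comp]
        rfl }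

/-- Isotopy classes of colored `ξ`-plants. -/
def PlantClass (Δ : MarkedPoints t) (ξ : Fin t → ℕ) : Type := Quotient (plantSetoid Δ ξ)

/-- The isotopy class of a plant. -/
def Plant.cls (P : Plant Δ ξ) : PlantClass Δ ξ := Quotient.mk _ P

/-- The colored plant complex: its simplices are the finite nonempty sets of isotopy classes of
colored `ξ`-plants which can be embedded with disjoint interiors and without common marked
points, that is, such that distinct plants share no point except `*`. -/
def coloredPlantComplex (Δ : MarkedPoints t) (ξ : Fin t → ℕ) :
    AbstractSimplicialComplex (PlantClass Δ ξ) where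
  faces := {s | s.Nonempty ∧ ∃ r : PlantClass Δ ξ → Plant Δ ξ, (∀ v ∈ s, (r v).cls = v) ∧
    ∀ v ∈ s, ∀ w ∈ s, v ≠ w → (r v).1 ∩ (r w).1 ⊆ {base}}
  isRelLowerSet_faces := by
    rintro s ⟨hs, r, h1, h2⟩
    exact ⟨hs, fun u hu hne => ⟨hne, r, fun v hv => h1 v (hu hv),
      fun v hv w hw => h2 v (hu hv) w (hu hw)⟩⟩
  singleton_mem v := by
    refine ⟨Finset.singleton_nonempty v, fun w => Quotient.out w,
      fun w _ => Quotient.out_eq w, fun v' hv' w hw hne => absurd ?_ hne⟩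
    rw [Finset.mem_singleton.1 hv', Finset.mem_singleton.1 hw]

/-- The set of `q`-simplices of the colored plant complex. -/
def Simplex (Δ : MarkedPoints t) (ξ : Fin t → ℕ) (q : ℕ) : Type :=
  {s : Finset (PlantClass Δ ξ) // s ∈ (coloredPlantComplex Δ ξ).faces ∧ s.card = q + 1}

/-! ### The action of the colored braid group -/

/-- Diffeomorphisms carry arcs to arcs, preserving the color. -/
theorem exists_arc_image (g : coloredDiffeo Δ) (a : Arc Δ) :
    ∃ b : Arc Δ, b.carrier = g.1 '' a.carrier ∧ ∀ i, a.HasColor i → b.HasColor i := by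
  obtain ⟨φ, ⟨F, hF, hFφ⟩, ⟨G, hG, hGφ⟩, hbd, hcol⟩ := g
  set B : Set ℂ := Metric.closedBall 0 1 with hB
  have huB : UniqueDiffOn ℝ B := uniqueDiffOn_convex (convex_closedBall _ _)
    (by rw [interior_closedBall _ one_ne_zero]; exact ⟨0, by simp⟩)
  have hmaps : MapsTo a.toFun (Icc 0 1) B := fun s hs => by
    simpa [hB] using a.norm_le_one hs
  have hFB : MapsTo F B B := fun z hz => by
    rw [hFφ ⟨z, hz⟩]; exact (φ ⟨z, hz⟩).2
  have hGF : ∀ z ∈ B, G (F z) = z := fun z hz => by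
    rw [hFφ ⟨z, hz⟩, hGφ, Homeomorph.symm_apply_apply]
  have hFbd : ∀ z : ℂ, ‖z‖ = 1 → F z = z := fun z hz => by
    have hz' : z ∈ B := by simp [hB, hz]
    rw [hFφ ⟨z, hz'⟩, hbd ⟨z, hz'⟩ hz]
  have hFcol : ∀ i, ∀ z ∈ B, F z ∈ Δ.pts i ↔ z ∈ Δ.pts i := fun i z hz => by
    rw [hFφ ⟨z, hz⟩, hcol i ⟨z, hz⟩]
  have hFd : DifferentiableOn ℝ F B := hF.differentiableOn (by simp)
  have hGd : DifferentiableOn ℝ G B := hG.differentiableOn (by simp)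
  have hinj : ∀ z ∈ B, ∀ v, fderivWithin ℝ F B z v = 0 → v = 0 := by
    intro z hz v hv
    have h1 : HasFDerivWithinAt (G ∘ F) ((fderivWithin ℝ G B (F z)).comp
        (fderivWithin ℝ F B z)) B z :=
      (hGd _ (hFB hz)).hasFDerivWithinAt.comp z (hFd z hz).hasFDerivWithinAt hFB
    have h2 : HasFDerivWithinAt (G ∘ F) (ContinuousLinearMap.id ℝ ℂ) B z :=
      (hasFDerivWithinAt_id z B).congr (fun w hw => hGF w hw) (hGF z hz)
    have h3 := (huB z hz).eq h1 h2
    have h4 := congrArg (fun L : ℂ →L[ℝ] ℂ => L v) h3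
    simpa [hv] using h4.symm
  have hderiv : ∀ s ∈ Icc (0 : ℝ) 1, derivWithin (F ∘ a.toFun) (Icc 0 1) s =
      fderivWithin ℝ F B (a.toFun s) (derivWithin a.toFun (Icc 0 1) s) := by
    intro s hs
    exact fderivWithin_comp_derivWithin s (hFd _ (hmaps hs))
      (a.smooth.differentiableOn (by simp) s hs) hmaps
  have hlt : ∀ z ∈ B, ‖z‖ < 1 → ‖F z‖ < 1 := by
    intro z hz hz1
    have h1 : ‖F z‖ ≤ 1 := by simpa [hB] using hFB hz
    rcases eq_or_lt_of_le h1 with h | h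
    · exfalso
      have h2 : φ (φ ⟨z, hz⟩) = φ ⟨z, hz⟩ := hbd _ (by rw [← hFφ]; exact h)
      have h3 : F z = z := by
        rw [hFφ ⟨z, hz⟩]; exact congrArg Subtype.val (φ.injective h2)
      rw [h3] at h; exact absurd h hz1.ne
    · exact h
  have hone : fderivWithin ℝ F B (-Complex.I) 1 = 1 := by
    have hmem : (-Complex.I) ∈ B := by simp [hB]
    set c : ℝ → ℂ := fun s => Complex.exp (s * Complex.I) * (-Complex.I) with hc
    have hcn : ∀ s, ‖c s‖ = 1 := fun s => by simp [hc, Complex.norm_exp_ofReal_mul_I]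
    have hc0 : c 0 = -Complex.I := by simp [hc]
    have hcd : HasDerivAt c 1 0 := by
      have h1 : HasDerivAt (fun s : ℝ => (s : ℂ) * Complex.I) Complex.I 0 := by
        simpa using (Complex.ofRealCLM.hasDerivAt (x := (0 : ℝ))).mul_const Complex.I
      have h2 := (h1.cexp).mul_const (-Complex.I)
      rw [hc]
      refine h2.congr_deriv ?_
      simp
    have hd : HasFDerivWithinAt F (fderivWithin ℝ F B (-Complex.I)) B (c 0) := by
      rw [hc0]; exact (hFd _ hmem).hasFDerivWithinAt
    have h1 : HasDerivAt (F ∘ c) (fderivWithin ℝ F B (-Complex.I) 1) 0 := by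
      have := hd.comp_hasDerivWithinAt (s := univ) 0 hcd.hasDerivWithinAt
        (fun s _ => by simp [hB, hcn s])
      simpa using this
    have h2 : F ∘ c = c := funext fun s => hFbd _ (hcn s)
    rw [h2] at h1
    exact h1.unique hcd
  have h01 : (0 : ℝ) ∈ Icc (0 : ℝ) 1 := by simp
  have h11 : (1 : ℝ) ∈ Icc (0 : ℝ) 1 := by simp
  refine ⟨⟨F ∘ a.toFun, hF.comp a.smooth hmaps, ?_, ?_, ?_, ?_, ?_, ?_⟩, ?_, ?_⟩
  · intro s hs u hu h
    apply a.injOn hs hu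
    rw [← hGF _ (hmaps hs), ← hGF _ (hmaps hu)]
    exact congrArg G h
  · intro s hs h
    rw [hderiv s hs] at h
    exact a.immersion s hs (hinj _ (hmaps hs) _ h)
  · rw [Function.comp_apply, a.start]; exact hFbd _ (by simp)
  · obtain ⟨i, hi⟩ := a.finish
    exact ⟨i, (hFcol i _ (hmaps h11)).2 hi⟩
  · rw [hderiv 0 h01, a.start]
    set v := derivWithin a.toFun (Icc 0 1) 0 with hv
    set L := fderivWithin ℝ F B (-Complex.I) with hL
    intro h
    apply a.transverse
    have h1 : L v = ((L v).re : ℂ) := Complex.ext (by simp) (by simpa using h)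
    have h2 : L (((L v).re : ℝ) : ℂ) = ((L v).re : ℂ) := by
      have := L.map_smul (L v).re (1 : ℂ)
      rw [hone] at this
      simpa using this
    have h3 : L (v - (((L v).re : ℝ) : ℂ)) = 0 := by rw [map_sub, h2, ← h1, sub_self]
    have h4 := hinj _ (by simp [hB]) _ h3
    rw [← hv, sub_eq_zero.1 h4, Complex.ofReal_im]
  · intro s hs
    have hs' := Ioo_subset_Icc_self hs
    refine ⟨hlt _ (hmaps hs') (a.interior s hs).1, fun i hi => ?_⟩
    exact (a.interior s hs).2 i ((hFcol i _ (hmaps hs')).1 hi)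
  · ext z
    constructor
    · rintro ⟨s, hs, h⟩
      refine ⟨⟨a.toFun s, hmaps hs⟩, ⟨s, hs, rfl⟩, Subtype.ext ?_⟩
      rw [← h]; exact (hFφ ⟨a.toFun s, hmaps hs⟩).symm
    · rintro ⟨w, ⟨s, hs, h⟩, rfl⟩
      refine ⟨s, hs, ?_⟩
      change F (a.toFun s) = φ w
      rw [h, hFφ]
  · intro i hi
    exact (hFcol i _ (hmaps h11)).2 hi

theorem base_fixed (g : coloredDiffeo Δ) : g.1 base = base :=
  g.2.2.2.1 base (by simp [base])

theorem isColoredPlant_image (g : coloredDiffeo Δ) {P : Set Disk} (hP : IsColoredPlant Δ ξ P) :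
    IsColoredPlant Δ ξ (g.1 '' P) := by
  obtain ⟨a, h1, h2, h3⟩ := hP
  choose f hf hf' using exists_arc_image g
  refine ⟨fun k => f (a k), fun k => hf' _ _ (h1 k), fun k l hkl => ?_, ?_⟩
  · rw [hf, hf, ← image_inter g.1.injective, h2 k l hkl, image_singleton, base_fixed]
  · rw [h3, image_iUnion]
    exact iUnion_congr fun k => (hf _).symm

/-- The action of diffeomorphisms on plants: the image of a plant. -/
instance plantAction : MulAction (coloredDiffeo Δ) (Plant Δ ξ) where
  smul g P := ⟨g.1 '' P.1, isColoredPlant_image g P.2⟩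
  one_smul P := Subtype.ext (image_id P.1)
  mul_smul g h P := Subtype.ext (image_comp g.1 h.1 P.1)

theorem smul_plant_val (g : coloredDiffeo Δ) (P : Plant Δ ξ) : (g • P).1 = g.1 '' P.1 := rfl

theorem smul_equiv (g : coloredDiffeo Δ) {P Q : Plant Δ ξ} (h : P ≈ Q) : g • P ≈ g • Q := by
  obtain ⟨φ, hφ, h⟩ := h
  refine ⟨g.1 * φ * g.1⁻¹, conj_mem_isotopyGroup hφ g.2, ?_⟩
  rw [smul_plant_val, smul_plant_val, ← h, ← image_comp, ← image_comp]
  refine image_congr fun z _ => ?_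
  change g.1 (φ (g.1.symm (g.1 z))) = g.1 (φ z)
  rw [Homeomorph.symm_apply_apply]

/-- The action of diffeomorphisms on isotopy classes of plants. -/
instance classAction : MulAction (coloredDiffeo Δ) (PlantClass Δ ξ) where
  smul g := Quotient.map (g • ·) fun _ _ => smul_equiv g
  one_smul v := Quotient.inductionOn v fun P => congrArg (Quotient.mk _) (one_smul _ P)
  mul_smul g h v := Quotient.inductionOn v fun P => congrArg (Quotient.mk _) (mul_smul g h P)

theorem smul_cls (g : coloredDiffeo Δ) (P : Plant Δ ξ) : g • P.cls = (g • P).cls := rfl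

theorem isotopy_smul (g : coloredDiffeo Δ)
    (hg : g ∈ (isotopyGroup Δ).subgroupOf (coloredDiffeo Δ)) (v : PlantClass Δ ξ) :
    g • v = v :=
  Quotient.inductionOn v fun _ => Quotient.sound (Setoid.symm ⟨g.1, hg, rfl⟩)

theorem map_mem_faces (g : coloredDiffeo Δ) {s : Finset (PlantClass Δ ξ)}
    (hs : s ∈ (coloredPlantComplex Δ ξ).faces) :
    s.map (MulAction.toPerm g).toEmbedding ∈ (coloredPlantComplex Δ ξ).faces := by
  obtain ⟨hne, r, h1, h2⟩ := hs
  refine ⟨hne.map, fun v => g • r (g⁻¹ • v), ?_, ?_⟩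
  · intro v hv
    obtain ⟨w, hw, rfl⟩ := Finset.mem_map.1 hv
    change (g • r (g⁻¹ • g • w)).cls = g • w
    rw [inv_smul_smul, ← smul_cls, h1 w hw]
  · intro v' hv' w' hw' hvw
    obtain ⟨v, hv, rfl⟩ := Finset.mem_map.1 hv'
    obtain ⟨w, hw, rfl⟩ := Finset.mem_map.1 hw'
    change (g • r (g⁻¹ • g • v)).1 ∩ (g • r (g⁻¹ • g • w)).1 ⊆ {base}
    rw [inv_smul_smul, inv_smul_smul, smul_plant_val, smul_plant_val,
      ← image_inter g.1.injective]
    rintro _ ⟨z, hz, rfl⟩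
    rw [h2 v hv w hw (fun h => hvw (by rw [h])) hz]
    exact base_fixed g

/-- The action of diffeomorphisms on `q`-simplices, vertex by vertex. -/
instance simplexAction (q : ℕ) : MulAction (coloredDiffeo Δ) (Simplex Δ ξ q) where
  smul g α := ⟨α.1.map (MulAction.toPerm g).toEmbedding, map_mem_faces g α.2.1,
    (Finset.card_map _).trans α.2.2⟩
  one_smul α := by
    refine Subtype.ext (Finset.ext fun v => ?_)
    change v ∈ α.1.map _ ↔ _
    simp
  mul_smul g h α := by
    refine Subtype.ext (Finset.ext fun v => ?_)
    change v ∈ α.1.map _ ↔ v ∈ (α.1.map _).map _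
    simp [mul_smul]

theorem isotopy_smul_simplex {q : ℕ} (g : coloredDiffeo Δ)
    (hg : g ∈ (isotopyGroup Δ).subgroupOf (coloredDiffeo Δ)) (α : Simplex Δ ξ q) :
    g • α = α := by
  refine Subtype.ext (Finset.ext fun v => ?_)
  change v ∈ α.1.map _ ↔ _
  simp [isotopy_smul _ (inv_mem hg)]

/-- The action of the colored braid group on `q`-simplices, induced by the action of
diffeomorphisms. -/
instance braidAction (q : ℕ) : MulAction (ColoredBraidGroup Δ) (Simplex Δ ξ q) :=
  MulAction.compHom _ (QuotientGroup.lift ((isotopyGroup Δ).subgroupOf (coloredDiffeo Δ))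
    (MulAction.toPermHom (coloredDiffeo Δ) (Simplex Δ ξ q))
    fun g hg => Equiv.ext fun α => isotopy_smul_simplex g hg α)

theorem braid_mk_smul {q : ℕ} (g : coloredDiffeo Δ) (α : Simplex Δ ξ q) :
    (QuotientGroup.mk g : ColoredBraidGroup Δ) • α = g • α := rfl

/-- The set of orbits of the colored braid group on `q`-simplices. -/
abbrev Orbits (Δ : MarkedPoints t) (ξ : Fin t → ℕ) (q : ℕ) : Type :=
  MulAction.orbitRel.Quotient (ColoredBraidGroup Δ) (Simplex Δ ξ q)

/-- The orbit of a `q`-simplex. -/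
def orbitOf {q : ℕ} (α : Simplex Δ ξ q) : Orbits Δ ξ q := Quotient.mk _ α

/-! ### IC-sequences -/

/-- Sequences of length `(q+1)(ξ_1 + ... + ξ_t)` of pairs of an index in `{0, ..., q}` and a
color. -/
abbrev ICSequence (ξ : Fin t → ℕ) (q : ℕ) : Type :=
  Fin ((q + 1) * ∑ i, ξ i) → Fin (q + 1) × Fin t

/-- `ω` is the IC-sequence (index-color-sequence) of the `q`-simplex `α`. There are plants
`v_0, ..., v_q` representing the vertices of `α` and consisting of arcs `a_k` which only meet at
`*`, such that
* the arcs are numbered in clockwise order of their tangent vectors at `* = -i`; as these vectors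
  point to the upper half plane, this means that the arguments are strictly decreasing;
* `a_k` belongs to the plant `v_i`, `i` the `k`-th index, and its end point has the `k`-th color;
* the plants are numbered in their natural order: for `i < j`, some arc of `v_i` precedes every
  arc of `v_j`. -/
def IsICSequence {q : ℕ} (α : Simplex Δ ξ q) (ω : ICSequence ξ q) : Prop :=
  ∃ (v : Fin (q + 1) → Plant Δ ξ) (a : Fin ((q + 1) * ∑ i, ξ i) → Arc Δ),
    (α.1 : Set (PlantClass Δ ξ)) = range (fun i => (v i).cls) ∧
    (∀ k l, k ≠ l → (a k).carrier ∩ (a l).carrier = {base}) ∧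
    StrictAnti (fun k => (a k).tangent.arg) ∧
    (∀ i, (v i).1 = ⋃ (k) (_ : (ω k).1 = i), (a k).carrier) ∧
    (∀ k, (a k).HasColor (ω k).2) ∧
    ∀ i j, i < j → ∃ k, (ω k).1 = i ∧ ∀ l, (ω l).1 = j → k < l

/-- A sequence is `q`-feasible if each index is assigned `ξ_1 + ... + ξ_t` times, for each index
the color `j` is assigned `ξ_j` times, and the index `i+1` does not appear before the index
`i`. -/
def IsFeasible {q : ℕ} (ω : ICSequence ξ q) : Prop :=
  (∀ i, Nat.card {k // (ω k).1 = i} = ∑ j, ξ j) ∧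
  (∀ i j, Nat.card {k // ω k = (i, j)} = ξ j) ∧
  ∀ i i' : Fin (q + 1), (i' : ℕ) = i + 1 → ∀ k', (ω k').1 = i' → ∃ k, k < k' ∧ (ω k).1 = i

end PlantComplex

end

/-! ### Normalized index sequences and the number of feasible sequences. -/

open Set

noncomputable section

namespace PlantComplex

variable {t : ℕ} {Δ : MarkedPoints t} {ξ : Fin t → ℕ}

/-! The orbit of a simplex is determined by what happens near `*`: the left-to-right order of the
arcs, together with the plant and the color of each. The proof has four topological parts and a
count.

Well-definedness (`IsICSequence.unique`). Two systems of representatives of one simplex differ by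
isotopies chosen separately for each plant. These are merely topological and destroy tangent
directions, so the order at `*` needs another description. For disjoint arcs `a`, `b` that start at
`*`, compare the change of a continuous logarithm of `a - b(1)` along `a` with that of `b - a(1)`
along `b`. Both changes survive an isotopy of one arc alone, since end points are marked and hence
fixed. A logarithm of `a(s) - b(u)` on the square without its corner shows that the difference of
their imaginary parts depends only on the end points and on which arc starts to the left; exchanging
the order alters it by `2π` (`logChange_sub`, `arg_lt_of_isotopic`). An arc is moreover recovered
from its plant as the smallest connected subset that joins `*` to its end point
(`carrier_subset_of_isPreconnected`), so isotopic plants have isotopic arcs.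

Invariance (`IsICSequence.smul`). A diffeomorphism that fixes the circle has at `*` a derivative
that fixes the tangent line and preserves the inward side, so it preserves the order of inward
directions.

Existence of a sequence for each simplex (`exists_isICSequence`) and of a simplex for each feasible
sequence (`exists_simplex`). Near `*` disjoint arcs are graphs over the height coordinate, ordered
even if they are tangent to each other; an isotopy inside a thin wedge turns them into segments of
distinct slopes (`exists_straightStart`). Conversely, short segments at `*` are carried to arcs with
prescribed ends by a diffeomorphism that moves finitely many points (`exists_arcs`).

Transitivity (`exists_diffeo_family`). Two ordered families with the same colors are isotoped so
that the `k`-th arcs of both start with the same segment and all arcs end straight. Each arc is then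
retracted along itself to its initial segment by a diffeomorphism supported near it
(`exists_shrink_family`). The two retracted families coincide, and the unused marked points are
matched color by color in a smaller disk that misses the segments.

For the count, permutations of the positions act transitively on the sequences with prescribed pair
multiplicities, which gives a multinomial number (`card_hasPairCounts`). Relabelling the plants acts
freely on these sequences, and each class contains exactly one sequence whose indices appear in
order, whence the factor `(q+1)!` (`card_feasible`). -/

/-- The values of `f` are numbered in the order of their first occurrences. -/
def FirstOrdered {m N : ℕ} (f : Fin N → Fin m) : Prop :=
  ∀ i j, i < j → ∃ k, f k = i ∧ ∀ l, f l = j → k < l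

theorem exists_first {m N : ℕ} {f : Fin N → Fin m} (hf : Function.Surjective f) :
    ∃ F : Fin m → Fin N, (∀ i, f (F i) = i) ∧ ∀ k, F (f k) ≤ k := by
  have : ∀ i, ∃ k, f k = i ∧ ∀ l, f l = i → k ≤ l := fun i => by
    obtain ⟨k, hk⟩ := hf i
    obtain ⟨m, hm, hm'⟩ := WellFounded.has_min (wellFounded_lt (α := Fin N)) {k | f k = i} ⟨k, hk⟩
    exact ⟨m, hm, fun l hl => not_lt.1 (hm' l hl)⟩
  choose F h1 h2 using this
  exact ⟨F, h1, fun k => h2 _ k rfl⟩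

/-- Only first occurrences matter: the two hypotheses say that `F i` is the first position of the
value `i`. -/
theorem firstOrdered_iff_strictMono {m N : ℕ} {f : Fin N → Fin m} {F : Fin m → Fin N}
    (h1 : ∀ i, f (F i) = i) (h2 : ∀ k, F (f k) ≤ k) : FirstOrdered f ↔ StrictMono F := by
  constructor
  · intro h i j hij
    obtain ⟨k, hk, hk'⟩ := h i j hij
    calc F i = F (f k) := by rw [hk]
      _ ≤ k := h2 k
      _ < F j := hk' _ (h1 j)
  · intro h i j hij
    refine ⟨F i, h1 i, fun l hl => (h hij).trans_le ?_⟩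
    rw [← hl]; exact h2 l

/-- Relabelling by `σ` turns the first-position map `F` into `F ∘ σ.symm`. An injective map from
`Fin m` to a linear order has exactly one increasing rearrangement, namely the sorted enumeration of
its image. -/
theorem existsUnique_firstOrdered {m N : ℕ} {f : Fin N → Fin m} (hf : Function.Surjective f) :
    ∃! σ : Equiv.Perm (Fin m), FirstOrdered (σ ∘ f) := by
  obtain ⟨F, h1, h2⟩ := exists_first hf
  have hF : Function.Injective F := fun i j h => by rw [← h1 i, ← h1 j, h]
  have key : ∀ σ : Equiv.Perm (Fin m), FirstOrdered (σ ∘ f) ↔ StrictMono (F ∘ σ.symm) :=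
    fun σ => firstOrdered_iff_strictMono (fun i => by simp [h1]) (fun k => by simp [h2])
  have hc : (Finset.univ.image F).card = m := by
    rw [Finset.card_image_of_injective _ hF]; simp
  set e := Finset.orderIsoOfFin (Finset.univ.image F) hc
  let G : Fin m → Finset.univ.image F := fun i => ⟨F i, by simp⟩
  have hG : Function.Bijective G := by
    rw [Fintype.bijective_iff_injective_and_card]
    exact ⟨fun i j h => hF (congrArg Subtype.val h), by rw [Fintype.card_coe, hc, Fintype.card_fin]⟩
  have hex : FirstOrdered (((Equiv.ofBijective G hG).trans e.symm.toEquiv) ∘ f) := by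
    rw [key]
    intro i j hij
    have h3 : ∀ i, F (((Equiv.ofBijective G hG).trans e.symm.toEquiv).symm i) = e i := fun i => by
      have := (Equiv.ofBijective G hG).apply_symm_apply (e i)
      exact congrArg Subtype.val this
    simp only [Function.comp_apply, h3]
    exact e.strictMono hij
  refine ⟨_, hex, fun τ hτ => ?_⟩
  have h4 := (key _).1 hτ
  have h5 := (key _).1 hex
  have h6 := (StrictMono.range_inj h4 h5).1 (by simp [Set.range_comp])
  have h7 : ∀ i, τ.symm i = _ := fun i => hF (congrFun h6 i)
  exact Equiv.symm_bijective.injective (Equiv.ext h7)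

theorem FirstOrdered.eq_one {m N : ℕ} {f : Fin N → Fin m} (hf : Function.Surjective f)
    (h : FirstOrdered f) {σ : Equiv.Perm (Fin m)} (h' : FirstOrdered (σ ∘ f)) : σ = 1 :=
  (existsUnique_firstOrdered hf).unique h' h

/-- Each pair `(i, j)` occurs `ξ j` times. -/
def HasPairCounts {q : ℕ} (ω : ICSequence ξ q) : Prop :=
  ∀ i j, Nat.card {k // ω k = (i, j)} = ξ j

theorem HasPairCounts.card_index {q : ℕ} {ω : ICSequence ξ q} (h : HasPairCounts ω)
    (i : Fin (q + 1)) : Nat.card {k // (ω k).1 = i} = ∑ j, ξ j := by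
  classical
  have h' := Finset.sum_congr (s₁ := Finset.univ) rfl fun j _ => h i j
  refine Eq.trans ?_ h'
  simp only [Nat.card_eq_fintype_card, Fintype.card_subtype]
  rw [← Finset.card_biUnion]
  · congr 1
    ext k
    simp [Prod.ext_iff]
  · intro j _ j' _ hjj'
    rw [Function.onFun, Finset.disjoint_left]
    intro k hk hk'
    simp only [Finset.mem_filter, Finset.mem_univ, true_and] at hk hk'
    rw [hk] at hk'
    exact hjj' (congrArg Prod.snd hk')

theorem HasPairCounts.surjective {q : ℕ} {ω : ICSequence ξ q} (h : HasPairCounts ω)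
    (hξ : 0 < ∑ j, ξ j) : Function.Surjective fun k => (ω k).1 := by
  intro i
  have := h.card_index i
  rw [← this, Nat.card_pos_iff] at hξ
  obtain ⟨⟨k, hk⟩⟩ := hξ.1
  exact ⟨k, hk⟩

/-- The count of each index follows from the pair counts. Comparing consecutive indices suffices
because a sequence of first positions is strictly increasing as soon as each step is; positivity of
the sum ensures that every index occurs. -/
theorem isFeasible_iff {q : ℕ} (hξ : 0 < ∑ j, ξ j) (ω : ICSequence ξ q) :
    IsFeasible ω ↔ HasPairCounts ω ∧ FirstOrdered (fun k => (ω k).1) := by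
  constructor
  · rintro ⟨_, h2, h3⟩
    refine ⟨h2, ?_⟩
    obtain ⟨F, f1, f2⟩ := exists_first (HasPairCounts.surjective (ω := ω) h2 hξ)
    rw [firstOrdered_iff_strictMono f1 f2, Fin.strictMono_iff_lt_succ]
    intro i
    obtain ⟨k, hk, hk'⟩ := h3 i.castSucc i.succ (by simp) (F i.succ) (f1 _)
    calc F i.castSucc = F (ω k).1 := by rw [hk']
      _ ≤ k := f2 k
      _ < _ := hk
  · rintro ⟨h2, h3⟩
    refine ⟨h2.card_index, h2, fun i i' hi k' hk' => ?_⟩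
    obtain ⟨k, hk, hk2⟩ := h3 i i' (by rw [Fin.lt_def]; omega)
    exact ⟨k, hk2 _ hk', hk⟩

/-- Orbit–stabilizer for permutations of positions: the sequences with these multiplicities form one
orbit, and a stabilizer is the product of the symmetric groups of the fibres. -/
theorem card_hasPairCounts (ξ : Fin t → ℕ) (q : ℕ) :
    Nat.card {ω : ICSequence ξ q // HasPairCounts ω} * (∏ j, (ξ j).factorial) ^ (q + 1) =
      ((q + 1) * ∑ j, ξ j).factorial := by
  classical
  have hcard : Fintype.card (Σ p : Fin (q + 1) × Fin t, Fin (ξ p.2)) =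
      Fintype.card (Fin ((q + 1) * ∑ i, ξ i)) := by
    simp [Fintype.sum_prod_type]
  let e := (Fintype.equivOfCardEq hcard).symm
  let ω₀ : ICSequence ξ q := fun k => (e k).1
  have hω₀ : HasPairCounts ω₀ := by
    intro i j
    rw [Nat.card_congr (e.subtypeEquiv (q := fun s => s.1 = (i, j)) fun _ => Iff.rfl),
      Nat.card_congr (Equiv.sigmaSubtype (i, j))]
    simp
  -- Equal fibre sizes give bijections between the fibres of `ω` and of `ω₀`; glued together they
  -- are a permutation of the positions that carries one sequence to the other.
  have horb : {ω : ICSequence ξ q | HasPairCounts ω} =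
      MulAction.orbit (Equiv.Perm (Fin ((q + 1) * ∑ i, ξ i)))ᵈᵐᵃ ω₀ := by
    ext ω
    constructor
    · intro h
      have : ∀ p, Nonempty ({k // ω k = p} ≃ {k // ω₀ k = p}) := fun p => by
        rw [← Finite.card_eq]
        exact (h p.1 p.2).trans (hω₀ p.1 p.2).symm
      let E := fun p => (this p).some
      let g : Equiv.Perm (Fin ((q + 1) * ∑ i, ξ i)) :=
        (Equiv.sigmaFiberEquiv ω).symm.trans ((Equiv.sigmaCongrRight E).trans
          (Equiv.sigmaFiberEquiv ω₀))
      refine ⟨DomMulAct.mk g, funext fun k => ?_⟩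
      change ω₀ (g k) = ω k
      exact (E (ω k) ⟨k, rfl⟩).2
    · rintro ⟨g, rfl⟩ i j
      rw [← hω₀ i j]
      exact Nat.card_congr ((DomMulAct.mk.symm g).subtypeEquiv fun _ => Iff.rfl)
  have h1 := Nat.card_congr (MulAction.orbitProdStabilizerEquivGroup
    (Equiv.Perm (Fin ((q + 1) * ∑ i, ξ i)))ᵈᵐᵃ ω₀)
  have h2 : Nat.card (MulAction.stabilizer (Equiv.Perm (Fin ((q + 1) * ∑ i, ξ i)))ᵈᵐᵃ ω₀) =
      (∏ j, (ξ j).factorial) ^ (q + 1) := by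
    have h4 := DomMulAct.stabilizer_card ω₀
    rw [Fintype.prod_prod_type] at h4
    simp only [← Nat.card_eq_fintype_card] at h4
    have h5 : ∀ i j, Nat.card {k // ω₀ k = (i, j)} = ξ j := hω₀
    simp only [h5, Finset.prod_const, Finset.card_univ, Fintype.card_fin] at h4
    rw [← h4]
    exact Nat.card_congr (Equiv.subtypeEquiv DomMulAct.mk.symm
      fun g => DomMulAct.mem_stabilizer_iff)
  rw [Nat.card_prod, h2, ← horb, Nat.card_congr DomMulAct.mk.symm,
    Nat.card_eq_fintype_card (α := Equiv.Perm _), Fintype.card_perm, Fintype.card_fin] at h1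
  exact h1

/-- A feasible sequence and a permutation of the indices determine a sequence with the right pair
counts. This is a bijection, since each such sequence has exactly one relabelling whose indices
first appear in increasing order. -/
theorem card_feasible (q : ℕ) (hξ : 0 < ∑ j, ξ j) :
    Nat.card {ω : ICSequence ξ q // IsFeasible ω} * (q + 1).factorial =
      Nat.card {ω : ICSequence ξ q // HasPairCounts ω} := by
  classical
  let rel : Equiv.Perm (Fin (q + 1)) → ICSequence ξ q → ICSequence ξ q :=
    fun σ ω k => (σ (ω k).1, (ω k).2)
  have hrel : ∀ σ ω, HasPairCounts ω → HasPairCounts (rel σ ω) := fun σ ω h i j => by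
    rw [← h (σ.symm i) j]
    refine Nat.card_congr (Equiv.subtypeEquivRight fun k => ?_)
    simp [rel, Prod.ext_iff, Equiv.eq_symm_apply]
  let Ψ : {ω : ICSequence ξ q // IsFeasible ω} × Equiv.Perm (Fin (q + 1)) →
      {ω : ICSequence ξ q // HasPairCounts ω} :=
    fun p => ⟨rel p.2 p.1.1, hrel _ _ p.1.2.2.1⟩
  have hΨ : Function.Bijective Ψ := by
    constructor
    · rintro ⟨⟨ω, hω⟩, σ⟩ ⟨⟨ω', hω'⟩, σ'⟩ h
      have h1 : rel σ ω = rel σ' ω' := congrArg Subtype.val h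
      have h2 : ω' = rel (σ'⁻¹ * σ) ω := by
        funext k
        have := congrFun h1 k
        simp only [rel, Prod.ext_iff] at this
        simp [rel, this.1, this.2]
      have h3 := ((isFeasible_iff hξ _).1 hω)
      have h4 := ((isFeasible_iff hξ _).1 hω').2
      have h5 := h3.2.eq_one (h3.1.surjective hξ) (σ := σ'⁻¹ * σ) (by rw [h2] at h4; exact h4)
      have h6 : σ = σ' := (inv_mul_eq_one.1 h5).symm
      subst h6
      have : ω = ω' := by rw [h2, h5]; rfl
      subst this
      rfl
    · rintro ⟨ω, hω⟩
      obtain ⟨σ, hσ, -⟩ := existsUnique_firstOrdered (hω.surjective hξ)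
      refine ⟨⟨⟨rel σ ω, (isFeasible_iff hξ _).2 ⟨hrel _ _ hω, hσ⟩⟩, σ⁻¹⟩, Subtype.ext ?_⟩
      funext k
      simp [Ψ, rel]
  rw [← Nat.card_congr (Equiv.ofBijective Ψ hΨ), Nat.card_prod]
  simp [Nat.card_eq_fintype_card, Fintype.card_perm]

end PlantComplex

end

noncomputable section

namespace PlantComplex

variable {t : ℕ} {Δ : MarkedPoints t} {ξ : Fin t → ℕ}

/-! ### Continuous logarithms and the change of the argument along a path -/

/-- The fibres of the covering `exp` are discrete, so a continuous function on a connected set with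
constant exponential is constant. This is how all logarithms below are compared. -/
theorem sub_eq_sub_of_exp_eq {X : Type*} [TopologicalSpace X] {S : Set X} (hS : IsPreconnected S)
    {f g : X → ℂ} (hf : ContinuousOn f S) (hg : ContinuousOn g S)
    (h : ∀ x ∈ S, ∀ y ∈ S, Complex.exp (f x - g x) = Complex.exp (f y - g y))
    {x y : X} (hx : x ∈ S) (hy : y ∈ S) : f x - g x = f y - g y := by
  have hcov := Complex.isCoveringMap_exp
  exact hcov.isSeparatedMap.constOn_of_comp hcov.isLocalHomeomorph.isLocallyInjective hS
    (hf.sub hg) (fun a ha b hb => Subtype.ext (h a ha b hb)) hx hy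

theorem exists_continuousOn_log {E : Type*} [NormedAddCommGroup E] [NormedSpace ℝ E] {S : Set E}
    (hS : Convex ℝ S) (hne : S.Nonempty) {g : E → ℂ} (hg : ContinuousOn g S)
    (h0 : ∀ x ∈ S, g x ≠ 0) :
    ∃ f : E → ℂ, ContinuousOn f S ∧ ∀ x ∈ S, Complex.exp (f x) = g x := by
  classical
  have := hS.locallyPathConnectedSpace
  have := hS.contractibleSpace hne
  have : SimplyConnectedSpace S := inferInstance
  obtain ⟨x₀, hx₀⟩ := hne
  obtain ⟨f, ⟨-, hf⟩, -⟩ := Complex.isCoveringMapOn_exp.existsUnique_continuousMap_lifts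
    (⟨fun x : S => g x, continuousOn_iff_continuous_domRestrict.mp hg⟩ : C(S, ℂ)) (a₀ := ⟨x₀, hx₀⟩)
    (Complex.exp_log (h0 x₀ hx₀)) (fun x => h0 x x.2)
  refine ⟨fun x => if hx : x ∈ S then f ⟨x, hx⟩ else 0, ?_, fun x hx => ?_⟩
  · rw [continuousOn_iff_continuous_domRestrict]
    convert! map_continuous f
    ext x
    simp
  · simp only [hx, dite_true]
    exact congrFun hf ⟨x, hx⟩

/-- `c` is the change of a continuous logarithm of `γ` along the unit interval. -/
def IsLogChange (γ : ℝ → ℂ) (c : ℂ) : Prop :=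
  ∃ L : ℝ → ℂ, ContinuousOn L (Icc 0 1) ∧ (∀ s ∈ Icc (0 : ℝ) 1, Complex.exp (L s) = γ s) ∧
    c = L 1 - L 0

/-- A constant factor shifts a logarithm by a constant and leaves its change alone. The factor `z`
will be `1` or `-1`. -/
theorem IsLogChange.eq_sub {γ : ℝ → ℂ} {c : ℂ} (h : IsLogChange γ c) {L : ℝ → ℂ}
    (hL : ContinuousOn L (Icc 0 1)) {z : ℂ}
    (h' : ∀ s ∈ Icc (0 : ℝ) 1, Complex.exp (L s) = γ s * z) : c = L 1 - L 0 := by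
  obtain ⟨L', h1, h2, rfl⟩ := h
  have h01 : (0 : ℝ) ∈ Icc (0 : ℝ) 1 := by simp
  have h11 : (1 : ℝ) ∈ Icc (0 : ℝ) 1 := by simp
  have hq : ∀ x ∈ Icc (0 : ℝ) 1, Complex.exp (L x - L' x) = z := fun x hx => by
    rw [Complex.exp_sub, h' x hx, ← h2 x hx]
    field_simp [Complex.exp_ne_zero]
  have := sub_eq_sub_of_exp_eq (isPreconnected_Icc) hL h1
    (fun x hx y hy => by rw [hq x hx, hq y hy]) h01 h11
  linear_combination this

theorem exists_isLogChange {γ : ℝ → ℂ} (hγ : ContinuousOn γ (Icc 0 1))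
    (h0 : ∀ s ∈ Icc (0 : ℝ) 1, γ s ≠ 0) : ∃ c, IsLogChange γ c := by
  obtain ⟨L, h1, h2⟩ := exists_continuousOn_log (convex_Icc (0 : ℝ) 1) ⟨0, by simp⟩ hγ h0
  exact ⟨_, L, h1, h2, rfl⟩

theorem IsLogChange.comp {γ γ' : ℝ → ℂ} {c : ℂ} (h : IsLogChange γ' c) {σ : ℝ → ℝ}
    (hσ : ContinuousOn σ (Icc 0 1)) (hm : MapsTo σ (Icc 0 1) (Icc 0 1)) (h0 : σ 0 = 0)
    (h1 : σ 1 = 1) (hγ : ∀ s ∈ Icc (0 : ℝ) 1, γ s = γ' (σ s)) : IsLogChange γ c := by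
  obtain ⟨L, hL, hL', rfl⟩ := h
  exact ⟨L ∘ σ, hL.comp hσ hm, fun s hs => by rw [hγ s hs]; exact hL' _ (hm hs),
    by simp [h0, h1]⟩

/-- A logarithm of the whole homotopy exists on the square; it is constant on the two sides where
the end points stay fixed. -/
theorem IsLogChange.homotopy {F : ℝ × ℝ → ℂ} (hF : ContinuousOn F (Icc 0 1 ×ˢ Icc 0 1))
    (hne : ∀ x ∈ (Icc 0 1 ×ˢ Icc 0 1 : Set (ℝ × ℝ)), F x ≠ 0)
    (h0 : ∀ τ ∈ Icc (0 : ℝ) 1, F (τ, 0) = F (0, 0)) (h1 : ∀ τ ∈ Icc (0 : ℝ) 1, F (τ, 1) = F (0, 1))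
    {c : ℂ} (h : IsLogChange (fun s => F (0, s)) c) : IsLogChange (fun s => F (1, s)) c := by
  obtain ⟨L, hL, hL'⟩ := exists_continuousOn_log ((convex_Icc (0 : ℝ) 1).prod (convex_Icc (0 : ℝ) 1))
    ⟨(0, 0), by simp⟩ hF hne
  have h01 : (0 : ℝ) ∈ Icc (0 : ℝ) 1 := by simp
  have h11 : (1 : ℝ) ∈ Icc (0 : ℝ) 1 := by simp
  have hr : ∀ τ ∈ Icc (0 : ℝ) 1, ContinuousOn (fun s : ℝ => L (τ, s)) (Icc 0 1) := fun τ hτ =>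
    hL.comp (by fun_prop) fun s hs => ⟨hτ, hs⟩
  have hc : ∀ s ∈ Icc (0 : ℝ) 1, ContinuousOn (fun τ : ℝ => L (τ, s)) (Icc 0 1) := fun τ hτ =>
    hL.comp (by fun_prop) fun s hs => ⟨hs, hτ⟩
  have key : ∀ s ∈ Icc (0 : ℝ) 1, (∀ τ ∈ Icc (0 : ℝ) 1, F (τ, s) = F (0, s)) → L (0, s) = L (1, s) := by
    intro s hs h
    have := sub_eq_sub_of_exp_eq isPreconnected_Icc (hc s hs)
      (continuousOn_const (c := (0 : ℂ))) (fun x hx y hy => by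
        rw [sub_zero, sub_zero, hL' (x, s) ⟨hx, hs⟩, hL' (y, s) ⟨hy, hs⟩, h x hx, h y hy]) h01 h11
    simpa using this
  have e := h.eq_sub (hr 0 h01) (z := 1) fun s hs => by
    rw [hL' (0, s) ⟨h01, hs⟩, mul_one]
  refine ⟨fun s => L (1, s), hr 1 h11, fun s hs => hL' (1, s) ⟨h11, hs⟩, ?_⟩
  rw [e, key 0 h01 h0, key 1 h11 h1]

/-! ### Initial directions and the winding of two paths around each other's end points. -/

theorem eventually_pos_of_hasDerivWithinAt {f : ℝ → ℝ} {f' : ℝ}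
    (hf : HasDerivWithinAt f f' (Icc 0 1) 0) (h0 : f 0 = 0) (hf' : 0 < f') :
    ∃ ε > 0, ε ≤ 1 ∧ ∀ s, 0 < s → s ≤ ε → 0 < f s := by
  have h1 := hasDerivWithinAt_iff_tendsto_slope.1 hf
  rw [show Icc (0 : ℝ) 1 \ {0} = Ioc 0 1 from Icc_sdiff_left] at h1
  have h2 := h1.eventually (lt_mem_nhds hf')
  rw [nhdsWithin_Ioc_eq_nhdsGT one_pos, eventually_nhdsWithin_iff, Metric.eventually_nhds_iff] at h2
  obtain ⟨ε, hε, h3⟩ := h2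
  refine ⟨min (ε / 2) 1, by positivity, min_le_right _ _, fun s hs hs' => ?_⟩
  have h4 := h3 (y := s) (by
    rw [Real.dist_0_eq_abs, abs_of_pos hs]; linarith [min_le_left (ε / 2) 1]) hs
  rw [slope_def_field, h0, sub_zero, sub_zero] at h4
  exact (div_pos_iff_of_pos_right hs).1 h4

/-- The argument of `a s - a 0` is that of the difference quotient, as `s` is positive. The
direction can thus be read off from positions alone, without regard to the parametrization. -/
theorem tendsto_arg_sub {a : ℝ → ℂ} {va : ℂ} (ha : HasDerivWithinAt a va (Icc 0 1) 0)
    (hva : 0 < va.im) :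
    Filter.Tendsto (fun s => (a s - a 0).arg) (nhdsWithin 0 (Ioi 0)) (nhds va.arg) := by
  have h1 := hasDerivWithinAt_iff_tendsto_slope.1 ha
  rw [show Icc (0 : ℝ) 1 \ {0} = Ioc 0 1 from Icc_sdiff_left, nhdsWithin_Ioc_eq_nhdsGT one_pos] at h1
  have h2 := (Complex.continuousAt_arg (x := va) (Or.inr hva.ne')).tendsto.comp h1
  refine h2.congr' ?_
  filter_upwards [self_mem_nhdsWithin] with s hs
  have hs : 0 < s := hs
  rw [Function.comp_apply, slope_def_module, sub_zero, Complex.real_smul,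
    Complex.arg_real_mul _ (by positivity)]

theorem exists_re_mul_pos {u w : ℂ} (hu : u ≠ 0) (hw : w ≠ 0) (h : u.arg ≠ w.arg) :
    ∃ d : ℂ, 0 < (u * d).re ∧ 0 < (-w * d).re := by
  have hu' : 0 < ‖u‖ := norm_pos_iff.2 hu
  have hw' : 0 < ‖w‖ := norm_pos_iff.2 hw
  -- This is the conjugate of `‖w‖ u - ‖u‖ w`, the difference of the two unit vectors up to scale;
  -- positivity is the strict Cauchy–Schwarz inequality.
  refine ⟨‖w‖ * (starRingEnd ℂ) u - ‖u‖ * (starRingEnd ℂ) w, ?_⟩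
  have hle : u.re * w.re + u.im * w.im < ‖u‖ * ‖w‖ := by
    refine lt_of_le_of_ne ?_ ?_
    · have := Complex.abs_re_le_norm (u * (starRingEnd ℂ) w)
      rw [norm_mul, RCLike.norm_conj] at this
      have h2 := le_abs_self (u * (starRingEnd ℂ) w).re
      simp at h2 this
      linarith
    · intro he
      apply h
      have e1 : ‖u‖ ^ 2 = u.re ^ 2 + u.im ^ 2 := by
        rw [Complex.sq_norm, Complex.normSq_apply]; ring
      have e2 : ‖w‖ ^ 2 = w.re ^ 2 + w.im ^ 2 := by
        rw [Complex.sq_norm, Complex.normSq_apply]; ring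
      have e3 : (‖w‖ * u.re - ‖u‖ * w.re) ^ 2 + (‖w‖ * u.im - ‖u‖ * w.im) ^ 2 = 0 := by
        linear_combination -2 * ‖u‖ * ‖w‖ * he - ‖w‖ ^ 2 * e1 - ‖u‖ ^ 2 * e2
      have e4 : ‖w‖ * u.re - ‖u‖ * w.re = 0 := by nlinarith [sq_nonneg (‖w‖ * u.im - ‖u‖ * w.im)]
      have e5 : ‖w‖ * u.im - ‖u‖ * w.im = 0 := by nlinarith [sq_nonneg (‖w‖ * u.re - ‖u‖ * w.re)]
      have e6 : (‖w‖ : ℂ) * u = (‖u‖ : ℂ) * w := by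
        apply Complex.ext
        · simp; linarith
        · simp; linarith
      rw [← Complex.arg_real_mul u hw', e6, Complex.arg_real_mul w hu']
  have e1 : ‖u‖ ^ 2 = u.re ^ 2 + u.im ^ 2 := by
    rw [Complex.sq_norm, Complex.normSq_apply]; ring
  have e2 : ‖w‖ ^ 2 = w.re ^ 2 + w.im ^ 2 := by
    rw [Complex.sq_norm, Complex.normSq_apply]; ring
  constructor
  · have : (u * (‖w‖ * (starRingEnd ℂ) u - ‖u‖ * (starRingEnd ℂ) w)).re =
        ‖u‖ * (‖u‖ * ‖w‖ - (u.re * w.re + u.im * w.im)) := by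
      simp; linear_combination -‖w‖ * e1
    rw [this]
    exact mul_pos hu' (by linarith)
  · have : (-w * (‖w‖ * (starRingEnd ℂ) u - ‖u‖ * (starRingEnd ℂ) w)).re =
        ‖w‖ * (‖u‖ * ‖w‖ - (u.re * w.re + u.im * w.im)) := by
      simp; linear_combination -‖u‖ * e2
    rw [this]
    exact mul_pos hw' (by linarith)

/-- For two paths in the upper half plane above their common starting point `a 0 = b 0` which do
not meet otherwise, the winding of each of them around the end point of the other one determines
which of them starts to the left. -/
theorem logChange_sub {a b : ℝ → ℂ} (ha : ContinuousOn a (Icc 0 1)) (hb : ContinuousOn b (Icc 0 1))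
    (hab : a 0 = b 0)
    (hne : ∀ s ∈ Icc (0 : ℝ) 1, ∀ u ∈ Icc (0 : ℝ) 1, a s = b u → s = 0 ∧ u = 0)
    (ha' : ∀ s ∈ Ioc (0 : ℝ) 1, 0 < (a s - a 0).im) (hb' : ∀ s ∈ Ioc (0 : ℝ) 1, 0 < (b s - b 0).im)
    {va vb : ℂ} (hva : HasDerivWithinAt a va (Icc 0 1) 0) (hvb : HasDerivWithinAt b vb (Icc 0 1) 0)
    (hva' : 0 < va.im) (hvb' : 0 < vb.im) (harg : vb.arg < va.arg) {ca cb : ℂ}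
    (hca : IsLogChange (fun s => a s - b 1) ca) (hcb : IsLogChange (fun s => b s - a 1) cb) :
    (ca - cb).im = (a 1 - a 0).arg - (b 1 - b 0).arg - Real.pi := by
  have h01 : (0 : ℝ) ∈ Icc (0 : ℝ) 1 := by simp
  have h11 : (1 : ℝ) ∈ Icc (0 : ℝ) 1 := by simp
  -- The difference `a s - b u` vanishes only at the corner of the square. The square without this
  -- corner is still convex, so a logarithm of the difference exists on it.
  have hconv : ∀ ε : ℝ, 0 < ε → Convex ℝ ((Icc 0 ε ×ˢ Icc 0 ε) \ {((0 : ℝ), (0 : ℝ))}) := by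
    intro ε hε
    have : ((Icc 0 ε ×ˢ Icc 0 ε) \ {((0 : ℝ), (0 : ℝ))}) =
        (Icc 0 ε ×ˢ Icc 0 ε) ∩ {p : ℝ × ℝ | 0 < p.1 + p.2} := by
      ext ⟨x, y⟩
      simp only [mem_sdiff, mem_prod, mem_Icc, mem_singleton_iff, Prod.mk.injEq, mem_inter_iff,
        mem_ofPred_eq]
      refine and_congr_right fun h => ⟨fun h' => ?_, fun h' h'' => ?_⟩
      · by_contra h3
        exact h' ⟨by linarith, by linarith⟩
      · linarith
    rw [this]
    refine ((convex_Icc _ _).prod (convex_Icc _ _)).inter ?_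
    exact convex_halfSpace_gt (f := fun p : ℝ × ℝ => p.1 + p.2)
      ⟨fun x y => by simp; ring, fun c x => by simp; ring⟩ 0
  set S : Set (ℝ × ℝ) := (Icc 0 1 ×ˢ Icc 0 1) \ {(0, 0)} with hSdef
  have hgc : ContinuousOn (fun p : ℝ × ℝ => a p.1 - b p.2) (Icc 0 1 ×ˢ Icc 0 1) :=
    (ha.comp continuousOn_fst fun p hp => hp.1).sub (hb.comp continuousOn_snd fun p hp => hp.2)
  obtain ⟨Θ, hΘ, hΘe⟩ := exists_continuousOn_log (hconv 1 one_pos) ⟨(1, 1), by simp⟩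
    (hgc.mono sdiff_subset) (by
      rintro ⟨s, u⟩ ⟨⟨hs, hu⟩, h⟩ h'
      obtain ⟨rfl, rfl⟩ := hne s hs u hu (sub_eq_zero.1 h')
      exact h rfl)
  have m1 : ∀ s ∈ Icc (0 : ℝ) 1, (s, (1 : ℝ)) ∈ S := fun s hs => ⟨⟨hs, h11⟩, by simp⟩
  have m2 : ∀ s ∈ Icc (0 : ℝ) 1, ((1 : ℝ), s) ∈ S := fun s hs => ⟨⟨h11, hs⟩, by simp⟩
  have m3 : ∀ s ∈ Ioc (0 : ℝ) 1, (s, (0 : ℝ)) ∈ S := fun s hs =>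
    ⟨⟨⟨hs.1.le, hs.2⟩, h01⟩, by simp [hs.1.ne']⟩
  have m4 : ∀ s ∈ Ioc (0 : ℝ) 1, ((0 : ℝ), s) ∈ S := fun s hs =>
    ⟨⟨h01, ⟨hs.1.le, hs.2⟩⟩, by simp [hs.1.ne']⟩
  -- The changes `ca` and `cb` live on the two sides of the square away from the corner, so their
  -- difference is `Θ (1, 0) - Θ (0, 1)`; the sign `-1` in `e2` turns `b s - a 1` into `a 1 - b s`.
  have e1 : ca = Θ (1, 1) - Θ (0, 1) := hca.eq_sub (L := fun s => Θ (s, 1)) (z := 1)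
    (hΘ.comp (by fun_prop) fun s hs => m1 s hs) fun s hs => by
      rw [hΘe _ (m1 s hs), mul_one]
  have e2 : cb = Θ (1, 1) - Θ (1, 0) := hcb.eq_sub (L := fun s => Θ (1, s)) (z := -1)
    (hΘ.comp (by fun_prop) fun s hs => m2 s hs) fun s hs => by
      rw [hΘe _ (m2 s hs)]; ring
  have I1 : (1 : ℝ) ∈ Ioc (0 : ℝ) 1 := by simp
  -- the two sides of the corner
  have hlog : ∀ c : ℝ → ℂ, ContinuousOn c (Icc 0 1) → (∀ s ∈ Ioc (0 : ℝ) 1, 0 < (c s - c 0).im) →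
      ContinuousOn (fun s => Complex.log (c s - c 0)) (Ioc 0 1) := fun c hc hc' =>
    ((hc.mono Ioc_subset_Icc_self).sub continuousOn_const).clog fun s hs =>
      Or.inr (hc' s hs).ne'
  have s1 : ∀ s ∈ Ioc (0 : ℝ) 1, Θ (s, 0) - Complex.log (a s - a 0) =
      Θ (1, 0) - Complex.log (a 1 - a 0) := fun s hs => by
    refine sub_eq_sub_of_exp_eq (f := fun s => Θ (s, 0)) (g := fun s => Complex.log (a s - a 0))
      isPreconnected_Ioc (hΘ.comp (by fun_prop) fun s hs => m3 s hs) (hlog a ha ha')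
      (fun x hx y hy => ?_) hs I1
    have : ∀ x ∈ Ioc (0 : ℝ) 1, Complex.exp (Θ (x, 0) - Complex.log (a x - a 0)) = 1 := by
      intro x hx
      have h0 : a x - a 0 ≠ 0 := fun h => by have := ha' x hx; simp [h] at this
      rw [Complex.exp_sub, hΘe _ (m3 x hx), Complex.exp_log h0, ← hab, div_self h0]
    rw [this x hx, this y hy]
  have s2' : ∀ x ∈ Ioc (0 : ℝ) 1, Complex.exp (Θ (0, x) - Complex.log (b x - b 0)) = -1 := by
    intro x hx
    have h0 : b x - b 0 ≠ 0 := fun h => by have := hb' x hx; simp [h] at this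
    rw [Complex.exp_sub, hΘe _ (m4 x hx), Complex.exp_log h0, hab, ← neg_sub, neg_div,
      div_self h0]
  have s2 : ∀ s ∈ Ioc (0 : ℝ) 1, Θ (0, s) - Complex.log (b s - b 0) =
      Θ (0, 1) - Complex.log (b 1 - b 0) := fun s hs =>
    sub_eq_sub_of_exp_eq (f := fun s => Θ (0, s)) (g := fun s => Complex.log (b s - b 0))
      isPreconnected_Ioc (hΘ.comp (by fun_prop) fun s hs => m4 s hs) (hlog b hb hb')
      (fun x hx y hy => by rw [s2' x hx, s2' y hy]) hs I1
  -- On the two sides that meet at the corner `Θ` differs from a principal logarithm by the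
  -- constants `C₁` and `C₂`. It remains to find which odd multiple of `π` the imaginary part of `C₁
  -- - C₂` is.
  set C₁ := Θ (1, 0) - Complex.log (a 1 - a 0) with hC₁
  set C₂ := Θ (0, 1) - Complex.log (b 1 - b 0) with hC₂
  have hC1 : Complex.exp C₁ = 1 := by
    have h0 : a 1 - a 0 ≠ 0 := fun h => by have := ha' 1 I1; simp [h] at this
    rw [hC₁, Complex.exp_sub, hΘe _ (m3 1 I1), Complex.exp_log h0, ← hab, div_self h0]
  have hC2 : Complex.exp C₂ = -1 := s2' 1 I1
  obtain ⟨n, hn⟩ : ∃ n : ℤ, C₁ - C₂ = Real.pi * Complex.I + n * (2 * Real.pi * Complex.I) := by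
    have : Complex.exp (C₁ - C₂) = Complex.exp (Real.pi * Complex.I) := by
      rw [Complex.exp_sub, hC1, hC2, Complex.exp_pi_mul_I]; norm_num
    exact Complex.exp_eq_exp_iff_exists_int.1 this
  have hnim : (C₁ - C₂).im = Real.pi + n * (2 * Real.pi) := by
    rw [hn]; simp
  -- the corner
  have hva0 : va ≠ 0 := fun h => by simp [h] at hva'
  have hvb0 : vb ≠ 0 := fun h => by simp [h] at hvb'
  obtain ⟨d, hd1, hd2⟩ := exists_re_mul_pos hva0 hvb0 harg.ne'
  have hd0 : d ≠ 0 := fun h => by simp [h] at hd1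
  have hder : ∀ (c : ℝ → ℂ) (v w : ℂ), HasDerivWithinAt c v (Icc 0 1) 0 →
      HasDerivWithinAt (fun s => ((c s - c 0) * w).re) (v * w).re (Icc 0 1) 0 := by
    intro c v w h
    exact Complex.reCLM.hasFDerivAt.comp_hasDerivWithinAt (0 : ℝ)
      ((h.sub_const (c 0)).mul_const w)
  obtain ⟨ε₁, hε₁, hε₁', p1⟩ := eventually_pos_of_hasDerivWithinAt (hder a va d hva)
    (by simp) hd1
  obtain ⟨ε₂, hε₂, hε₂', p2⟩ := eventually_pos_of_hasDerivWithinAt (hder b vb (-d) hvb)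
    (by simp) (by simpa using hd2)
  set ε := min ε₁ ε₂ with hε
  have hε0 : 0 < ε := lt_min hε₁ hε₂
  have hεle : ε ≤ 1 := (min_le_left _ _).trans hε₁'
  set Q : Set (ℝ × ℝ) := (Icc 0 ε ×ˢ Icc 0 ε) \ {(0, 0)} with hQdef
  have hQS : Q ⊆ S := sdiff_subset_sdiff_left
    (prod_mono (Icc_subset_Icc_right hεle) (Icc_subset_Icc_right hεle))
  -- Near the corner `a s - a 0` lies on one side of the line determined by `d` and `b u - b 0` on
  -- the other. Hence `a s - b u` stays in a half plane and the imaginary part of `Θ` varies by at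
  -- most `π` there.
  have hQpos : ∀ p ∈ Q, 0 < ((a p.1 - b p.2) * d).re := by
    rintro ⟨s, u⟩ ⟨⟨hs, hu⟩, h⟩
    have q1 : 0 ≤ ((a s - a 0) * d).re := by
      rcases hs.1.eq_or_lt with h | h
      · rw [show s = 0 from h.symm]; simp
      · exact (p1 s h (hs.2.trans (min_le_left _ _))).le
    have q2 : 0 ≤ ((b u - b 0) * (-d)).re := by
      rcases hu.1.eq_or_lt with h | h
      · rw [show u = 0 from h.symm]; simp
      · exact (p2 u h (hu.2.trans (min_le_right _ _))).le
    have q3 : ((a s - b u) * d).re = ((a s - a 0) * d).re + ((b u - b 0) * (-d)).re := by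
      rw [← Complex.add_re, hab]; congr 1; ring
    change 0 < ((a s - b u) * d).re
    rw [q3]
    rcases hs.1.eq_or_lt with h1 | h1
    · have h2 : 0 < u := lt_of_le_of_ne hu.1 fun h2 => h (Prod.ext h1.symm h2.symm)
      linarith [p2 u h2 (hu.2.trans (min_le_right _ _))]
    · linarith [p1 s h1 (hs.2.trans (min_le_left _ _))]
  have hQc : ContinuousOn (fun p : ℝ × ℝ => Complex.log ((a p.1 - b p.2) * d)) Q :=
    ((hgc.mono (hQS.trans sdiff_subset)).mul continuousOn_const).clog fun p hp =>
      Or.inl (hQpos p hp)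
  have hQe : ∀ p ∈ Q, Complex.exp (Θ p - Complex.log ((a p.1 - b p.2) * d)) = d⁻¹ := by
    intro p hp
    have h0 : (a p.1 - b p.2) * d ≠ 0 := fun h => by have := hQpos p hp; simp [h] at this
    rw [Complex.exp_sub, hΘe p (hQS hp), Complex.exp_log h0]
    have := left_ne_zero_of_mul h0
    field_simp
  have hQb : ∀ p ∈ Q, ∀ p' ∈ Q, |(Θ p).im - (Θ p').im| ≤ Real.pi := by
    intro p hp p' hp'
    have h1 := sub_eq_sub_of_exp_eq (hconv ε hε0).isPreconnected (hΘ.mono hQS) hQc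
      (fun x hx y hy => by rw [hQe x hx, hQe y hy]) hp hp'
    have h2 := congrArg Complex.im h1
    simp only [Complex.sub_im, Complex.log_im] at h2
    have h3 := abs_lt.1 (Complex.abs_arg_lt_pi_div_two_iff.2 (Or.inl (hQpos p hp)))
    have h4 := abs_lt.1 (Complex.abs_arg_lt_pi_div_two_iff.2 (Or.inl (hQpos p' hp')))
    rw [abs_le]
    constructor <;> linarith [h3.1, h3.2, h4.1, h4.2]
  have hlim : |va.arg - vb.arg + (C₁ - C₂).im| ≤ Real.pi := by
    have h1 := (((tendsto_arg_sub hva hva').sub (tendsto_arg_sub hvb hvb')).add_const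
      ((C₁ - C₂).im)).abs
    refine le_of_tendsto h1 ?_
    filter_upwards [Ioc_mem_nhdsGT hε0] with s hs
    have hs' : s ∈ Ioc (0 : ℝ) 1 := ⟨hs.1, hs.2.trans hεle⟩
    have h2 := hQb (s, 0) ⟨⟨⟨hs.1.le, hs.2⟩, ⟨le_rfl, hε0.le⟩⟩, by simp [hs.1.ne']⟩
      (0, s) ⟨⟨⟨le_rfl, hε0.le⟩, ⟨hs.1.le, hs.2⟩⟩, by simp [hs.1.ne']⟩
    have h3 := congrArg Complex.im (s1 s hs')
    have h4 := congrArg Complex.im (s2 s hs')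
    simp only [Complex.sub_im, Complex.log_im] at h3 h4
    refine le_trans (le_of_eq ?_) h2
    rw [Complex.sub_im]
    congr 1
    linarith
  have hpi := Real.pi_pos
  have hα : va.arg - vb.arg < Real.pi := by
    have h1 : 0 ≤ vb.arg := Complex.arg_nonneg_iff.2 hvb'.le
    have h2 : va.arg < Real.pi := Complex.arg_lt_pi_iff.2 (Or.inr hva'.ne')
    linarith
  rw [hnim, abs_le] at hlim
  -- With `α = va.arg - vb.arg` in `(0, π)`, the bound `|α + π + 2πn| ≤ π` leaves only this value.
  -- Here the order of the tangents enters.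
  have hn1 : n = -1 := by
    have h1 : (n : ℝ) < 0 := by
      by_contra h
      push Not at h
      nlinarith
    have h2 : (-2 : ℝ) < n := by
      by_contra h
      push Not at h
      nlinarith
    have h1' : n < 0 := by exact_mod_cast h1
    have h2' : -2 < n := by exact_mod_cast h2
    omega
  have e3 : (ca - cb).im = (Θ (1, 0)).im - (Θ (0, 1)).im := by
    rw [e1, e2]; simp
  have h3 := congrArg Complex.im hC₁
  have h4 := congrArg Complex.im hC₂
  simp only [Complex.sub_im, Complex.log_im] at h3 h4 hnim e3 ⊢
  rw [hn1] at hnim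
  push_cast at hnim
  linarith

end PlantComplex

end

noncomputable section

namespace PlantComplex

variable {t : ℕ} {Δ : MarkedPoints t} {ξ : Fin t → ℕ}

/-! ### Basic properties of arcs -/

theorem neg_one_lt_im {z : ℂ} (hz : ‖z‖ ≤ 1) (h : z ≠ -Complex.I) : -1 < z.im := by
  by_contra hlt
  push Not at hlt
  have h1 := Complex.abs_im_le_norm z
  have h2 : z.im = -1 := by
    have := (abs_le.1 (h1.trans hz)).1
    linarith
  have h3 : z.re ^ 2 + z.im ^ 2 ≤ 1 := by
    have : ‖z‖ ^ 2 ≤ 1 := by nlinarith [norm_nonneg z]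
    rw [Complex.sq_norm, Complex.normSq_apply] at this
    linarith
  have h4 : z.re = 0 := by rw [h2] at h3; nlinarith [sq_nonneg z.re]
  exact h (Complex.ext (by simp [h4]) (by simp [h2]))

namespace Arc

theorem continuousOn (a : Arc Δ) : ContinuousOn a.toFun (Icc 0 1) := a.smooth.continuousOn

theorem hasDerivWithinAt (a : Arc Δ) {s : ℝ} (hs : s ∈ Icc (0 : ℝ) 1) :
    HasDerivWithinAt a.toFun (derivWithin a.toFun (Icc 0 1) s) (Icc 0 1) s :=
  (a.smooth.differentiableOn (by simp) s hs).hasDerivWithinAt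

/-- The arc as a path in the disk. -/
def pt (a : Arc Δ) (s : unitInterval) : Disk := ⟨a.toFun s, by simpa using a.norm_le_one s.2⟩

/-- The end point of an arc. -/
def tip (a : Arc Δ) : Disk := a.pt 1

theorem pt_zero (a : Arc Δ) : a.pt 0 = base := Subtype.ext a.start

theorem coe_tip (a : Arc Δ) : (a.tip : ℂ) = a.toFun 1 := rfl

theorem continuous_pt (a : Arc Δ) : Continuous a.pt :=
  (continuousOn_iff_continuous_domRestrict.1 a.continuousOn).subtype_mk _

theorem pt_injective (a : Arc Δ) : Function.Injective a.pt := fun s u h =>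
  Subtype.ext (a.injOn s.2 u.2 (congrArg Subtype.val h))

theorem isClosedEmbedding_pt (a : Arc Δ) : Topology.IsClosedEmbedding a.pt :=
  a.continuous_pt.isClosedEmbedding a.pt_injective

theorem carrier_eq_range (a : Arc Δ) : a.carrier = range a.pt := by
  ext z
  constructor
  · rintro ⟨s, hs, h⟩; exact ⟨⟨s, hs⟩, Subtype.ext h⟩
  · rintro ⟨s, rfl⟩; exact ⟨s, s.2, rfl⟩

theorem pt_mem (a : Arc Δ) (s : unitInterval) : a.pt s ∈ a.carrier := by
  rw [carrier_eq_range]; exact mem_range_self s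

theorem tip_mem (a : Arc Δ) : a.tip ∈ a.carrier := a.pt_mem 1

theorem base_mem (a : Arc Δ) : base ∈ a.carrier := by rw [← a.pt_zero]; exact a.pt_mem 0

theorem isClosed_carrier (a : Arc Δ) : IsClosed a.carrier := by
  rw [carrier_eq_range]; exact a.isClosedEmbedding_pt.isClosed_range

theorem tip_marked (a : Arc Δ) : ∃ i, (a.tip : ℂ) ∈ Δ.pts i := a.finish

theorem tip_ne_base (a : Arc Δ) : a.tip ≠ base := by
  intro h
  obtain ⟨i, hi⟩ := a.tip_marked
  have := Δ.norm_lt_one i _ hi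
  rw [h] at this
  simp [base] at this

theorem pt_marked (a : Arc Δ) {s : unitInterval} {i : Fin t} (h : (a.pt s : ℂ) ∈ Δ.pts i) :
    s = 1 := by
  rcases s.2.1.eq_or_lt with h0 | h0
  · have : s = 0 := Subtype.ext h0.symm
    rw [this, pt_zero] at h
    have := Δ.norm_lt_one i _ h
    simp [base] at this
  rcases s.2.2.eq_or_lt with h1 | h1
  · exact Subtype.ext h1
  · exact absurd h ((a.interior s ⟨h0, h1⟩).2 i)

theorem eq_tip (a : Arc Δ) {z : Disk} (hz : z ∈ a.carrier) {i : Fin t} (h : (z : ℂ) ∈ Δ.pts i) :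
    z = a.tip := by
  rw [carrier_eq_range] at hz
  obtain ⟨s, rfl⟩ := hz
  rw [a.pt_marked h]; rfl

theorem im_sub_pos (a : Arc Δ) {s : ℝ} (hs : s ∈ Ioc (0 : ℝ) 1) :
    0 < (a.toFun s - a.toFun 0).im := by
  have hs' : s ∈ Icc (0 : ℝ) 1 := ⟨hs.1.le, hs.2⟩
  rw [a.start]
  have := neg_one_lt_im (a.norm_le_one hs') fun h => hs.1.ne'
    (a.injOn hs' (by simp) (h.trans a.start.symm))
  simp
  linarith

theorem hasDerivWithinAt_zero (a : Arc Δ) : HasDerivWithinAt a.toFun a.tangent (Icc 0 1) 0 :=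
  a.hasDerivWithinAt (by simp)

/-- The disk lies above its lowest point `-i`, so the height of the arc cannot start to decrease;
transversality excludes a horizontal start. -/
theorem tangent_im_pos (a : Arc Δ) : 0 < a.tangent.im := by
  refine lt_of_le_of_ne ?_ (Ne.symm a.transverse)
  have h1 : HasDerivWithinAt (fun s => (a.toFun s).im) a.tangent.im (Icc 0 1) 0 :=
    Complex.imCLM.hasFDerivAt.comp_hasDerivWithinAt (0 : ℝ) a.hasDerivWithinAt_zero
  have h2 := hasDerivWithinAt_iff_tendsto_slope.1 h1
  rw [show Icc (0 : ℝ) 1 \ {0} = Ioc 0 1 from Icc_sdiff_left] at h2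
  have : (nhdsWithin (0 : ℝ) (Ioc 0 1)).NeBot := by
    rw [nhdsWithin_Ioc_eq_nhdsGT one_pos]; infer_instance
  refine ge_of_tendsto h2 ?_
  filter_upwards [self_mem_nhdsWithin] with s hs
  rw [slope_def_field]
  have h3 := a.im_sub_pos hs
  rw [Complex.sub_im] at h3
  exact div_nonneg h3.le (by linarith [hs.1])

end Arc

theorem Arc.eq_zero_of_eq {a b : Arc Δ} (hab : a.carrier ∩ b.carrier = {base}) {s u : ℝ}
    (hs : s ∈ Icc (0 : ℝ) 1) (hu : u ∈ Icc (0 : ℝ) 1) (h : a.toFun s = b.toFun u) :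
    s = 0 ∧ u = 0 := by
  have h1 : a.pt ⟨s, hs⟩ = b.pt ⟨u, hu⟩ := Subtype.ext h
  have h2 : a.pt ⟨s, hs⟩ ∈ a.carrier ∩ b.carrier := ⟨a.pt_mem _, h1 ▸ b.pt_mem _⟩
  rw [hab, mem_singleton_iff] at h2
  have h3 := h2
  rw [← a.pt_zero] at h2
  rw [h1, ← b.pt_zero] at h3
  exact ⟨congrArg Subtype.val (a.pt_injective h2), congrArg Subtype.val (b.pt_injective h3)⟩

theorem tip_ne_tip {a b : Arc Δ} (hab : a.carrier ∩ b.carrier = {base}) : a.tip ≠ b.tip :=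
  fun h => a.tip_ne_base (by
    have : a.tip ∈ a.carrier ∩ b.carrier := ⟨a.tip_mem, h ▸ b.tip_mem⟩
    rwa [hab] at this)

/-! ### Isotopies and the order of arcs at the base point -/

theorem isotopy_fixesBoundary {φ : Disk ≃ₜ Disk} (hφ : φ ∈ isotopyGroup Δ) : FixesBoundary φ := by
  obtain ⟨H, -, -, h1, h⟩ := hφ
  rw [← h1]; exact (h 1).1

theorem isotopy_fixesMarked {φ : Disk ≃ₜ Disk} (hφ : φ ∈ isotopyGroup Δ) : FixesMarked Δ φ := by
  obtain ⟨H, -, -, h1, h⟩ := hφ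
  rw [← h1]; exact (h 1).2

theorem isotopy_base {φ : Disk ≃ₜ Disk} (hφ : φ ∈ isotopyGroup Δ) : φ base = base :=
  isotopy_fixesBoundary hφ base (by simp [base])

theorem tip_eq_of_image {φ : Disk ≃ₜ Disk} (hφ : φ ∈ isotopyGroup Δ) {a a' : Arc Δ}
    (h : φ '' a.carrier = a'.carrier) : a'.tip = a.tip := by
  obtain ⟨i, hi⟩ := a.tip_marked
  have h1 : φ a.tip = a.tip := isotopy_fixesMarked hφ i _ hi
  refine (a'.eq_tip ?_ hi).symm
  rw [← h, ← h1]
  exact mem_image_of_mem _ a.tip_mem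

/-- Along the isotopy the moving arc never meets `z`: the isotopy fixes `z`, and `z` is not on `a`,
whose only marked point is its tip. The end points do not move, so the change is a homotopy
invariant. -/
theorem isLogChange_isotopy {φ : Disk ≃ₜ Disk} (hφ : φ ∈ isotopyGroup Δ) {a a' : Arc Δ}
    (h : φ '' a.carrier = a'.carrier) {z : Disk} {i : Fin t} (hz : (z : ℂ) ∈ Δ.pts i)
    (hza : z ≠ a.tip) {c : ℂ} (hc : IsLogChange (fun s => a.toFun s - z) c) :
    IsLogChange (fun s => a'.toFun s - z) c := by
  have htip := tip_eq_of_image hφ h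
  have hbase := isotopy_base hφ
  have hmark := isotopy_fixesMarked hφ
  obtain ⟨H, hH, H0, H1, hfix⟩ := hφ
  have hF : Continuous fun p : ℝ × ℝ => ((H (projIcc 0 1 zero_le_one p.1)
      (a.pt (projIcc 0 1 zero_le_one p.2)) : Disk) : ℂ) - z :=
    (continuous_subtype_val.comp (hH.comp (((continuous_projIcc (h := zero_le_one)).comp continuous_fst).prodMk
      (a.continuous_pt.comp ((continuous_projIcc (h := zero_le_one)).comp continuous_snd))))).sub continuous_const
  have h2 : IsLogChange (fun s => ((H 1 (a.pt (projIcc 0 1 zero_le_one s)) : Disk) : ℂ) - z) c := by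
    have key := IsLogChange.homotopy hF.continuousOn (fun x _ h0 => ?_) (fun τ _ => ?_)
      (fun τ _ => ?_) (c := c) ?_
    · simpa using key
    · have h3 : H (projIcc 0 1 zero_le_one x.1) (a.pt (projIcc 0 1 zero_le_one x.2)) = z :=
        Subtype.ext (sub_eq_zero.1 h0)
      rw [← (hfix (projIcc 0 1 zero_le_one x.1)).2 i z hz] at h3
      have h4 := (H _).injective h3
      have h5 : projIcc 0 1 zero_le_one x.2 = 1 := a.pt_marked (i := i) (by rw [h4]; exact hz)
      exact hza (by rw [← h4, h5]; rfl)
    · have : ∀ s, H s base = base := fun s => (hfix s).1 base (by simp [base])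
      simp [a.pt_zero, this]
    · obtain ⟨j, hj⟩ := a.tip_marked
      have : ∀ s, H s (a.pt 1) = a.pt 1 := fun s => (hfix s).2 j _ hj
      simp [this]
    · obtain ⟨L, l1, l2, l3⟩ := hc
      refine ⟨L, l1, fun s hs => ?_, l3⟩
      rw [l2 s hs]
      simp [H0, projIcc_of_mem zero_le_one hs, Arc.pt]
  -- The arcs `φ ∘ a` and `a'` agree only as sets. They differ by a continuous reparametrization `σ`
  -- that fixes both ends, which does not affect the change.
  have hex : ∀ s : unitInterval, ∃ u : unitInterval, φ (a.pt u) = a'.pt s := fun s => by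
    have : a'.pt s ∈ φ '' a.carrier := h ▸ a'.pt_mem s
    rw [a.carrier_eq_range] at this
    obtain ⟨_, ⟨u, rfl⟩, hu⟩ := this
    exact ⟨u, hu⟩
  choose σ hσ using hex
  have hσc : Continuous σ := by
    rw [a.isClosedEmbedding_pt.isInducing.continuous_iff]
    have : a.pt ∘ σ = φ.symm ∘ a'.pt := funext fun s => by
      rw [Function.comp_apply, Function.comp_apply, ← hσ, Homeomorph.symm_apply_apply]
    rw [this]
    exact φ.symm.continuous.comp a'.continuous_pt
  have hσ0 : σ 0 = 0 := by
    apply a.pt_injective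
    apply φ.injective
    rw [hσ, a.pt_zero, a'.pt_zero, hbase]
  have hσ1 : σ 1 = 1 := by
    apply a.pt_injective
    apply φ.injective
    obtain ⟨j, hj⟩ := a.tip_marked
    rw [hσ]
    exact htip.trans (hmark j _ hj).symm
  refine h2.comp (σ := fun s => (σ (projIcc 0 1 zero_le_one s) : ℝ))
    (continuous_subtype_val.comp (hσc.comp continuous_projIcc)).continuousOn
    (fun s _ => (σ _).2) (by simp [hσ0]) (by simp [hσ1]) fun s hs => ?_
  rw [H1, projIcc_val, hσ, projIcc_of_mem zero_le_one hs]
  rfl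

theorem logChange_sub_arc {a b : Arc Δ} (hab : a.carrier ∩ b.carrier = {base})
    (harg : b.tangent.arg < a.tangent.arg) {ca cb : ℂ}
    (hca : IsLogChange (fun s => a.toFun s - b.tip) ca)
    (hcb : IsLogChange (fun s => b.toFun s - a.tip) cb) :
    (ca - cb).im = ((a.tip : ℂ) + Complex.I).arg - ((b.tip : ℂ) + Complex.I).arg - Real.pi := by
  have := logChange_sub a.continuousOn b.continuousOn (a.start.trans b.start.symm)
    (fun s hs u hu h => Arc.eq_zero_of_eq hab hs hu h) (fun s hs => a.im_sub_pos hs)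
    (fun s hs => b.im_sub_pos hs) a.hasDerivWithinAt_zero b.hasDerivWithinAt_zero a.tangent_im_pos
    b.tangent_im_pos harg hca hcb
  rw [this, a.start, b.start, sub_neg_eq_add, sub_neg_eq_add]
  rfl

/-- The order at the base point of two disjoint arcs only depends on their isotopy classes. -/
theorem arg_lt_of_isotopic {a b a' b' : Arc Δ} (hab : a.carrier ∩ b.carrier = {base})
    (hab' : a'.carrier ∩ b'.carrier = {base}) {φ ψ : Disk ≃ₜ Disk} (hφ : φ ∈ isotopyGroup Δ)
    (hψ : ψ ∈ isotopyGroup Δ) (ha : φ '' a.carrier = a'.carrier) (hb : ψ '' b.carrier = b'.carrier)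
    (h : b.tangent.arg < a.tangent.arg) (h' : a'.tangent.arg ≠ b'.tangent.arg) :
    b'.tangent.arg < a'.tangent.arg := by
  -- If the order were reversed, `logChange_sub_arc` applied to both pairs would give values of `(ca
  -- - cb).im` that differ by `2π`, although `ca`, `cb` and the end points are the same.
  refine lt_of_le_of_ne (not_lt.1 fun hlt => ?_) h'.symm
  obtain ⟨i, hi⟩ := a.tip_marked
  obtain ⟨j, hj⟩ := b.tip_marked
  have hne : ∀ (a b : Arc Δ), a.carrier ∩ b.carrier = {base} → ∀ s ∈ Icc (0 : ℝ) 1,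
      a.toFun s - b.tip ≠ 0 := fun a b hab s hs h0 =>
    zero_ne_one (Arc.eq_zero_of_eq hab hs (by simp) (sub_eq_zero.1 h0)).2.symm
  have hba : b.carrier ∩ a.carrier = {base} := by rw [inter_comm, hab]
  have hba' : b'.carrier ∩ a'.carrier = {base} := by rw [inter_comm, hab']
  obtain ⟨ca, hca⟩ := exists_isLogChange (a.continuousOn.sub continuousOn_const) (hne a b hab)
  obtain ⟨cb, hcb⟩ := exists_isLogChange (b.continuousOn.sub continuousOn_const) (hne b a hba)
  have hta := tip_eq_of_image hφ ha
  have htb := tip_eq_of_image hψ hb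
  have hca' := isLogChange_isotopy hφ ha hj (tip_ne_tip hba) hca
  have hcb' := isLogChange_isotopy hψ hb hi (tip_ne_tip hab) hcb
  rw [← htb] at hca'
  rw [← hta] at hcb'
  have e1 := logChange_sub_arc hab h hca hcb
  have e2 := logChange_sub_arc hba' hlt hcb' hca'
  rw [hta, htb] at e2
  have := Real.pi_pos
  simp only [Complex.sub_im] at e1 e2
  linarith

/-! ### Isotopic plants have isotopic arcs -/

/-- An arc of a plant is contained in every connected subset of the plant which contains the base
point and the end point of the arc. -/
theorem carrier_subset_of_isPreconnected {ι : Type*} [Finite ι] {a : ι → Arc Δ}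
    (ha : ∀ k l, k ≠ l → (a k).carrier ∩ (a l).carrier = {base}) (k : ι) {C : Set Disk}
    (hC : IsPreconnected C) (hCa : C ⊆ ⋃ l, (a l).carrier) (hb : base ∈ C)
    (ht : (a k).tip ∈ C) : (a k).carrier ⊆ C := by
  intro z hz
  rw [(a k).carrier_eq_range] at hz
  obtain ⟨s, rfl⟩ := hz
  by_contra hzC
  have hs0 : s ≠ 0 := fun h => hzC (by rw [h, (a k).pt_zero]; exact hb)
  have hs1 : s ≠ 1 := fun h => hzC (by rw [h]; exact ht)
  -- If a point of the arc were missing from `C`, the outer part `A` of the arc and the rest `B` of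
  -- the plant would be closed sets covering `C` that meet only in that point; they contain the tip
  -- and the base point respectively.
  set A : Set Disk := (a k).pt '' Ici s
  set B : Set Disk := (a k).pt '' Iic s ∪ ⋃ l ∈ {l | l ≠ k}, (a l).carrier
  have hA : IsClosed A := (a k).isClosedEmbedding_pt.isClosedMap _ isClosed_Ici
  have hB : IsClosed B := ((a k).isClosedEmbedding_pt.isClosedMap _ isClosed_Iic).union
    ((Set.toFinite _).isClosed_biUnion fun l _ => (a l).isClosed_carrier)
  have hcov : C ⊆ A ∪ B := by
    intro w hw
    obtain ⟨l, hl⟩ := mem_iUnion.1 (hCa hw)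
    by_cases hlk : l = k
    · subst hlk
      rw [(a l).carrier_eq_range] at hl
      obtain ⟨u, rfl⟩ := hl
      rcases le_total s u with h | h
      · exact Or.inl ⟨u, h, rfl⟩
      · exact Or.inr (Or.inl ⟨u, h, rfl⟩)
    · exact Or.inr (Or.inr (mem_biUnion (show l ∈ {l | l ≠ k} from hlk) hl))
  obtain ⟨w, hwC, hwA, hwB⟩ := (isPreconnected_closed_iff.1 hC) A B hA hB hcov
    ⟨_, ht, 1, unitInterval.le_one s, rfl⟩
    ⟨_, hb, Or.inl ⟨0, unitInterval.nonneg s, (a k).pt_zero⟩⟩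
  obtain ⟨u, hu, rfl⟩ := hwA
  have hus : u ≠ s := fun h => hzC (h ▸ hwC)
  rcases hwB with ⟨u', hu', h⟩ | h
  · have := (a k).pt_injective h
    subst this
    exact hus (le_antisymm hu' hu)
  · obtain ⟨l, hl, hl'⟩ := mem_iUnion₂.1 h
    have h2 : (a k).pt u ∈ (a k).carrier ∩ (a l).carrier := ⟨(a k).pt_mem u, hl'⟩
    rw [ha k l (Ne.symm hl), mem_singleton_iff, ← (a k).pt_zero] at h2
    have := (a k).pt_injective h2
    subst this
    exact hs0 (le_antisymm hu (unitInterval.nonneg s))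

theorem isPreconnected_carrier (a : Arc Δ) : IsPreconnected a.carrier := by
  rw [a.carrier_eq_range]; exact isPreconnected_range a.continuous_pt

/-- An arc is the smallest connected subset of its plant through the base point and its tip, a
topological property preserved by `φ`. Minimality is used once in each plant, giving both
inclusions. -/
theorem image_carrier_eq {ι ι' : Type*} [Finite ι] [Finite ι'] {a : ι → Arc Δ} {a' : ι' → Arc Δ}
    (ha : ∀ k l, k ≠ l → (a k).carrier ∩ (a l).carrier = {base})
    (ha' : ∀ k l, k ≠ l → (a' k).carrier ∩ (a' l).carrier = {base})
    {φ : Disk ≃ₜ Disk} (hφ : φ ∈ isotopyGroup Δ)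
    (h : φ '' (⋃ k, (a k).carrier) = ⋃ k, (a' k).carrier) {k : ι} {k' : ι'}
    (hk : (a' k').tip = (a k).tip) : φ '' (a k).carrier = (a' k').carrier := by
  obtain ⟨i, hi⟩ := (a k).tip_marked
  have h1 : φ (a k).tip = (a k).tip := isotopy_fixesMarked hφ i _ hi
  have h2 := isotopy_base hφ
  apply Subset.antisymm
  · have : (a k).carrier ⊆ φ ⁻¹' (a' k').carrier := by
      refine carrier_subset_of_isPreconnected ha k ?_ ?_ ?_ ?_
      · exact (φ.isPreconnected_preimage).2 (isPreconnected_carrier _)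
      · intro z hz
        have h3 : φ z ∈ φ '' (⋃ k, (a k).carrier) := by
          rw [h]; exact mem_iUnion_of_mem k' hz
        obtain ⟨w, hw, hw'⟩ := h3
        rwa [← φ.injective hw']
      · rw [mem_preimage, h2]; exact (a' k').base_mem
      · rw [mem_preimage, h1, ← hk]; exact (a' k').tip_mem
    exact image_subset_iff.2 this
  · refine carrier_subset_of_isPreconnected ha' k' ?_ ?_ ?_ ?_
    · exact (isPreconnected_carrier _).image _ φ.continuous.continuousOn
    · rw [← h]; exact image_mono (subset_iUnion (fun k => (a k).carrier) k)
    · rw [← h2]; exact mem_image_of_mem _ (a k).base_mem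
    · rw [hk, ← h1]; exact mem_image_of_mem _ (a k).tip_mem

end PlantComplex

end

noncomputable section

namespace PlantComplex

variable {t : ℕ} {Δ : MarkedPoints t} {ξ : Fin t → ℕ}

/-! ### Uniqueness and feasibility of IC-sequences -/

theorem color_unique {z : ℂ} {i j : Fin t} (hi : z ∈ Δ.pts i) (hj : z ∈ Δ.pts j) : i = j := by
  by_contra h
  exact Finset.disjoint_left.1 (Δ.disjoint i j h) hi hj

theorem card_hasColor {κ : Type*} {c : κ → Arc Δ}
    (hc : ∀ k l, k ≠ l → (c k).carrier ∩ (c l).carrier = {base}) (j : Fin t) :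
    Nat.card {k // (c k).HasColor j} =
      Nat.card {z : Disk // z ∈ ⋃ k, (c k).carrier ∧ (z : ℂ) ∈ Δ.pts j} := by
  refine Nat.card_congr (Equiv.ofBijective
    (fun k => ⟨(c k.1).tip, mem_iUnion_of_mem k.1 (c k.1).tip_mem, k.2⟩) ⟨?_, ?_⟩)
  · rintro ⟨k, hk⟩ ⟨l, hl⟩ h
    by_contra hne
    exact tip_ne_tip (hc k l fun h' => hne (Subtype.ext h')) (congrArg Subtype.val h)
  · rintro ⟨z, hz, hz'⟩
    obtain ⟨k, hk⟩ := mem_iUnion.1 hz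
    have := (c k).eq_tip hk hz'
    subst this
    exact ⟨⟨k, hz'⟩, rfl⟩

theorem IsColoredPlant.card_marked {P : Set Disk} (hP : IsColoredPlant Δ ξ P) (j : Fin t) :
    Nat.card {z : Disk // z ∈ P ∧ (z : ℂ) ∈ Δ.pts j} = ξ j := by
  obtain ⟨a, h1, h2, rfl⟩ := hP
  rw [← card_hasColor h2]
  have : Nat.card {k // (a k).HasColor j} = Nat.card {k : Σ i : Fin t, Fin (ξ i) // k.1 = j} :=
    Nat.card_congr (Equiv.subtypeEquivRight fun k =>
      ⟨fun h => color_unique (h1 k) h, fun h => h ▸ h1 k⟩)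
  rw [this, Nat.card_congr (Equiv.sigmaSubtype j)]
  simp

theorem iUnion_index_eq {N : ℕ} {κ : Type*} (a : Fin N → Arc Δ) (f : Fin N → κ) (i : κ) :
    ⋃ k : {k // f k = i}, (a k).carrier = ⋃ (k) (_ : f k = i), (a k).carrier := by
  rw [iUnion_subtype]

/-- The decomposition into the arcs `a k` need not be the one that witnesses that `v i` is a plant.
Either way an arc contains exactly one marked point, so both decompositions count the marked points
of color `j` in the set `v i`. -/
theorem hasPairCounts_of_plants {q : ℕ} {ω : ICSequence ξ q} {v : Fin (q + 1) → Plant Δ ξ}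
    {a : Fin ((q + 1) * ∑ i, ξ i) → Arc Δ}
    (hd : ∀ k l, k ≠ l → (a k).carrier ∩ (a l).carrier = {base})
    (hv : ∀ i, (v i).1 = ⋃ (k) (_ : (ω k).1 = i), (a k).carrier)
    (hc : ∀ k, (a k).HasColor (ω k).2) : HasPairCounts ω := by
  intro i j
  have h1 := card_hasColor (c := fun k : {k // (ω k).1 = i} => a k)
    (fun k l h => hd k l fun h' => h (Subtype.ext h')) j
  rw [iUnion_index_eq a (fun k => (ω k).1), ← hv i, (v i).2.card_marked j] at h1
  rw [← h1]
  refine Nat.card_congr (Equiv.trans ?_ (Equiv.subtypeSubtypeEquivSubtypeInter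
    (fun k => (ω k).1 = i) (fun k => (a k).HasColor j)).symm)
  refine Equiv.subtypeEquivRight fun k => ⟨fun h => ?_, fun h => ?_⟩
  · refine ⟨by rw [h], ?_⟩
    have := hc k
    rwa [h] at this
  · exact Prod.ext h.1 (color_unique (hc k) h.2)

theorem IsICSequence.feasible {q : ℕ} (hξ : 0 < ∑ j, ξ j) {α : Simplex Δ ξ q}
    {ω : ICSequence ξ q} (h : IsICSequence α ω) : IsFeasible ω := by
  obtain ⟨v, a, -, hd, -, hv, hc, ho⟩ := h
  exact (isFeasible_iff hξ ω).2 ⟨hasPairCounts_of_plants hd hv hc, ho⟩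

theorem cls_injective {q : ℕ} {α : Simplex Δ ξ q} {v : Fin (q + 1) → Plant Δ ξ}
    (h : (α.1 : Set (PlantClass Δ ξ)) = range fun i => (v i).cls) :
    Function.Injective fun i => (v i).cls := by
  classical
  have h1 : α.1 = Finset.univ.image fun i => (v i).cls := by
    apply Finset.coe_injective
    rw [h]; simp
  have h2 := α.2.2
  rw [h1] at h2
  have h3 := Finset.card_image_iff.1 (h2.trans (by simp) : _ = (Finset.univ : Finset (Fin (q + 1))).card)
  exact fun i j hij => h3 (by simp) (by simp) hij

/-- Equality of vertices matches the plants (`σ`), equality of tips matches the arcs (`π`). Rigidity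
of orders then forces both matchings to be trivial. -/
theorem IsICSequence.unique {q : ℕ} (hξ : 0 < ∑ j, ξ j) {α : Simplex Δ ξ q}
    {ω ω' : ICSequence ξ q} (h : IsICSequence α ω) (h' : IsICSequence α ω') : ω = ω' := by
  obtain ⟨v, a, hα, hd, harg, hv, hc, ho⟩ := h
  obtain ⟨v', a', hα', hd', harg', hv', hc', ho'⟩ := h'
  have hex : ∀ i, ∃ i', (v' i').cls = (v i).cls := fun i => by
    have : (v i).cls ∈ range fun i => (v' i).cls := by rw [← hα', hα]; exact mem_range_self i
    exact this
  choose σ hσ using hex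
  have hσi : Function.Injective σ := fun i j hij => cls_injective hα (by
    change (v i).cls = (v j).cls
    rw [← hσ, ← hσ, hij])
  have hφ : ∀ i, ∃ φ ∈ isotopyGroup Δ, φ '' (v i).1 = (v' (σ i)).1 := fun i =>
    Quotient.exact (hσ i).symm
  choose φ hφ hφv using hφ
  have hex : ∀ k, ∃ k', (ω' k').1 = σ (ω k).1 ∧ (a' k').tip = (a k).tip := fun k => by
    have h1 : (a k).tip ∈ (v (ω k).1).1 := by
      rw [hv]; exact mem_iUnion₂.2 ⟨k, rfl, (a k).tip_mem⟩
    have h2 := mem_image_of_mem (φ (ω k).1) h1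
    rw [hφv, isotopy_fixesMarked (hφ _) _ (a k).tip (hc k), hv'] at h2
    obtain ⟨k', hk', hk2⟩ := mem_iUnion₂.1 h2
    exact ⟨k', hk', ((a' k').eq_tip hk2 (hc k)).symm⟩
  choose π hπ1 hπ2 using hex
  have himg : ∀ k, φ (ω k).1 '' (a k).carrier = (a' (π k)).carrier := fun k => by
    refine image_carrier_eq (a := fun l : {l // (ω l).1 = (ω k).1} => a l)
      (a' := fun l : {l // (ω' l).1 = σ (ω k).1} => a' l) (k := ⟨k, rfl⟩) (k' := ⟨π k, hπ1 k⟩)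
      (fun l m hlm => hd _ _ fun h => hlm (Subtype.ext h))
      (fun l m hlm => hd' _ _ fun h => hlm (Subtype.ext h)) (hφ _) ?_ (hπ2 k)
    rw [iUnion_index_eq a (fun k => (ω k).1), iUnion_index_eq a' (fun k => (ω' k).1),
      ← hv, ← hv', hφv]
  -- Arcs of different plants are moved by unrelated isotopies. The order of two arcs is preserved
  -- nevertheless, because `arg_lt_of_isotopic` allows a separate isotopy for each.
  have hmono : StrictMono π := by
    intro k l hkl
    have hne : π k ≠ π l := fun h => tip_ne_tip (hd k l hkl.ne) (by rw [← hπ2, ← hπ2, h])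
    refine harg'.lt_iff_gt.1 (arg_lt_of_isotopic (hd k l hkl.ne) (hd' _ _ hne) (hφ _) (hφ _)
      (himg k) (himg l) (harg hkl) fun h => hne (harg'.injective h))
  have hid : π = id := by
    refine (StrictMono.range_inj hmono strictMono_id).1 ?_
    rw [range_id, (Finite.injective_iff_surjective.1 hmono.injective).range_eq]
  simp only [hid, id] at hπ1 hπ2
  -- Both index sequences list the plants by first occurrence, and they differ by the relabelling
  -- `σ`.
  have h1 : σ = id := by
    have h2 := FirstOrdered.eq_one ((hasPairCounts_of_plants hd hv hc).surjective hξ) ho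
      (σ := Equiv.ofBijective σ (Finite.injective_iff_bijective.1 hσi)) (by
        have : (⇑(Equiv.ofBijective σ (Finite.injective_iff_bijective.1 hσi)) ∘ fun k => (ω k).1) =
          fun k => (ω' k).1 := funext fun k => (hπ1 k).symm
        rw [this]; exact ho')
    funext i
    exact congrArg (fun e : Equiv.Perm (Fin (q + 1)) => e i) h2
  funext k
  refine Prod.ext ?_ ?_
  · rw [hπ1, h1]; rfl
  · have h2 := hc' k
    rw [Arc.HasColor, ← Arc.coe_tip, hπ2] at h2
    exact color_unique (hc k) h2

/-! ### Invariance of IC-sequences under diffeomorphisms -/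

/-- The cross product is `‖v‖ ‖w‖ sin (arg w - arg v)`, and the difference of two arguments in `[0,
π)` lies in `(-π, π)`, where the sine has the sign of its argument. -/
theorem arg_lt_arg_iff {v w : ℂ} (hv : 0 < v.im) (hw : 0 < w.im) :
    v.arg < w.arg ↔ w.re * v.im < v.re * w.im := by
  have h1 := Complex.norm_mul_cos_arg v
  have h2 := Complex.norm_mul_sin_arg v
  have h3 := Complex.norm_mul_cos_arg w
  have h4 := Complex.norm_mul_sin_arg w
  have hv0 : 0 < ‖v‖ := norm_pos_iff.2 fun h => by simp [h] at hv
  have hw0 : 0 < ‖w‖ := norm_pos_iff.2 fun h => by simp [h] at hw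
  have a1 : 0 ≤ v.arg := Complex.arg_nonneg_iff.2 hv.le
  have a2 : v.arg < Real.pi := Complex.arg_lt_pi_iff.2 (Or.inr hv.ne')
  have a3 : 0 ≤ w.arg := Complex.arg_nonneg_iff.2 hw.le
  have a4 : w.arg < Real.pi := Complex.arg_lt_pi_iff.2 (Or.inr hw.ne')
  have key : v.re * w.im - w.re * v.im = ‖v‖ * ‖w‖ * Real.sin (w.arg - v.arg) := by
    rw [Real.sin_sub, ← h1, ← h2, ← h3, ← h4]; ring
  rw [← sub_pos, ← sub_pos (b := w.re * v.im), key]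
  have hp := mul_pos hv0 hw0
  constructor
  · intro h
    exact mul_pos hp (Real.sin_pos_of_pos_of_lt_pi h (by linarith))
  · intro h
    by_contra hle
    have := Real.sin_nonpos_of_nonpos_of_neg_pi_le (not_lt.1 hle) (by linarith)
    nlinarith [(pos_iff_pos_of_mul_pos h).1 hp]

/-- The derivative at the base point of a diffeomorphism fixing the boundary. -/
theorem exists_fderiv_base (g : coloredDiffeo Δ) : ∃ F : ℂ → ℂ, ∃ L : ℂ →L[ℝ] ℂ,
    (∀ z : Disk, F z = g.1 z) ∧
    HasFDerivWithinAt F L (Metric.closedBall 0 1) (-Complex.I) ∧ L 1 = 1 ∧ 0 < (L Complex.I).im := by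
  obtain ⟨φ, ⟨F, hF, hFφ⟩, ⟨G, hG, hGφ⟩, hbd, hcol⟩ := g
  set B : Set ℂ := Metric.closedBall 0 1 with hB
  have huB : UniqueDiffOn ℝ B := uniqueDiffOn_convex (convex_closedBall _ _)
    (by rw [interior_closedBall _ one_ne_zero]; exact ⟨0, by simp⟩)
  have hFB : MapsTo F B B := fun z hz => by
    rw [hFφ ⟨z, hz⟩]; exact (φ ⟨z, hz⟩).2
  have hGF : ∀ z ∈ B, G (F z) = z := fun z hz => by
    rw [hFφ ⟨z, hz⟩, hGφ, Homeomorph.symm_apply_apply]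
  have hFbd : ∀ z : ℂ, ‖z‖ = 1 → F z = z := fun z hz => by
    have hz' : z ∈ B := by simp [hB, hz]
    rw [hFφ ⟨z, hz'⟩, hbd ⟨z, hz'⟩ hz]
  have hFd : DifferentiableOn ℝ F B := hF.differentiableOn (by simp)
  have hGd : DifferentiableOn ℝ G B := hG.differentiableOn (by simp)
  have hmem : (-Complex.I) ∈ B := by simp [hB]
  have hF0 : F (-Complex.I) = -Complex.I := hFbd _ (by simp)
  set L := fderivWithin ℝ F B (-Complex.I) with hL
  have hFL : HasFDerivWithinAt F L B (-Complex.I) := (hFd _ hmem).hasFDerivWithinAt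
  have hinj : ∀ v, L v = 0 → v = 0 := by
    intro v hv
    have h1 : HasFDerivWithinAt (G ∘ F) ((fderivWithin ℝ G B (F (-Complex.I))).comp L) B
        (-Complex.I) :=
      (hGd _ (hFB hmem)).hasFDerivWithinAt.comp _ hFL hFB
    have h2 : HasFDerivWithinAt (G ∘ F) (ContinuousLinearMap.id ℝ ℂ) B (-Complex.I) :=
      (hasFDerivWithinAt_id _ B).congr (fun w hw => hGF w hw) (hGF _ hmem)
    have h4 := congrArg (fun L : ℂ →L[ℝ] ℂ => L v) ((huB _ hmem).eq h1 h2)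
    simpa [hv] using h4.symm
  have hone : L 1 = 1 := by
    set c : ℝ → ℂ := fun s => Complex.exp (s * Complex.I) * (-Complex.I) with hc
    have hcn : ∀ s, ‖c s‖ = 1 := fun s => by simp [hc, Complex.norm_exp_ofReal_mul_I]
    have hc0 : c 0 = -Complex.I := by simp [hc]
    have hcd : HasDerivAt c 1 0 := by
      have h1 : HasDerivAt (fun s : ℝ => (s : ℂ) * Complex.I) Complex.I 0 := by
        simpa using (Complex.ofRealCLM.hasDerivAt (x := (0 : ℝ))).mul_const Complex.I
      have h2 := (h1.cexp).mul_const (-Complex.I)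
      rw [hc]
      refine h2.congr_deriv ?_
      simp
    have h1 : HasDerivAt (F ∘ c) (L 1) 0 := by
      have := (hc0 ▸ hFL : HasFDerivWithinAt F L B (c 0)).comp_hasDerivWithinAt (s := univ) 0
        hcd.hasDerivWithinAt (fun s _ => by simp [hB, hcn s])
      simpa using this
    have h2 : F ∘ c = c := funext fun s => hFbd _ (hcn s)
    rw [h2] at h1
    exact h1.unique hcd
  refine ⟨F, L, hFφ, hFL, hone, ?_⟩
  have hne : (L Complex.I).im ≠ 0 := by
    intro h
    have h1 : L (Complex.I - ((L Complex.I).re : ℂ)) = 0 := by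
      have h2 : L (((L Complex.I).re : ℝ) : ℂ) = ((L Complex.I).re : ℂ) := by
        have := L.map_smul (L Complex.I).re (1 : ℂ)
        rw [hone] at this
        simpa using this
      rw [map_sub, h2]
      exact Complex.ext (by simp) (by simp [h])
    have h3 := congrArg Complex.im (hinj _ h1)
    simp at h3
  -- The sign comes from following the vertical radius at `-i`: its image stays in the disk, hence
  -- at height at least `-1`.
  refine lt_of_le_of_ne ?_ hne.symm
  have hcB : ∀ s ∈ Icc (0 : ℝ) 1, ((s : ℂ) - 1) * Complex.I ∈ B := fun s hs => by
    have : ‖((s : ℂ) - 1)‖ = |s - 1| := by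
      rw [← Complex.ofReal_one, ← Complex.ofReal_sub, Complex.norm_real, Real.norm_eq_abs]
    simp only [hB, mem_closedBall_zero_iff, norm_mul, Complex.norm_I, mul_one, this]
    rw [abs_le]; constructor <;> linarith [hs.1, hs.2]
  have hcd : HasDerivWithinAt (fun s : ℝ => ((s : ℂ) - 1) * Complex.I) Complex.I (Icc 0 1) 0 := by
    simpa using (((Complex.ofRealCLM.hasDerivAt (x := (0 : ℝ))).sub_const (1 : ℂ)).mul_const
      Complex.I).hasDerivWithinAt (s := Icc 0 1)
  have h1 : HasDerivWithinAt (fun s : ℝ => (F (((s : ℂ) - 1) * Complex.I)).im) (L Complex.I).im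
      (Icc 0 1) 0 := by
    have h0 : HasFDerivWithinAt F L B (((0 : ℝ) - 1 : ℂ) * Complex.I) := by simpa using hFL
    exact Complex.imCLM.hasFDerivAt.comp_hasDerivWithinAt (0 : ℝ)
      (h0.comp_hasDerivWithinAt (0 : ℝ) hcd hcB)
  have h2 := hasDerivWithinAt_iff_tendsto_slope.1 h1
  rw [show Icc (0 : ℝ) 1 \ {0} = Ioc 0 1 from Icc_sdiff_left] at h2
  have : (nhdsWithin (0 : ℝ) (Ioc 0 1)).NeBot := by
    rw [nhdsWithin_Ioc_eq_nhdsGT one_pos]; infer_instance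
  refine ge_of_tendsto h2 ?_
  filter_upwards [self_mem_nhdsWithin] with s hs
  have h3 : (F (((0 : ℝ) - 1 : ℂ) * Complex.I)).im = -1 := by simp [hF0]
  rw [slope_def_field, h3]
  have h4 := hFB (hcB s ⟨hs.1.le, hs.2⟩)
  have h5 := (abs_le.1 ((Complex.abs_im_le_norm _).trans (mem_closedBall_zero_iff.1 h4))).1
  exact div_nonneg (by linarith) (by linarith [hs.1])

/-- Only the carrier of `b` is known, so `b` may be parametrized differently from the image of `a`.
Directions are therefore compared as limits of arguments of chords. -/
theorem tangent_arg_image (g : coloredDiffeo Δ) {F : ℂ → ℂ} {L : ℂ →L[ℝ] ℂ}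
    (hFg : ∀ z : Disk, F z = g.1 z)
    (hFL : HasFDerivWithinAt F L (Metric.closedBall 0 1) (-Complex.I)) {a b : Arc Δ}
    (hb : b.carrier = g.1 '' a.carrier) (hL : 0 < (L a.tangent).im) :
    b.tangent.arg = (L a.tangent).arg := by
  have hmaps : MapsTo a.toFun (Icc 0 1) (Metric.closedBall 0 1) := fun s hs => by
    simpa using a.norm_le_one hs
  have h1 : HasDerivWithinAt (F ∘ a.toFun) (L a.tangent) (Icc 0 1) 0 :=
    (a.start ▸ hFL : HasFDerivWithinAt F L _ (a.toFun 0)).comp_hasDerivWithinAt (0 : ℝ)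
      a.hasDerivWithinAt_zero hmaps
  have h2 := tendsto_arg_sub h1 hL
  have h3 := tendsto_arg_sub b.hasDerivWithinAt_zero b.tangent_im_pos
  have hex : ∀ s : unitInterval, ∃ u : unitInterval, g.1 (a.pt u) = b.pt s := fun s => by
    have : b.pt s ∈ g.1 '' a.carrier := hb ▸ b.pt_mem s
    rw [a.carrier_eq_range] at this
    obtain ⟨_, ⟨u, rfl⟩, hu⟩ := this
    exact ⟨u, hu⟩
  choose σ hσ using hex
  have hσc : Continuous σ := by
    rw [a.isClosedEmbedding_pt.isInducing.continuous_iff]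
    have : a.pt ∘ σ = g.1.symm ∘ b.pt := funext fun s => by
      rw [Function.comp_apply, Function.comp_apply, ← hσ, Homeomorph.symm_apply_apply]
    rw [this]
    exact g.1.symm.continuous.comp b.continuous_pt
  have hσ0 : ∀ s, σ s = 0 ↔ s = 0 := fun s => by
    constructor
    · intro h
      have := hσ s
      rw [h, a.pt_zero, base_fixed, ← b.pt_zero] at this
      exact (b.pt_injective this).symm
    · rintro rfl
      apply a.pt_injective
      apply g.1.injective
      rw [hσ, a.pt_zero, b.pt_zero, base_fixed]
  have h4 : Filter.Tendsto (fun s : ℝ => (σ (projIcc 0 1 zero_le_one s) : ℝ))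
      (nhdsWithin 0 (Ioi 0)) (nhdsWithin 0 (Ioi 0)) := by
    rw [tendsto_nhdsWithin_iff]
    constructor
    · have : Continuous fun s : ℝ => (σ (projIcc 0 1 zero_le_one s) : ℝ) :=
        continuous_subtype_val.comp (hσc.comp continuous_projIcc)
      have h5 := this.tendsto 0
      rw [projIcc_left, show (⟨0, by simp⟩ : unitInterval) = 0 from rfl, (hσ0 0).2 rfl] at h5
      exact h5.mono_left nhdsWithin_le_nhds
    · filter_upwards [Ioc_mem_nhdsGT (zero_lt_one (α := ℝ))] with s hs
      rw [mem_Ioi]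
      refine lt_of_le_of_ne (σ _).2.1 fun h => ?_
      have h5 := (hσ0 _).1 (Subtype.ext h.symm : σ (projIcc 0 1 zero_le_one s) = 0)
      rw [projIcc_of_mem zero_le_one ⟨hs.1.le, hs.2⟩] at h5
      exact hs.1.ne' (congrArg Subtype.val h5)
  refine tendsto_nhds_unique h3 ((h2.comp h4).congr' ?_)
  filter_upwards [Ioc_mem_nhdsGT (zero_lt_one (α := ℝ))] with s hs
  have h5 : F (a.toFun (σ (projIcc 0 1 zero_le_one s))) = b.toFun s := by
    have h6 := congrArg Subtype.val (hσ (projIcc 0 1 zero_le_one s))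
    rw [← hFg] at h6
    refine h6.trans ?_
    rw [projIcc_of_mem zero_le_one ⟨hs.1.le, hs.2⟩]; rfl
  have h6 : F (a.toFun 0) = b.toFun 0 := by
    have := congrArg Subtype.val (base_fixed g)
    rw [← hFg] at this
    rw [a.start, b.start]
    exact this
  simp only [Function.comp_apply, h5, h6]

/-- In the real basis `1, i` the derivative at `*` is `(x, y) ↦ (x + p y, r y)` with `r > 0`. It
multiplies cross products by `r`, so it keeps the order of directions; indices and colors are
carried along unchanged. -/
theorem IsICSequence.smul {q : ℕ} {α : Simplex Δ ξ q} {ω : ICSequence ξ q}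
    (h : IsICSequence α ω) (g : coloredDiffeo Δ) : IsICSequence (g • α) ω := by
  obtain ⟨v, a, hα, hd, harg, hv, hc, ho⟩ := h
  choose f hf hf' using exists_arc_image g
  obtain ⟨F, L, hFg, hFL, hL1, hLI⟩ := exists_fderiv_base g
  have hLv : ∀ v : ℂ, L v = v.re + v.im * L Complex.I := fun v => by
    have h1 := L.map_add (v.re • (1 : ℂ)) (v.im • Complex.I)
    rw [L.map_smul, L.map_smul, hL1] at h1
    simp only [Complex.real_smul, mul_one, Complex.re_add_im] at h1
    exact h1
  have hre : ∀ v : ℂ, (L v).re = v.re + v.im * (L Complex.I).re := fun v => by rw [hLv]; simp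
  have him : ∀ v : ℂ, (L v).im = v.im * (L Complex.I).im := fun v => by rw [hLv]; simp
  have hpos : ∀ k, 0 < (L (a k).tangent).im := fun k => by
    rw [him]; exact mul_pos (a k).tangent_im_pos hLI
  refine ⟨fun i => g • v i, fun k => f (a k), ?_, fun k l hkl => ?_, fun k l hkl => ?_,
    fun i => ?_, fun k => hf' _ _ (hc k), ho⟩
  · change ((α.1.map (MulAction.toPerm g).toEmbedding : Finset _) : Set (PlantClass Δ ξ)) = _
    rw [Finset.coe_map, hα, ← range_comp]
    rfl
  · rw [hf, hf, ← image_inter g.1.injective, hd k l hkl, image_singleton, base_fixed]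
  · change (f (a l)).tangent.arg < (f (a k)).tangent.arg
    rw [tangent_arg_image g hFg hFL (hf (a l)) (hpos l),
      tangent_arg_image g hFg hFL (hf (a k)) (hpos k),
      arg_lt_arg_iff (hpos l) (hpos k), hre (a l).tangent, hre (a k).tangent,
      him (a l).tangent, him (a k).tangent]
    have h1 := (arg_lt_arg_iff (a l).tangent_im_pos (a k).tangent_im_pos).1 (harg hkl)
    have h2 := mul_lt_mul_of_pos_right h1 hLI
    nlinarith
  · rw [smul_plant_val, hv, image_iUnion₂]
    simp only [hf]

end PlantComplex

end

noncomputable section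

namespace PlantComplex

variable {t : ℕ} {Δ : MarkedPoints t} {ξ : Fin t → ℕ}

/-! ### Piecewise linear maps of the line -/

/-- The piecewise linear map of the real line sending the nodes `p 0 < ... < p n` to the nodes
`q 0 < ... < q n`, where `p 0 = q 0` and `p n = q n`, which is the identity outside
`[p 0, p n]`. -/
def plMap (n : ℕ) (p q : ℕ → ℝ) (x : ℝ) : ℝ :=
  min x (p 0) + max (x - p n) 0 +
    ∑ k ∈ Finset.range n, (q (k + 1) - q k) * max 0 (min ((x - p k) / (p (k + 1) - p k)) 1)

section plMap

variable {n : ℕ} {p q : ℕ → ℝ}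

/-- With this form of the summands the sum in `plMap n p p` telescopes. -/
theorem mul_clamp {a b x : ℝ} (h : a < b) :
    (b - a) * max 0 (min ((x - a) / (b - a)) 1) = min x b - min x a := by
  have h' : 0 < b - a := sub_pos.2 h
  rcases le_total x a with h1 | h1
  · have : (x - a) / (b - a) ≤ 0 := div_nonpos_of_nonpos_of_nonneg (by linarith) h'.le
    rw [max_eq_left (by rw [min_eq_left (by linarith)]; exact this), min_eq_left (h1.trans h.le),
      min_eq_left h1]; ring
  · rw [max_eq_right (le_min (div_nonneg (by linarith) h'.le) zero_le_one), min_eq_right h1]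
    rcases le_total x b with h2 | h2
    · rw [min_eq_left ((div_le_one h').2 (by linarith)), min_eq_left h2]
      field_simp
    · rw [min_eq_right ((one_le_div h').2 (by linarith)), min_eq_right h2]; ring

theorem plMap_self (hp : ∀ k < n, p k < p (k + 1)) (x : ℝ) : plMap n p p x = x := by
  rw [plMap, Finset.sum_congr rfl fun k hk => mul_clamp (hp k (Finset.mem_range.1 hk)),
    Finset.sum_range_sub (fun k => min x (p k))]
  rcases le_total x (p n) with h | h
  · rw [max_eq_right (by linarith), min_eq_left h]; ring
  · rw [max_eq_left (by linarith), min_eq_right h]; ring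

theorem plMap_strictMono (hp : ∀ k < n, p k < p (k + 1)) (hq : ∀ k < n, q k < q (k + 1)) :
    StrictMono (plMap n p q) := by
  intro x y hxy
  have hm : ∀ k < n, max 0 (min ((x - p k) / (p (k + 1) - p k)) 1) ≤
      max 0 (min ((y - p k) / (p (k + 1) - p k)) 1) := fun k hk =>
    max_le_max le_rfl (min_le_min ((div_le_div_iff_of_pos_right (sub_pos.2 (hp k hk))).2
      (by linarith)) le_rfl)
  have h1 : min x (p 0) ≤ min y (p 0) := min_le_min hxy.le le_rfl
  have h2 : max (x - p n) 0 ≤ max (y - p n) 0 := max_le_max (by linarith) le_rfl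
  have h3 : ∑ k ∈ Finset.range n, (q (k + 1) - q k) * max 0 (min ((x - p k) / (p (k + 1) - p k)) 1) ≤
      ∑ k ∈ Finset.range n, (q (k + 1) - q k) * max 0 (min ((y - p k) / (p (k + 1) - p k)) 1) :=
    Finset.sum_le_sum fun k hk => mul_le_mul_of_nonneg_left (hm k (Finset.mem_range.1 hk))
      (sub_pos.2 (hq k (Finset.mem_range.1 hk))).le
  rw [plMap, plMap]
  by_contra hle
  push Not at hle
  have e1 : min x (p 0) = min y (p 0) := by linarith
  have e2 : max (x - p n) 0 = max (y - p n) 0 := by linarith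
  have e3 := (Finset.sum_eq_sum_iff_of_le fun k hk => mul_le_mul_of_nonneg_left
    (hm k (Finset.mem_range.1 hk)) (sub_pos.2 (hq k (Finset.mem_range.1 hk))).le).1
    (le_antisymm h3 (by linarith))
  -- Equal values force every weakly increasing summand to agree at `x` and `y`. The same then holds
  -- for the weights `p`, where the map is the identity.
  have e4 : plMap n p p x = plMap n p p y := by
    rw [plMap, plMap, e1, e2]
    congr 1
    refine Finset.sum_congr rfl fun k hk => ?_
    rw [mul_left_cancel₀ (sub_pos.2 (hq k (Finset.mem_range.1 hk))).ne' (e3 k hk)]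
  rw [plMap_self hp, plMap_self hp] at e4
  exact hxy.ne e4

theorem node_mono (hp : ∀ k < n, p k < p (k + 1)) {j k : ℕ} (hjk : j ≤ k) (hk : k ≤ n) :
    p j ≤ p k := by
  induction k, hjk using Nat.le_induction with
  | base => exact le_rfl
  | succ k h ih => exact (ih (by omega)).trans (hp k (by omega)).le

theorem plMap_node (hp : ∀ k < n, p k < p (k + 1)) (h0 : p 0 = q 0) {j : ℕ} (hj : j ≤ n) :
    plMap n p q (p j) = q j := by
  have h1 : ∀ k ∈ Finset.range n, (q (k + 1) - q k) *
      max 0 (min ((p j - p k) / (p (k + 1) - p k)) 1) = q (min (k + 1) j) - q (min k j) := by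
    intro k hk
    have hk := Finset.mem_range.1 hk
    have hpos := sub_pos.2 (hp k hk)
    rcases lt_or_ge k j with h | h
    · have := node_mono hp (show k + 1 ≤ j from h) hj
      rw [min_eq_right ((one_le_div hpos).2 (by linarith)), max_eq_right zero_le_one,
        min_eq_left (show k + 1 ≤ j from h), min_eq_left h.le, mul_one]
    · have := node_mono hp h hk.le
      have h2 : (p j - p k) / (p (k + 1) - p k) ≤ 0 :=
        div_nonpos_of_nonpos_of_nonneg (by linarith) hpos.le
      rw [max_eq_left ((min_le_left _ _).trans h2), min_eq_right h,
        min_eq_right (by omega : j ≤ k + 1)]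
      ring
  rw [plMap, Finset.sum_congr rfl h1, Finset.sum_range_sub (fun k => q (min k j)),
    min_eq_right (node_mono hp (Nat.zero_le j) hj),
    max_eq_right (sub_nonpos.2 (node_mono hp hj le_rfl)), min_eq_right hj, Nat.zero_min, h0]
  ring

theorem plMap_of_le (hp : ∀ k < n, p k < p (k + 1)) {x : ℝ} (hx : x ≤ p 0) : plMap n p q x = x := by
  rw [plMap, Finset.sum_eq_zero fun k hk => ?_, min_eq_left hx, max_eq_right]
  · ring
  · linarith [node_mono hp (Nat.zero_le n) le_rfl]
  · have hk := Finset.mem_range.1 hk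
    have h1 := node_mono hp (Nat.zero_le k) hk.le
    rw [max_eq_left ((min_le_left _ _).trans (div_nonpos_of_nonpos_of_nonneg (by linarith)
      (sub_pos.2 (hp k hk)).le)), mul_zero]

theorem plMap_of_ge (hp : ∀ k < n, p k < p (k + 1)) (h0 : p 0 = q 0) (hn : p n = q n) {x : ℝ}
    (hx : p n ≤ x) : plMap n p q x = x := by
  have h1 : ∀ k ∈ Finset.range n, (q (k + 1) - q k) *
      max 0 (min ((x - p k) / (p (k + 1) - p k)) 1) = q (k + 1) - q k := by
    intro k hk
    have hk := Finset.mem_range.1 hk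
    have h1 := node_mono hp (show k + 1 ≤ n from hk) le_rfl
    rw [min_eq_right ((one_le_div (sub_pos.2 (hp k hk))).2 (by linarith)),
      max_eq_right zero_le_one, mul_one]
  rw [plMap, Finset.sum_congr rfl h1, Finset.sum_range_sub, max_eq_left (by linarith),
    min_eq_right (by linarith [node_mono hp (Nat.zero_le n) le_rfl])]
  linarith

theorem plMap_continuous : Continuous (plMap n p q) := by
  unfold plMap
  fun_prop

theorem plMap_bijective (hp : ∀ k < n, p k < p (k + 1)) (hq : ∀ k < n, q k < q (k + 1))
    (h0 : p 0 = q 0) (hn : p n = q n) : Function.Bijective (plMap n p q) := by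
  refine ⟨(plMap_strictMono hp hq).injective, plMap_continuous.surjective ?_ ?_⟩
  · refine Filter.tendsto_id.congr' ?_
    filter_upwards [Filter.eventually_ge_atTop (p n)] with x hx
    rw [plMap_of_ge hp h0 hn hx]; rfl
  · refine Filter.tendsto_id.congr' ?_
    filter_upwards [Filter.eventually_le_atBot (p 0)] with x hx
    rw [plMap_of_le hp hx]; rfl

end plMap

/-! ### Isotopies supported in a wedge -/

/-- An isotopy of the plane, supported in the wedge `|x| < C y`, `0 < y < δ`, which preserves the
coordinate `y` and moves the curves `x = p k y` to the curves `x = q k y`. -/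
theorem exists_wedge_isotopy (n : ℕ) {δ C : ℝ} (hδ : 0 < δ) (hC : 0 < C) (p q : ℕ → ℝ → ℝ)
    (hpc : ∀ k ≤ n, ContinuousOn (p k) (Ioc 0 δ)) (hqc : ∀ k ≤ n, ContinuousOn (q k) (Ioc 0 δ))
    (hp : ∀ y ∈ Ioc 0 δ, ∀ k < n, p k y < p (k + 1) y)
    (hq : ∀ y ∈ Ioc 0 δ, ∀ k < n, q k y < q (k + 1) y)
    (hp0 : ∀ y ∈ Ioc 0 δ, p 0 y = -(C * y)) (hq0 : ∀ y ∈ Ioc 0 δ, q 0 y = -(C * y))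
    (hpn : ∀ y ∈ Ioc 0 δ, p n y = C * y) (hqn : ∀ y ∈ Ioc 0 δ, q n y = C * y)
    (hpq : ∀ k ≤ n, p k δ = q k δ) :
    ∃ H : unitInterval → ℂ → ℂ, Continuous (fun x : unitInterval × ℂ => H x.1 x.2) ∧
      (∀ τ, Function.Bijective (H τ)) ∧ H 0 = id ∧
      (∀ τ z, ¬ (0 < z.im ∧ z.im < δ ∧ |z.re| < C * z.im) → H τ z = z) ∧
      ∀ k ≤ n, ∀ y ∈ Ioc 0 δ, H 1 (p k y + y * Complex.I) = q k y + y * Complex.I := by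
  -- The target nodes at time `τ` interpolate linearly between `p` and `q`; convex combinations of
  -- increasing families are increasing, so every stage is a homeomorphism of the line.
  set r : unitInterval → ℝ → ℕ → ℝ := fun τ y k => (1 - τ) * p k y + τ * q k y with hr
  have hmem : ∀ y : ℝ, 0 < y → min y δ ∈ Ioc 0 δ := fun y hy => ⟨lt_min hy hδ, min_le_right _ _⟩
  have hr1 : ∀ τ, ∀ y ∈ Ioc 0 δ, ∀ k < n, r τ y k < r τ y (k + 1) := by
    intro τ y hy k hk
    have h1 := hp y hy k hk
    have h2 := hq y hy k hk
    simp only [hr]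
    rcases τ.2.1.eq_or_lt with h | h
    · rw [← h]; linarith
    · nlinarith [τ.2.2, mul_lt_mul_of_pos_left h2 h,
        mul_le_mul_of_nonneg_left h1.le (sub_nonneg.2 τ.2.2)]
  have hr0 : ∀ τ, ∀ y ∈ Ioc 0 δ, p 0 y = r τ y 0 := fun τ y hy => by
    simp only [hr]; rw [hp0 y hy, hq0 y hy]; ring
  have hrn : ∀ τ, ∀ y ∈ Ioc 0 δ, p n y = r τ y n := fun τ y hy => by
    simp only [hr]; rw [hpn y hy, hqn y hy]; ring
  have hrδ : ∀ τ, ∀ k ≤ n, r τ δ k = p k δ := fun τ k hk => by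
    simp only [hr]; rw [← hpq k hk]; ring
  -- the first coordinate of the isotopy
  set h : unitInterval → ℝ → ℝ → ℝ := fun τ y x =>
    if 0 < y then plMap n (fun k => p k (min y δ)) (r τ (min y δ)) x else x with hh
  have hbij : ∀ τ y, Function.Bijective (h τ y) := by
    intro τ y
    by_cases hy : 0 < y
    · have := plMap_bijective (n := n) (p := fun k => p k (min y δ)) (q := r τ (min y δ))
        (hp _ (hmem y hy)) (hr1 τ _ (hmem y hy)) (hr0 τ _ (hmem y hy)) (hrn τ _ (hmem y hy))
      simpa only [hh, if_pos hy] using this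
    · simp only [hh, if_neg hy]
      exact Function.bijective_id
  have hcongr : ∀ (p q q' : ℕ → ℝ) (x : ℝ), (∀ k ≤ n, q k = q' k) →
      plMap n p q x = plMap n p q' x := by
    intro p q q' x h
    rw [plMap, plMap]
    congr 1
    refine Finset.sum_congr rfl fun k hk => ?_
    have hk := Finset.mem_range.1 hk
    rw [h k hk.le, h (k + 1) hk]
  -- Above height `δ` the nodes are frozen at their values for `δ`, where `p` and `q` agree, so the
  -- map is the identity there.
  have hout : ∀ τ y x, ¬ (0 < y ∧ y < δ ∧ |x| < C * y) → h τ y x = x := by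
    intro τ y x hn
    by_cases hy : 0 < y
    · simp only [hh, if_pos hy]
      rcases lt_or_ge y δ with hy' | hy'
      · have hx : C * y ≤ |x| := not_lt.1 fun h => hn ⟨hy, hy', h⟩
        rw [min_eq_left hy'.le]
        have hyδ : y ∈ Ioc 0 δ := ⟨hy, hy'.le⟩
        rcases le_abs.1 hx with h | h
        · exact plMap_of_ge (hp y hyδ) (hr0 τ y hyδ) (hrn τ y hyδ) (by rw [hpn y hyδ]; exact h)
        · exact plMap_of_le (hp y hyδ) (by rw [hp0 y hyδ]; linarith)
      · rw [min_eq_right hy', hcongr _ _ (fun k => p k δ) x (hrδ τ),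
          plMap_self (hp δ ⟨hδ, le_rfl⟩)]
    · simp only [hh, if_neg hy]
  -- Each slice of the wedge is mapped to itself because all points outside are fixed. Its width
  -- tends to zero with `y`, which gives continuity at the apex, where the piecewise linear formula
  -- breaks down.
  have hbound : ∀ τ y x, |h τ y x - x| ≤ 2 * C * max y 0 := by
    intro τ y x
    by_cases hn : 0 < y ∧ y < δ ∧ |x| < C * y
    · have h1 : |h τ y x| < C * y := by
        by_contra hle
        have h2 := hout τ y (h τ y x) fun h3 => hle h3.2.2
        have h3 := (hbij τ y).1 h2
        rw [h3] at hle
        exact hle hn.2.2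
      rw [max_eq_left hn.1.le]
      have := abs_sub (h τ y x) x
      linarith [hn.2.2]
    · rw [hout τ y x hn, sub_self, abs_zero]; positivity
  have hcont : Continuous fun X : unitInterval × ℂ => h X.1 X.2.im X.2.re := by
    rw [continuous_iff_continuousAt]
    rintro ⟨τ, z⟩
    by_cases hz : 0 < z.im
    · have hopen : IsOpen {X : unitInterval × ℂ | 0 < X.2.im} :=
        isOpen_lt continuous_const (Complex.continuous_im.comp continuous_snd)
      have hc : ContinuousOn (fun X : unitInterval × ℂ => plMap n (fun k => p k (min X.2.im δ))
          (r X.1 (min X.2.im δ)) X.2.re) {X : unitInterval × ℂ | 0 < X.2.im} := by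
        have hcm : ContinuousOn (fun X : unitInterval × ℂ => min X.2.im δ)
            {X : unitInterval × ℂ | 0 < X.2.im} :=
          ((Complex.continuous_im.comp continuous_snd).min continuous_const).continuousOn
        have hcp : ∀ k ≤ n, ContinuousOn (fun X : unitInterval × ℂ => p k (min X.2.im δ))
            {X : unitInterval × ℂ | 0 < X.2.im} := fun k hk =>
          (hpc k hk).comp hcm fun X hX => hmem _ hX
        have hcq : ∀ k ≤ n, ContinuousOn (fun X : unitInterval × ℂ => q k (min X.2.im δ))
            {X : unitInterval × ℂ | 0 < X.2.im} := fun k hk =>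
          (hqc k hk).comp hcm fun X hX => hmem _ hX
        have hcτ : ContinuousOn (fun X : unitInterval × ℂ => (X.1 : ℝ))
            {X : unitInterval × ℂ | 0 < X.2.im} :=
          (continuous_subtype_val.comp continuous_fst).continuousOn
        have hcr : ∀ k ≤ n, ContinuousOn (fun X : unitInterval × ℂ => r X.1 (min X.2.im δ) k)
            {X : unitInterval × ℂ | 0 < X.2.im} := fun k hk =>
          ((continuousOn_const.sub hcτ).mul (hcp k hk)).add (hcτ.mul (hcq k hk))
        have hcx : ContinuousOn (fun X : unitInterval × ℂ => X.2.re)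
            {X : unitInterval × ℂ | 0 < X.2.im} :=
          (Complex.continuous_re.comp continuous_snd).continuousOn
        refine ((ContinuousOn.inf hcx (hcp 0 (Nat.zero_le n))).add (ContinuousOn.sup
          (hcx.sub (hcp n le_rfl)) continuousOn_const)).add (continuousOn_finsetSum _ fun k hk => ?_)
        have hk := Finset.mem_range.1 hk
        refine ((hcr _ hk).sub (hcr _ hk.le)).mul (ContinuousOn.sup continuousOn_const
          (ContinuousOn.inf ((hcx.sub (hcp _ hk.le)).div ((hcp _ hk).sub (hcp _ hk.le)) ?_)
            continuousOn_const))
        intro X hX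
        exact (sub_pos.2 (hp _ (hmem _ hX) k hk)).ne'
      refine (hc.continuousAt (hopen.mem_nhds hz)).congr ?_
      filter_upwards [hopen.mem_nhds hz] with X hX
      simp only [hh]
      exact (if_pos hX).symm
    · have h0 : h τ z.im z.re = z.re := by simp only [hh, if_neg hz]
      have hlim : Filter.Tendsto (fun X : unitInterval × ℂ => h X.1 X.2.im X.2.re - X.2.re)
          (nhds (τ, z)) (nhds 0) := by
        refine squeeze_zero_norm (a := fun X : unitInterval × ℂ => 2 * C * max X.2.im 0)
          (fun X => hbound _ _ _) ?_
        have hc : Continuous fun X : unitInterval × ℂ => 2 * C * max X.2.im 0 :=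
          continuous_const.mul ((Complex.continuous_im.comp continuous_snd).max continuous_const)
        have := hc.tendsto (τ, z)
        simpa [max_eq_right (not_lt.1 hz)] using this
      have hre : Filter.Tendsto (fun X : unitInterval × ℂ => X.2.re) (nhds (τ, z)) (nhds z.re) :=
        (Complex.continuous_re.comp continuous_snd).tendsto (τ, z)
      have := hlim.add hre
      rw [ContinuousAt, h0]
      simpa using this
  refine ⟨fun τ z => ⟨h τ z.im z.re, z.im⟩, ?_, fun τ => ⟨?_, ?_⟩, ?_, ?_, ?_⟩
  · have : (fun x : unitInterval × ℂ => (⟨h x.1 x.2.im x.2.re, x.2.im⟩ : ℂ)) =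
        fun x => ((h x.1 x.2.im x.2.re : ℝ) : ℂ) + (x.2.im : ℝ) * Complex.I :=
      funext fun x => by apply Complex.ext <;> simp
    rw [this]
    exact (Complex.continuous_ofReal.comp hcont).add ((Complex.continuous_ofReal.comp
      (Complex.continuous_im.comp continuous_snd)).mul continuous_const)
  · intro z w hzw
    have h1 := congrArg Complex.im hzw
    have h2 := congrArg Complex.re hzw
    simp only at h1 h2
    rw [h1] at h2
    exact Complex.ext ((hbij τ _).1 h2) h1
  · intro w
    obtain ⟨x, hx⟩ := (hbij τ w.im).2 w.re
    exact ⟨⟨x, w.im⟩, Complex.ext hx rfl⟩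
  · funext z
    refine Complex.ext ?_ rfl
    by_cases hz : 0 < z.im
    · have : ∀ k, r 0 (min z.im δ) k = p k (min z.im δ) := fun k => by simp [hr]
      simp only [hh, if_pos hz]
      rw [funext this, plMap_self (hp _ (hmem _ hz))]; rfl
    · simp only [hh, if_neg hz]; rfl
  · intro τ z hz
    exact Complex.ext (hout τ _ _ hz) rfl
  · intro k hk y hy
    have h1 : ((p k y : ℂ) + y * Complex.I).re = p k y := by simp
    have h2 : ((p k y : ℂ) + y * Complex.I).im = y := by simp
    simp only [h1, h2]
    have h3 : h 1 y (p k y) = q k y := by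
      simp only [hh, if_pos hy.1]
      rw [min_eq_left hy.2]
      have := plMap_node (n := n) (p := fun k => p k y) (q := r 1 y) (hp y hy) (hr0 1 y hy) hk
      rw [this]
      simp [hr]
    rw [h3]
    apply Complex.ext <;> simp

/-- An isotopy of the plane which is supported in a subset of the open disk without marked points
restricts to an isotopy of the disk. -/
theorem exists_isotopy_of_plane {W : Set ℂ} (hW : W ⊆ Metric.ball 0 1)
    (hWΔ : ∀ i, ∀ z ∈ Δ.pts i, z ∉ W) {H : unitInterval → ℂ → ℂ}
    (hc : Continuous (fun x : unitInterval × ℂ => H x.1 x.2)) (hb : ∀ τ, Function.Bijective (H τ))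
    (h0 : H 0 = id) (hout : ∀ τ, ∀ z, z ∉ W → H τ z = z) :
    ∃ φ ∈ isotopyGroup Δ, ∀ z : Disk, (φ z : ℂ) = H 1 z := by
  have hWW : ∀ τ, ∀ z ∈ W, H τ z ∈ W := fun τ z hz => by
    by_contra h
    have := (hb τ).1 (hout τ _ h)
    rw [this] at h
    exact h hz
  have hmaps : ∀ τ, ∀ z : Disk, H τ z ∈ Metric.closedBall (0 : ℂ) 1 := fun τ z => by
    by_cases hz : (z : ℂ) ∈ W
    · exact Metric.ball_subset_closedBall (hW (hWW τ z hz))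
    · rw [hout τ z hz]; exact z.2
  have hbij : ∀ τ, Function.Bijective (fun z : Disk => (⟨H τ z, hmaps τ z⟩ : Disk)) := fun τ => by
    refine ⟨fun z w h => Subtype.ext ((hb τ).1 (congrArg Subtype.val h)), fun w => ?_⟩
    obtain ⟨z, hz⟩ := (hb τ).2 w
    have hz1 : z ∈ Metric.closedBall (0 : ℂ) 1 := by
      by_cases hzW : z ∈ W
      · exact Metric.ball_subset_closedBall (hW hzW)
      · rw [hout τ z hzW] at hz; rw [hz]; exact w.2
    exact ⟨⟨z, hz1⟩, Subtype.ext hz⟩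
  have hcont : Continuous fun x : unitInterval × Disk => (⟨H x.1 x.2, hmaps x.1 x.2⟩ : Disk) :=
    (hc.comp (continuous_fst.prodMk (continuous_subtype_val.comp continuous_snd))).subtype_mk _
  let K : unitInterval → (Disk ≃ₜ Disk) := fun τ =>
    Continuous.homeoOfEquivCompactToT2 (f := Equiv.ofBijective _ (hbij τ))
      (hcont.comp (continuous_const.prodMk continuous_id))
  have hK : ∀ τ z, ((K τ z : Disk) : ℂ) = H τ z := fun τ z => rfl
  have hKfix : ∀ τ, ∀ z : Disk, (z : ℂ) ∉ W → K τ z = z := fun τ z hz =>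
    Subtype.ext ((hK τ z).trans (hout τ z hz))
  refine ⟨K 1, ⟨K, hcont, ?_, rfl, fun τ => ⟨fun z hz => hKfix τ z fun h => ?_,
    fun i z hz => hKfix τ z (hWΔ i z hz)⟩⟩, fun z => hK 1 z⟩
  · ext z
    rw [hK, h0]; rfl
  · have := mem_ball_zero_iff.1 (hW h)
    linarith

end PlantComplex

end

noncomputable section

namespace PlantComplex

variable {t : ℕ} {Δ : MarkedPoints t} {ξ : Fin t → ℕ}

/-! ### Germs of curves as graphs -/

/-- Near its starting point the curve `γ` is the graph of a function of the coordinate `y = im`: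
`θ` is the inverse of the function `y` along the curve. -/
structure IsGraph (γ : ℝ → ℂ) (δ C T : ℝ) (θ : ℝ → ℝ) : Prop where
  δ_pos : 0 < δ
  C_pos : 0 < C
  T_mem : T ∈ Ioc (0 : ℝ) 1
  mono : StrictMonoOn (fun s => (γ s).im) (Icc 0 T)
  deriv_pos : ∀ s ∈ Icc 0 T, 0 < (derivWithin γ (Icc 0 1) s).im
  cont : ContinuousOn θ (Icc 0 δ)
  mem : ∀ y ∈ Icc 0 δ, θ y ∈ Icc 0 T
  eq : ∀ y ∈ Icc 0 δ, (γ (θ y)).im = y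
  bound : ∀ s ∈ Icc 0 T, |(γ s).re| ≤ C * (γ s).im

theorem IsGraph.shrink {γ : ℝ → ℂ} {δ C T δ' C' : ℝ} {θ : ℝ → ℝ} (h : IsGraph γ δ C T θ)
    (hδ' : 0 < δ') (hδ : δ' ≤ δ) (hC : C ≤ C') : IsGraph γ δ' C' T θ where
  δ_pos := hδ'
  C_pos := h.C_pos.trans_le hC
  T_mem := h.T_mem
  mono := h.mono
  deriv_pos := h.deriv_pos
  cont := h.cont.mono (Icc_subset_Icc_right hδ)
  mem y hy := h.mem y ⟨hy.1, hy.2.trans hδ⟩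
  eq y hy := h.eq y ⟨hy.1, hy.2.trans hδ⟩
  bound s hs := by
    have h1 := h.bound s hs
    have h2 : 0 ≤ (γ s).im := by
      have := (abs_nonneg _).trans h1
      exact nonneg_of_mul_nonneg_right this h.C_pos
    exact h1.trans (mul_le_mul_of_nonneg_right hC h2)

theorem IsGraph.inv {γ : ℝ → ℂ} {δ C T : ℝ} {θ : ℝ → ℝ} (h : IsGraph γ δ C T θ)
    {s : ℝ} (hs : s ∈ Icc 0 T) (hy : (γ s).im ∈ Icc 0 δ) : θ (γ s).im = s :=
  h.mono.injOn (h.mem _ hy) hs (h.eq _ hy)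

theorem IsGraph.lt_of_lt {γ : ℝ → ℂ} {δ C T : ℝ} {θ : ℝ → ℝ} (h : IsGraph γ δ C T θ)
    {y y' : ℝ} (hy : y ∈ Icc 0 δ) (hy' : y' ∈ Icc 0 δ) (hlt : y < y') : θ y < θ y' := by
  by_contra hle
  have := h.mono.monotoneOn (h.mem _ hy') (h.mem _ hy) (not_lt.1 hle)
  simp only [h.eq _ hy, h.eq _ hy'] at this
  linarith

theorem exists_isGraph {γ : ℝ → ℂ} (hγ : ContDiffOn ℝ (⊤ : ℕ∞) γ (Icc 0 1)) (h0 : γ 0 = 0)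
    (hd : 0 < (derivWithin γ (Icc 0 1) 0).im) {T₀ : ℝ} (hT₀ : 0 < T₀) :
    ∃ δ C T θ, T ≤ T₀ ∧ IsGraph γ δ C T θ := by
  have h01 : (0 : ℝ) ∈ Icc (0 : ℝ) 1 := by simp
  have hder : ∀ s ∈ Icc (0 : ℝ) 1, HasDerivWithinAt γ (derivWithin γ (Icc 0 1) s) (Icc 0 1) s :=
    fun s hs => (hγ.differentiableOn (by simp) s hs).hasDerivWithinAt
  set v := derivWithin γ (Icc 0 1) 0 with hv
  have him : ∀ s ∈ Icc (0 : ℝ) 1, HasDerivWithinAt (fun s => (γ s).im)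
      (derivWithin γ (Icc 0 1) s).im (Icc 0 1) s := fun s hs =>
    Complex.imCLM.hasFDerivAt.comp_hasDerivWithinAt s (hder s hs)
  have hre : HasDerivWithinAt (fun s => (γ s).re) v.re (Icc 0 1) 0 :=
    Complex.reCLM.hasFDerivAt.comp_hasDerivWithinAt (0 : ℝ) (hder 0 h01)
  have hcd : ContinuousOn (fun s => (derivWithin γ (Icc 0 1) s).im) (Icc 0 1) :=
    Complex.continuous_im.comp_continuousOn
      (hγ.continuousOn_derivWithin (uniqueDiffOn_Icc zero_lt_one) (by simp))
  obtain ⟨ε, hε, hε'⟩ : ∃ ε > 0, ∀ s ∈ Icc (0 : ℝ) 1, s ≤ ε → 0 < (derivWithin γ (Icc 0 1) s).im := by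
    have h1 := (hcd 0 h01).eventually (lt_mem_nhds hd)
    rw [eventually_nhdsWithin_iff, Metric.eventually_nhds_iff] at h1
    obtain ⟨ε, hε, h2⟩ := h1
    refine ⟨ε / 2, by positivity, fun s hs hs' => h2 ?_ hs⟩
    rw [Real.dist_0_eq_abs, abs_of_nonneg hs.1]; linarith
  -- The added `1` makes the initial derivatives of `C y - x` and `C y + x` strictly positive.
  set C := (|v.re| + 1) / v.im with hC
  have hCv : C * v.im = |v.re| + 1 := by rw [hC]; field_simp
  have hC0 : 0 < C := by positivity
  obtain ⟨ε₁, hε₁, -, p1⟩ := eventually_pos_of_hasDerivWithinAt (f := fun s => C * (γ s).im - (γ s).re)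
    (((him 0 h01).const_mul C).sub hre) (by simp [h0]) (by linarith [le_abs_self v.re])
  obtain ⟨ε₂, hε₂, -, p2⟩ := eventually_pos_of_hasDerivWithinAt (f := fun s => C * (γ s).im + (γ s).re)
    (((him 0 h01).const_mul C).add hre) (by simp [h0]) (by linarith [neg_abs_le v.re])
  set T := min (min (min ε ε₁) (min ε₂ T₀)) 1 with hT
  have hT0 : 0 < T := by positivity
  have hT1 : T ≤ 1 := min_le_right _ _
  have hTε : T ≤ ε := ((min_le_left _ _).trans (min_le_left _ _)).trans (min_le_left _ _)
  have hTε₁ : T ≤ ε₁ := ((min_le_left _ _).trans (min_le_left _ _)).trans (min_le_right _ _)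
  have hTε₂ : T ≤ ε₂ := ((min_le_left _ _).trans (min_le_right _ _)).trans (min_le_left _ _)
  have hTT₀ : T ≤ T₀ := ((min_le_left _ _).trans (min_le_right _ _)).trans (min_le_right _ _)
  have hsub : Icc (0 : ℝ) T ⊆ Icc 0 1 := Icc_subset_Icc_right hT1
  have hcont : ContinuousOn (fun s => (γ s).im) (Icc 0 T) :=
    (Complex.continuous_im.comp_continuousOn hγ.continuousOn).mono hsub
  have hmono : StrictMonoOn (fun s => (γ s).im) (Icc 0 T) := by
    refine strictMonoOn_of_deriv_pos (convex_Icc 0 T) hcont fun s hs => ?_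
    rw [interior_Icc] at hs
    have hs1 : s ∈ Icc (0 : ℝ) 1 := hsub (Ioo_subset_Icc_self hs)
    rw [((him s hs1).hasDerivAt (Icc_mem_nhds hs.1 (hs.2.trans_le hT1))).deriv]
    exact hε' s hs1 (hs.2.le.trans hTε)
  have hex : ∀ y ∈ Icc (0 : ℝ) (γ T).im, ∃ s ∈ Icc 0 T, (γ s).im = y := fun y hy =>
    intermediate_value_Icc hT0.le hcont (by simpa [h0] using hy)
  choose! θ hθ1 hθ2 using hex
  have hδ : 0 < (γ T).im := by
    have := hmono ⟨le_rfl, hT0.le⟩ ⟨hT0.le, le_rfl⟩ hT0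
    simpa [h0] using this
  refine ⟨(γ T).im, C, T, θ, hTT₀, hδ, hC0, ⟨hT0, hT1⟩, hmono,
    fun s hs => hε' s (hsub hs) (hs.2.trans hTε), ?_, hθ1, hθ2, fun s hs => ?_⟩
  · let f : Icc (0 : ℝ) T → ℝ := fun s => (γ s).im
    have hf : Topology.IsClosedEmbedding f :=
      (continuousOn_iff_continuous_domRestrict.1 hcont).isClosedEmbedding
        fun s u h => Subtype.ext (hmono.injOn s.2 u.2 h)
    rw [continuousOn_iff_continuous_domRestrict]
    have hg : Continuous fun y : Icc (0 : ℝ) (γ T).im => (⟨θ y, hθ1 y y.2⟩ : Icc (0 : ℝ) T) := by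
      rw [hf.isInducing.continuous_iff]
      have : (f ∘ fun y : Icc (0 : ℝ) (γ T).im => (⟨θ y, hθ1 y y.2⟩ : Icc (0 : ℝ) T)) =
          Subtype.val := funext fun y => hθ2 y y.2
      rw [this]; exact continuous_subtype_val
    exact continuous_subtype_val.comp hg
  · rcases hs.1.eq_or_lt with h | h
    · rw [← h, h0]; simp
    · rw [abs_le]
      constructor
      · linarith [p2 s h (hs.2.trans hTε₂)]
      · linarith [p1 s h (hs.2.trans hTε₁)]

/-- An arc in the coordinates at the base point. -/
def Arc.germ (a : Arc Δ) (s : ℝ) : ℂ := a.toFun s + Complex.I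

theorem Arc.germ_zero (a : Arc Δ) : a.germ 0 = 0 := by simp [Arc.germ, a.start]

theorem Arc.germ_smooth (a : Arc Δ) : ContDiffOn ℝ (⊤ : ℕ∞) a.germ (Icc 0 1) :=
  a.smooth.add contDiffOn_const

theorem Arc.derivWithin_germ (a : Arc Δ) (s : ℝ) :
    derivWithin a.germ (Icc 0 1) s = derivWithin a.toFun (Icc 0 1) s := by
  unfold Arc.germ
  rw [derivWithin_add_const]

theorem Arc.germ_im_pos (a : Arc Δ) {s : ℝ} (hs : s ∈ Ioc (0 : ℝ) 1) : 0 < (a.germ s).im := by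
  have := a.im_sub_pos hs
  rw [a.start] at this
  simpa [Arc.germ] using this

theorem Arc.germ_im_nonneg (a : Arc Δ) {s : ℝ} (hs : s ∈ Icc (0 : ℝ) 1) : 0 ≤ (a.germ s).im := by
  rcases hs.1.eq_or_lt with h | h
  · rw [← h, a.germ_zero]; simp
  · exact (a.germ_im_pos ⟨h, hs.2⟩).le

/-- Points of an arc near the base point have small parameters. -/
theorem Arc.exists_lt_germ (a : Arc Δ) {T : ℝ} (hT : 0 < T) :
    ∃ m > 0, ∀ s ∈ Icc (0 : ℝ) 1, T ≤ s → m < (a.germ s).im := by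
  rcases lt_or_ge 1 T with h | h
  · exact ⟨1, one_pos, fun s hs hs' => by linarith [hs.2]⟩
  · have hc : ContinuousOn (fun s => (a.germ s).im) (Icc T 1) :=
      Complex.continuous_im.comp_continuousOn
        (a.germ_smooth.continuousOn.mono (Icc_subset_Icc_left hT.le))
    obtain ⟨s₀, hs₀, hmin⟩ := isCompact_Icc.exists_isMinOn ⟨T, le_rfl, h⟩ hc
    have hpos := a.germ_im_pos ⟨hT.trans_le hs₀.1, hs₀.2⟩
    refine ⟨(a.germ s₀).im / 2, by positivity, fun s hs hs' => ?_⟩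
    have h1 : (a.germ s₀).im ≤ (a.germ s).im := hmin (show s ∈ Icc T 1 from ⟨hs', hs.2⟩)
    linarith

theorem exists_min_pos {ι : Type*} [Finite ι] {f : ι → ℝ} (hf : ∀ i, 0 < f i) :
    ∃ m > 0, ∀ i, m ≤ f i := by
  cases isEmpty_or_nonempty ι
  · exact ⟨1, one_pos, fun i => isEmptyElim i⟩
  · obtain ⟨i, hi⟩ := Finite.exists_min f
    exact ⟨f i, hf i, hi⟩

/-- The last clause says that an arc does not return to heights at most `δ` after its initial graph
piece: the height is positive on the compact remainder. Below `δ` the arcs are thus nothing but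
graphs. -/
theorem exists_graphs {ι : Type*} [Finite ι] (a : ι → Arc Δ) :
    ∃ δ C, ∃ T : ι → ℝ, ∃ θ : ι → ℝ → ℝ, ∀ k, IsGraph (a k).germ δ C (T k) (θ k) ∧
      ∀ s ∈ Icc (0 : ℝ) 1, ((a k).germ s).im ≤ δ → s ≤ T k := by
  have h1 : ∀ k, ∃ δ C T θ, IsGraph (a k).germ δ C T θ ∧
      ∀ s ∈ Icc (0 : ℝ) 1, ((a k).germ s).im ≤ δ → s ≤ T := fun k => by
    obtain ⟨δ, C, T, θ, -, h⟩ := exists_isGraph (a k).germ_smooth (a k).germ_zero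
      (by rw [(a k).derivWithin_germ]; exact (a k).tangent_im_pos) one_pos
    obtain ⟨m, hm, hm'⟩ := (a k).exists_lt_germ h.T_mem.1
    refine ⟨min δ m, C, T, θ, h.shrink (lt_min h.δ_pos hm) (min_le_left _ _) le_rfl,
      fun s hs hs' => ?_⟩
    by_contra hle
    have := hm' s hs (not_le.1 hle).le
    linarith [hs'.trans (min_le_right _ _)]
  choose δ C T θ h1 h2 using h1
  obtain ⟨m, hm, hm'⟩ := exists_min_pos fun k => (h1 k).δ_pos
  obtain ⟨M, hM⟩ := (Set.finite_range C).bddAbove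
  exact ⟨m, M, T, θ, fun k => ⟨(h1 k).shrink hm (hm' k) (hM (mem_range_self k)),
    fun s hs hs' => h2 k s hs (hs'.trans (hm' k))⟩⟩

/-! ### The order of arcs at the base point -/

/-- The arcs are ordered from the left to the right near the base point. -/
def OrderedAtBase {N : ℕ} (a : Fin N → Arc Δ) : Prop :=
  ∃ δ > 0, ∀ k l, k < l → ∀ s ∈ Ioc (0 : ℝ) 1, ∀ u ∈ Ioc (0 : ℝ) 1,
    ((a k).germ s).im = ((a l).germ u).im → ((a k).germ s).im ≤ δ →
      ((a k).germ s).re < ((a l).germ u).re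

/-- A line of slope strictly between those of two tangents separates the two arcs near the base
point. -/
theorem orderedAtBase_of_strictAnti {N : ℕ} {a : Fin N → Arc Δ}
    (h : StrictAnti fun k => (a k).tangent.arg) : OrderedAtBase a := by
  have hpair : ∀ p : Fin N × Fin N, ∃ δ > 0, p.1 < p.2 → ∀ s ∈ Ioc (0 : ℝ) 1, ∀ u ∈ Ioc (0 : ℝ) 1,
      ((a p.1).germ s).im = ((a p.2).germ u).im → ((a p.1).germ s).im ≤ δ →
      ((a p.1).germ s).re < ((a p.2).germ u).re := by
    rintro ⟨k, l⟩
    by_cases hkl : k < l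
    · have hk := (a k).tangent_im_pos
      have hl := (a l).tangent_im_pos
      have h1 := (arg_lt_arg_iff hl hk).1 (h hkl)
      have h2 : (a k).tangent.re / (a k).tangent.im < (a l).tangent.re / (a l).tangent.im := by
        rw [div_lt_div_iff₀ hk hl]; exact h1
      obtain ⟨m, hm1, hm2⟩ := exists_between h2
      rw [div_lt_iff₀ hk] at hm1
      rw [lt_div_iff₀ hl] at hm2
      have hder : ∀ k, HasDerivWithinAt (a k).germ (a k).tangent (Icc 0 1) 0 := fun k =>
        (a k).hasDerivWithinAt_zero.add_const _
      have him : ∀ k, HasDerivWithinAt (fun s => ((a k).germ s).im) (a k).tangent.im (Icc 0 1) 0 :=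
        fun k => Complex.imCLM.hasFDerivAt.comp_hasDerivWithinAt (0 : ℝ) (hder k)
      have hre : ∀ k, HasDerivWithinAt (fun s => ((a k).germ s).re) (a k).tangent.re (Icc 0 1) 0 :=
        fun k => Complex.reCLM.hasFDerivAt.comp_hasDerivWithinAt (0 : ℝ) (hder k)
      obtain ⟨ε₁, hε₁, -, p1⟩ := eventually_pos_of_hasDerivWithinAt
        (f := fun s => m * ((a k).germ s).im - ((a k).germ s).re)
        (((him k).const_mul m).sub (hre k)) (by simp [(a k).germ_zero]) (by linarith)
      obtain ⟨ε₂, hε₂, -, p2⟩ := eventually_pos_of_hasDerivWithinAt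
        (f := fun s => ((a l).germ s).re - m * ((a l).germ s).im)
        ((hre l).sub ((him l).const_mul m)) (by simp [(a l).germ_zero]) (by linarith)
      obtain ⟨m₁, hm₁, q1⟩ := (a k).exists_lt_germ hε₁
      obtain ⟨m₂, hm₂, q2⟩ := (a l).exists_lt_germ hε₂
      refine ⟨min m₁ m₂, lt_min hm₁ hm₂, fun _ s hs u hu he hle => ?_⟩
      have r1 : s ≤ ε₁ := by
        by_contra hlt
        have := q1 s ⟨hs.1.le, hs.2⟩ (not_le.1 hlt).le
        linarith [hle.trans (min_le_left _ _)]
      have r2 : u ≤ ε₂ := by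
        by_contra hlt
        have := q2 u ⟨hu.1.le, hu.2⟩ (not_le.1 hlt).le
        rw [he] at hle
        linarith [hle.trans (min_le_right _ _)]
      have e1 := p1 s hs.1 r1
      have e2 := p2 u hu.1 r2
      simp only at e1 e2 he
      rw [he] at e1
      linarith
    · exact ⟨1, one_pos, fun h => absurd h hkl⟩
  choose δ hδ hp using hpair
  obtain ⟨m, hm, hm'⟩ := exists_min_pos hδ
  exact ⟨m, hm, fun k l hkl s hs u hu he hle => hp (k, l) hkl s hs u hu he (hle.trans (hm' _))⟩

/-- Tangent directions may coincide here, so the arcs are sorted by their horizontal positions at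
height `δ`. Disjoint graphs cannot cross, by the intermediate value theorem, so this order holds at
all lower heights. -/
theorem exists_perm_orderedAtBase {N : ℕ} (a : Fin N → Arc Δ)
    (hd : ∀ k l, k ≠ l → (a k).carrier ∩ (a l).carrier = {base}) :
    ∃ e : Equiv.Perm (Fin N), OrderedAtBase (a ∘ e) := by
  obtain ⟨δ, C, T, θ, h⟩ := exists_graphs a
  set f : Fin N → ℝ → ℝ := fun k y => ((a k).germ (θ k y)).re with hf
  have hIcc : ∀ k, Icc 0 (T k) ⊆ Icc (0 : ℝ) 1 := fun k =>
    Icc_subset_Icc_right (h k).1.T_mem.2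
  have hfc : ∀ k, ContinuousOn (f k) (Icc 0 δ) := fun k =>
    Complex.continuous_re.comp_continuousOn ((a k).germ_smooth.continuousOn.comp (h k).1.cont
      fun y hy => hIcc k ((h k).1.mem y hy))
  have hne : ∀ k l, k ≠ l → ∀ y ∈ Ioc 0 δ, f k y ≠ f l y := by
    intro k l hkl y hy he
    have hy' := Ioc_subset_Icc_self hy
    have h1 : (a k).toFun (θ k y) = (a l).toFun (θ l y) := by
      have : (a k).germ (θ k y) = (a l).germ (θ l y) :=
        Complex.ext he (((h k).1.eq y hy').trans ((h l).1.eq y hy').symm)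
      exact add_right_cancel this
    have h2 := Arc.eq_zero_of_eq (hd k l hkl) (hIcc k ((h k).1.mem y hy'))
      (hIcc l ((h l).1.mem y hy')) h1
    have h3 := (h k).1.eq y hy'
    rw [h2.1, (a k).germ_zero] at h3
    exact hy.1.ne h3
  have hδ : Fin N → 0 < δ := fun k => (h k).1.δ_pos
  have hsign : ∀ k l, f k δ < f l δ → ∀ y ∈ Ioc 0 δ, f k y < f l y := by
    intro k l hkl y hy
    have hkl' : k ≠ l := fun h => by rw [h] at hkl; exact lt_irrefl _ hkl
    by_contra hle
    have hc : ContinuousOn (fun y => f l y - f k y) (Icc y δ) :=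
      ((hfc l).sub (hfc k)).mono (Icc_subset_Icc_left hy.1.le)
    obtain ⟨z, hz, hz'⟩ := intermediate_value_Icc hy.2 hc
      (show (0 : ℝ) ∈ Icc _ _ from ⟨by linarith, by linarith⟩)
    exact hne k l hkl' z ⟨hy.1.trans_le hz.1, hz.2⟩ (by linarith)
  have hsort := Tuple.monotone_sort fun k => f k δ
  refine ⟨Tuple.sort fun k => f k δ, ?_⟩
  rcases Nat.eq_zero_or_pos N with rfl | hN
  · exact ⟨1, one_pos, fun k => k.elim0⟩
  · refine ⟨δ, hδ ⟨0, hN⟩, fun k l hkl s hs u hu he hle => ?_⟩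
    set k' := Tuple.sort (fun k => f k δ) k
    set l' := Tuple.sort (fun k => f k δ) l
    have hkl' : k' ≠ l' := fun h => hkl.ne ((Tuple.sort fun k => f k δ).injective h)
    have h1 : f k' δ < f l' δ := lt_of_le_of_ne (hsort hkl.le) (hne k' l' hkl' δ ⟨hδ k', le_rfl⟩)
    have he : ((a k').germ s).im = ((a l').germ u).im := he
    have hle : ((a k').germ s).im ≤ δ := hle
    have hs' : s ∈ Icc (0 : ℝ) 1 := ⟨hs.1.le, hs.2⟩
    have hu' : u ∈ Icc (0 : ℝ) 1 := ⟨hu.1.le, hu.2⟩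
    have hpos := (a k').germ_im_pos hs
    have h2 := hsign k' l' h1 _ ⟨hpos, hle⟩
    have e1 : θ k' ((a k').germ s).im = s :=
      (h k').1.inv ⟨hs.1.le, (h k').2 s hs' hle⟩ ⟨hpos.le, hle⟩
    have e2 : θ l' ((a k').germ s).im = u := by
      rw [he] at hle hpos ⊢
      exact (h l').1.inv ⟨hu.1.le, (h l').2 u hu' hle⟩ ⟨hpos.le, hle⟩
    simp only [hf, e1, e2] at h2
    exact h2

end PlantComplex

end

noncomputable section

namespace PlantComplex

variable {t : ℕ} {Δ : MarkedPoints t} {ξ : Fin t → ℕ}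

/-! ### Images of arcs under isotopies -/

theorem isotopy_norm_lt {φ : Disk ≃ₜ Disk} (hφ : φ ∈ isotopyGroup Δ) {z : Disk}
    (hz : ‖(z : ℂ)‖ < 1) : ‖(φ z : ℂ)‖ < 1 := by
  have h1 : ‖(φ z : ℂ)‖ ≤ 1 := mem_closedBall_zero_iff.1 (φ z).2
  refine lt_of_le_of_ne h1 fun h => ?_
  have h2 := isotopy_fixesBoundary hφ _ h
  rw [φ.injective h2] at h
  exact hz.ne h

/-- The image of an arc under a homeomorphism in the isotopy group, if it is smooth. -/
theorem exists_arc_of_isotopy (a : Arc Δ) {φ : Disk ≃ₜ Disk} (hφ : φ ∈ isotopyGroup Δ) {b : ℝ → ℂ}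
    (hb : ∀ s : unitInterval, (φ (a.pt s) : ℂ) = b s) (hs : ContDiffOn ℝ (⊤ : ℕ∞) b (Icc 0 1))
    (hi : ∀ s ∈ Icc (0 : ℝ) 1, derivWithin b (Icc 0 1) s ≠ 0)
    (ht : (derivWithin b (Icc 0 1) 0).im ≠ 0) :
    ∃ a' : Arc Δ, a'.toFun = b ∧ φ '' a.carrier = a'.carrier := by
  have hb' : ∀ (s : ℝ) (h : s ∈ Icc (0 : ℝ) 1), b s = φ (a.pt ⟨s, h⟩) := fun s h => (hb ⟨s, h⟩).symm
  refine ⟨⟨b, hs, ?_, hi, ?_, ?_, ht, ?_⟩, rfl, ?_⟩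
  · intro s hs u hu h
    rw [hb' s hs, hb' u hu] at h
    exact congrArg Subtype.val (a.pt_injective (φ.injective (Subtype.ext h)))
  · have := hb 0
    rw [a.pt_zero, isotopy_base hφ] at this
    exact this.symm
  · obtain ⟨i, hi⟩ := a.tip_marked
    refine ⟨i, ?_⟩
    have := hb 1
    rw [show a.pt 1 = a.tip from rfl, isotopy_fixesMarked hφ i _ hi] at this
    rw [show b 1 = a.tip from this.symm]
    exact hi
  · intro s hs
    have hs' := Ioo_subset_Icc_self hs
    rw [hb' s hs']
    refine ⟨isotopy_norm_lt hφ (a.interior s hs).1, fun i h => ?_⟩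
    have h1 := isotopy_fixesMarked hφ i _ h
    have h2 := φ.injective h1
    rw [h2] at h
    exact (a.interior s hs).2 i h
  · ext z
    rw [a.carrier_eq_range]
    constructor
    · rintro ⟨_, ⟨s, rfl⟩, rfl⟩
      exact ⟨s, s.2, (hb s).symm⟩
    · rintro ⟨s, hs, h⟩
      exact ⟨_, ⟨⟨s, hs⟩, rfl⟩, Subtype.ext ((hb ⟨s, hs⟩).trans h)⟩

/-! ### Straight initial segments. -/

/-- Up to the height `δ` the arc is a segment of slope `x = c y`. -/
def StraightStart (b : Arc Δ) (c δ : ℝ) : Prop :=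
  ∃ s₀ ∈ Ioo (0 : ℝ) 1, StrictMonoOn (fun s => (b.germ s).im) (Icc 0 s₀) ∧ (b.germ s₀).im = δ ∧
    (∀ s ∈ Icc 0 s₀, (b.germ s).re = c * (b.germ s).im) ∧
    ∀ s ∈ Ioc s₀ 1, δ < (b.germ s).im

theorem StraightStart.shrink {b : Arc Δ} {c δ δ' : ℝ} (h : StraightStart b c δ) (h0 : 0 < δ')
    (hle : δ' ≤ δ) : StraightStart b c δ' := by
  obtain ⟨s₀, hs₀, hm, he, hl, hg⟩ := h
  have hc : ContinuousOn (fun s => (b.germ s).im) (Icc 0 s₀) :=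
    Complex.continuous_im.comp_continuousOn
      (b.germ_smooth.continuousOn.mono (Icc_subset_Icc_right hs₀.2.le))
  obtain ⟨s₁, hs₁, hs₁'⟩ := intermediate_value_Icc hs₀.1.le hc
    (show δ' ∈ Icc _ _ by rw [b.germ_zero]; exact ⟨h0.le, by rw [he]; exact hle⟩)
  replace hs₁' : (b.germ s₁).im = δ' := hs₁'
  have hs1 : 0 < s₁ := lt_of_le_of_ne hs₁.1 fun h => by
    rw [← h, b.germ_zero] at hs₁'; exact h0.ne hs₁'
  refine ⟨s₁, ⟨hs1, hs₁.2.trans_lt hs₀.2⟩, hm.mono (Icc_subset_Icc_right hs₁.2), hs₁',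
    fun s hs => hl s ⟨hs.1, hs.2.trans hs₁.2⟩, fun s hs => ?_⟩
  rcases le_or_gt s s₀ with h | h
  · rw [← hs₁']
    exact hm hs₁ ⟨hs1.le.trans hs.1.le, h⟩ hs.1
  · exact hle.trans_lt (hg s ⟨h, hs.2⟩)

theorem StraightStart.tangent {b : Arc Δ} {c δ : ℝ} (h : StraightStart b c δ) :
    b.tangent.re = c * b.tangent.im := by
  obtain ⟨s₀, hs₀, -, -, hl, -⟩ := h
  have hder : HasDerivWithinAt b.germ b.tangent (Icc 0 1) 0 := b.hasDerivWithinAt_zero.add_const _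
  have him : HasDerivWithinAt (fun s => (b.germ s).im) b.tangent.im (Icc 0 1) 0 :=
    Complex.imCLM.hasFDerivAt.comp_hasDerivWithinAt (0 : ℝ) hder
  have hre : HasDerivWithinAt (fun s => (b.germ s).re) b.tangent.re (Icc 0 1) 0 :=
    Complex.reCLM.hasFDerivAt.comp_hasDerivWithinAt (0 : ℝ) hder
  have hsub : Icc 0 s₀ ⊆ Icc (0 : ℝ) 1 := Icc_subset_Icc_right hs₀.2.le
  have h1 := (hre.mono hsub)
  have h2 : HasDerivWithinAt (fun s => (b.germ s).re) (c * b.tangent.im) (Icc 0 s₀) 0 :=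
    ((him.mono hsub).const_mul c).congr (fun s hs => hl s hs) (hl 0 ⟨le_rfl, hs₀.1.le⟩)
  exact (uniqueDiffOn_Icc hs₀.1 0 ⟨le_rfl, hs₀.1.le⟩).eq_deriv _ h1 h2

theorem strictAnti_arg_of_straightStart {N : ℕ} {b : Fin N → Arc Δ} {c : Fin N → ℝ}
    (hc : StrictMono c) {δ : ℝ} (h : ∀ k, StraightStart (b k) (c k) δ) :
    StrictAnti fun k => (b k).tangent.arg := by
  intro k l hkl
  change (b l).tangent.arg < (b k).tangent.arg
  rw [arg_lt_arg_iff (b l).tangent_im_pos (b k).tangent_im_pos, (h k).tangent, (h l).tangent]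
  have h1 := mul_pos (b l).tangent_im_pos (b k).tangent_im_pos
  nlinarith [hc hkl]

/-- In coordinates centred at `-i` the open disk is `x² + y² < 2y`, and in the wedge `x² + y² < (1 +
C²) y²`. -/
theorem norm_lt_one_of_wedge {C δ : ℝ} (hδ : δ * (1 + C ^ 2) < 2) {z : ℂ}
    (h0 : 0 < z.im) (h1 : z.im < δ) (h2 : |z.re| < C * z.im) : ‖z - Complex.I‖ < 1 := by
  have h3 : z.re ^ 2 < (C * z.im) ^ 2 := sq_lt_sq' (by linarith [neg_abs_le z.re]) (by linarith [le_abs_self z.re])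
  have h4 : ‖z - Complex.I‖ ^ 2 < 1 := by
    rw [Complex.sq_norm, Complex.normSq_apply]
    simp only [Complex.sub_re, Complex.I_re, Complex.sub_im, Complex.I_im]
    have h5 : z.im * (1 + C ^ 2) < 2 := by nlinarith [sq_nonneg C]
    nlinarith
  nlinarith [norm_nonneg (z - Complex.I)]

theorem finite_marked (Δ : MarkedPoints t) : {z : ℂ | ∃ i, z ∈ Δ.pts i}.Finite := by
  have : {z : ℂ | ∃ i, z ∈ Δ.pts i} = ⋃ i, (Δ.pts i : Set ℂ) := by ext; simp
  rw [this]
  exact Set.finite_iUnion fun i => (Δ.pts i).finite_toSet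

theorem exists_lt_im_marked (Δ : MarkedPoints t) :
    ∃ m > 0, ∀ i, ∀ z ∈ Δ.pts i, m < z.im + 1 := by
  have : Finite {z : ℂ // ∃ i, z ∈ Δ.pts i} := finite_marked Δ
  obtain ⟨m, hm, hm'⟩ := exists_min_pos (f := fun z : {z : ℂ // ∃ i, z ∈ Δ.pts i} => z.1.im + 1)
    fun z => by
      obtain ⟨i, hi⟩ := z.2
      have h1 := Δ.norm_lt_one i _ hi
      have := (abs_lt.1 ((Complex.abs_im_le_norm z.1).trans_lt h1)).1
      linarith
  exact ⟨m / 2, by positivity, fun i z hz => by linarith [hm' ⟨z, i, hz⟩]⟩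

/-- Arcs can be straightened near the base point by an isotopy. -/
theorem exists_straightStart {N : ℕ} {a : Fin N → Arc Δ} (ho : OrderedAtBase a) {c : Fin N → ℝ}
    (hc : StrictMono c) : ∃ φ ∈ isotopyGroup Δ, ∃ b : Fin N → Arc Δ, ∃ δ > 0,
      (∀ k, φ '' (a k).carrier = (b k).carrier) ∧ ∀ k, StraightStart (b k) (c k) δ := by
  rcases Nat.eq_zero_or_pos N with rfl | hN
  · exact ⟨1, one_mem _, a, 1, one_pos, fun k => k.elim0, fun k => k.elim0⟩
  obtain ⟨δ₁, C₁, T, θ, h₁⟩ := exists_graphs a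
  have hδ₁ := (h₁ ⟨0, hN⟩).1.δ_pos
  have hC₁ := (h₁ ⟨0, hN⟩).1.C_pos
  obtain ⟨δ₂, hδ₂, ho⟩ := ho
  obtain ⟨δ₃, hδ₃, hmark⟩ := exists_lt_im_marked Δ
  obtain ⟨C₂, hC₂⟩ := (Set.finite_range fun k => |c k|).bddAbove
  have hC₂ : ∀ k, |c k| ≤ C₂ := fun k => hC₂ (mem_range_self k)
  have hC₂0 : 0 ≤ C₂ := (abs_nonneg _).trans (hC₂ ⟨0, hN⟩)
  -- The wedge must strictly contain both the given graphs (`C₁`) and the target lines (`C₂`).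
  obtain ⟨C, hCdef⟩ : ∃ C, C = C₁ + C₂ + 1 := ⟨_, rfl⟩
  have hC0 : 0 < C := by linarith
  -- Below height `δ` the arcs are ordered graphs, there are no marked points, and the wedge lies in
  -- the open disk.
  obtain ⟨δ, hδ0, hd1, hd2, hd3, hd4⟩ : ∃ δ > 0, δ ≤ δ₁ ∧ δ ≤ δ₂ ∧ δ ≤ δ₃ ∧ δ * (1 + C ^ 2) < 2 := by
    refine ⟨min (min δ₁ δ₂) (min δ₃ (1 / (1 + C ^ 2))), by positivity,
      (min_le_left _ _).trans (min_le_left _ _), (min_le_left _ _).trans (min_le_right _ _),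
      (min_le_right _ _).trans (min_le_left _ _), ?_⟩
    have : min (min δ₁ δ₂) (min δ₃ (1 / (1 + C ^ 2))) ≤ 1 / (1 + C ^ 2) :=
      (min_le_right _ _).trans (min_le_right _ _)
    have h2 := mul_le_mul_of_nonneg_right this (show 0 ≤ 1 + C ^ 2 by positivity)
    rw [one_div_mul_cancel (by positivity)] at h2
    linarith
  have h : ∀ k, IsGraph (a k).germ δ C₁ (T k) (θ k) := fun k => (h₁ k).1.shrink hδ0 hd1 le_rfl
  have hT : ∀ k, ∀ s ∈ Icc (0 : ℝ) 1, ((a k).germ s).im ≤ δ → s ≤ T k := fun k s hs hs' =>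
    (h₁ k).2 s hs (hs'.trans hd1)
  have hIcc : ∀ k, Icc 0 (T k) ⊆ Icc (0 : ℝ) 1 := fun k => Icc_subset_Icc_right (h k).T_mem.2
  set f : Fin N → ℝ → ℝ := fun k y => ((a k).germ (θ k y)).re with hf
  have hfb : ∀ k, ∀ y ∈ Icc 0 δ, |f k y| ≤ C₁ * y := fun k y hy => by
    have := (h k).bound _ ((h k).mem y hy)
    rwa [(h k).eq y hy] at this
  have hfc : ∀ k, ContinuousOn (f k) (Icc 0 δ) := fun k =>
    Complex.continuous_re.comp_continuousOn ((a k).germ_smooth.continuousOn.comp (h k).cont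
      fun y hy => hIcc k ((h k).mem y hy))
  have hθpos : ∀ k, ∀ y ∈ Ioc 0 δ, θ k y ∈ Ioc (0 : ℝ) 1 := fun k y hy => by
    have h1 := (h k).mem y (Ioc_subset_Icc_self hy)
    refine ⟨lt_of_le_of_ne h1.1 fun h0 => ?_, (hIcc k h1).2⟩
    have h2 := (h k).eq y (Ioc_subset_Icc_self hy)
    rw [← h0, (a k).germ_zero] at h2
    exact hy.1.ne h2
  have hforder : ∀ k l, k < l → ∀ y ∈ Ioc 0 δ, f k y < f l y := fun k l hkl y hy => by
    have e1 := (h k).eq y (Ioc_subset_Icc_self hy)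
    have e2 := (h l).eq y (Ioc_subset_Icc_self hy)
    exact ho k l hkl _ (hθpos k y hy) _ (hθpos l y hy) (e1.trans e2.symm)
      (by rw [e1]; exact hy.2.trans hd2)
  -- the cut-off function
  set χ : ℝ → ℝ := fun y => Real.smoothTransition ((δ / 2 - y) / (δ / 4)) with hχ
  have hχs : ContDiff ℝ (⊤ : ℕ∞) χ := by
    refine Real.smoothTransition.contDiff.comp ?_
    exact (contDiff_const.sub contDiff_id).div_const _
  have hχ1 : ∀ y, y ≤ δ / 4 → χ y = 1 := fun y hy => Real.smoothTransition.one_of_one_le (by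
    rw [one_le_div (by positivity)]; linarith)
  have hχ0 : ∀ y, δ / 2 ≤ y → χ y = 0 := fun y hy => Real.smoothTransition.zero_of_nonpos
    (div_nonpos_of_nonpos_of_nonneg (by linarith) (by positivity))
  have hχm : ∀ y, 0 ≤ χ y ∧ χ y ≤ 1 := fun y =>
    ⟨Real.smoothTransition.nonneg _, Real.smoothTransition.le_one _⟩
  -- Equal to `f k` above `δ / 2` and to the line `c k * y` below `δ / 4`. In between it is a convex
  -- combination, with weights independent of `k`, of two families in the same order, so the graphs
  -- stay disjoint.
  set g : Fin N → ℝ → ℝ := fun k y => f k y - χ y * (f k y - c k * y) with hg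
  have hgb : ∀ k, ∀ y ∈ Ioc 0 δ, |f k y| < C * y ∧ |g k y| < C * y := fun k y hy => by
    have h1 := hfb k y (Ioc_subset_Icc_self hy)
    have h2 : |c k * y| ≤ C₂ * y := by
      rw [abs_mul, abs_of_pos hy.1]
      exact mul_le_mul_of_nonneg_right (hC₂ k) hy.1.le
    have h3 := hχm y
    have e : C * y = C₁ * y + C₂ * y + y := by rw [hCdef]; ring
    have p1 : 0 ≤ C₁ * y := (mul_pos hC₁ hy.1).le
    have p2 : 0 ≤ C₂ * y := mul_nonneg hC₂0 hy.1.le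
    refine ⟨by linarith [hy.1], ?_⟩
    have h4 : g k y = (1 - χ y) * f k y + χ y * (c k * y) := by simp only [hg]; ring
    rw [h4]
    refine (abs_add_le _ _).trans_lt ?_
    rw [abs_mul, abs_mul, abs_of_nonneg h3.1, abs_of_nonneg (sub_nonneg.2 h3.2)]
    have q1 := mul_le_mul_of_nonneg_left h1 (sub_nonneg.2 h3.2)
    have q2 := mul_le_mul_of_nonneg_left h2 h3.1
    have q3 : (1 - χ y) * (C₁ * y) ≤ C₁ * y := by nlinarith
    have q4 : χ y * (C₂ * y) ≤ C₂ * y := by nlinarith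
    linarith [hy.1]
  have hgorder : ∀ k l, k < l → ∀ y ∈ Ioc 0 δ, g k y < g l y := fun k l hkl y hy => by
    have h1 := hforder k l hkl y hy
    have h2 : c k * y < c l * y := mul_lt_mul_of_pos_right (hc hkl) hy.1
    have h3 := hχm y
    simp only [hg]
    rcases h3.1.eq_or_lt with h0 | h0
    · rw [← h0]; linarith
    · nlinarith [mul_lt_mul_of_pos_left h2 h0,
        mul_le_mul_of_nonneg_left h1.le (sub_nonneg.2 h3.2)]
  have hgc : ∀ k, ContinuousOn (g k) (Icc 0 δ) := fun k =>
    (hfc k).sub (hχs.continuous.continuousOn.mul ((hfc k).sub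
      (continuousOn_const.mul continuousOn_id)))
  -- the nodes
  let node : (Fin N → ℝ → ℝ) → ℕ → ℝ → ℝ := fun f j y =>
    if j = 0 then -(C * y) else if hj : j - 1 < N then f ⟨j - 1, hj⟩ y else C * y
  have node0 : ∀ f y, node f 0 y = -(C * y) := fun f y => rfl
  have nodeS : ∀ f (k : Fin N) y, node f (k + 1) y = f k y := fun f k y => by
    simp [node, k.2]
  have nodeN : ∀ f y, node f (N + 1) y = C * y := fun f y => by simp [node]
  have hcases : ∀ j ≤ N + 1, j = 0 ∨ (∃ k : Fin N, j = k + 1) ∨ j = N + 1 := fun j hj => by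
    rcases Nat.eq_zero_or_pos j with h | h
    · exact Or.inl h
    · rcases Nat.lt_or_ge j (N + 1) with h' | h'
      · exact Or.inr (Or.inl ⟨⟨j - 1, by omega⟩, by simp; omega⟩)
      · exact Or.inr (Or.inr (le_antisymm hj h'))
  have hnodec : ∀ f : Fin N → ℝ → ℝ, (∀ k, ContinuousOn (f k) (Icc 0 δ)) →
      ∀ j ≤ N + 1, ContinuousOn (node f j) (Ioc 0 δ) := by
    intro f hf j hj
    have hlin : ContinuousOn (fun y : ℝ => C * y) (Ioc 0 δ) := by fun_prop
    rcases hcases j hj with rfl | ⟨k, rfl⟩ | rfl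
    · exact hlin.neg
    · exact ((hf k).mono Ioc_subset_Icc_self).congr fun y _ => nodeS f k y
    · exact hlin.congr fun y _ => nodeN f y
  have hnodem : ∀ f : Fin N → ℝ → ℝ, (∀ k, ∀ y ∈ Ioc 0 δ, |f k y| < C * y) →
      (∀ k l, k < l → ∀ y ∈ Ioc 0 δ, f k y < f l y) →
      ∀ y ∈ Ioc 0 δ, ∀ j < N + 1, node f j y < node f (j + 1) y := by
    intro f hb hm y hy j hj
    have hlast : ∀ k : Fin N, f k y < C * y := fun k => (le_abs_self _).trans_lt (hb k y hy)
    rcases hcases j hj.le with rfl | ⟨k, rfl⟩ | rfl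
    · have := nodeS f ⟨0, hN⟩ y
      rw [node0, this]
      linarith [neg_abs_le (f ⟨0, hN⟩ y), hb ⟨0, hN⟩ y hy]
    · rw [nodeS]
      rcases Nat.lt_or_ge (k + 1) N with h' | h'
      · have := nodeS f ⟨k + 1, h'⟩ y
        rw [this]
        exact hm _ _ (Fin.lt_def.2 (Nat.lt_succ_self _)) y hy
      · rw [show (k : ℕ) + 1 + 1 = N + 1 by omega, nodeN]
        exact hlast k
    · omega
  have hδmem : δ ∈ Ioc 0 δ := ⟨hδ0, le_rfl⟩
  have hgδ : ∀ k, ∀ y, δ / 2 ≤ y → g k y = f k y := fun k y hy => by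
    simp only [hg, hχ0 y hy]; ring
  obtain ⟨H, hHc, hHb, hH0, hHout, hHnode⟩ := exists_wedge_isotopy (N + 1) hδ0 hC0 (node f) (node g)
    (hnodec f hfc) (hnodec g hgc) (hnodem f (fun k y hy => (hgb k y hy).1) hforder)
    (hnodem g (fun k y hy => (hgb k y hy).2) hgorder) (fun y _ => rfl) (fun y _ => rfl)
    (fun y _ => nodeN f y) (fun y _ => nodeN g y) (fun j hj => by
      rcases hcases j hj with rfl | ⟨k, rfl⟩ | rfl
      · rfl
      · rw [nodeS, nodeS, hgδ k δ (by linarith)]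
      · rw [nodeN, nodeN])
  set W : Set ℂ := {z | 0 < (z + Complex.I).im ∧ (z + Complex.I).im < δ ∧
    |(z + Complex.I).re| < C * (z + Complex.I).im} with hW
  obtain ⟨φ, hφ, hφH⟩ := exists_isotopy_of_plane (Δ := Δ) (W := W)
    (H := fun τ z => H τ (z + Complex.I) - Complex.I) (fun z hz => by
      have := norm_lt_one_of_wedge hd4 hz.1 hz.2.1 hz.2.2
      rw [mem_ball_zero_iff]
      simpa using this) (fun i z hz hzW => by
      have h1 := hmark i z hz
      have h2 := hzW.2.1
      simp at h2
      linarith)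
    ((hHc.comp (continuous_fst.prodMk (continuous_snd.add continuous_const))).sub continuous_const)
    (fun τ => ⟨fun z w hzw => add_right_cancel ((hHb τ).1 (sub_left_injective hzw)), fun w => by
      obtain ⟨z, hz⟩ := (hHb τ).2 (w + Complex.I)
      exact ⟨z - Complex.I, by simp [hz]⟩⟩)
    (by funext z; simp [hH0]) (fun τ z hz => by
      rw [hHout τ _ hz]; ring)
  -- the new arcs
  set w : Fin N → ℝ → ℝ := fun k s => ((a k).germ s).re -
    χ ((a k).germ s).im * (((a k).germ s).re - c k * ((a k).germ s).im) with hw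
  set B : Fin N → ℝ → ℂ := fun k s => (w k s : ℂ) + ((a k).germ s).im * Complex.I - Complex.I with hB
  have hBim : ∀ k s, (B k s + Complex.I).im = ((a k).germ s).im := fun k s => by simp [hB]
  have hBre : ∀ k s, (B k s + Complex.I).re = w k s := fun k s => by simp [hB]
  have hBfar : ∀ k s, δ / 2 ≤ ((a k).germ s).im → B k s = (a k).toFun s := fun k s hs => by
    have h1 : w k s = ((a k).germ s).re := by simp only [hw, hχ0 _ hs]; ring
    simp only [hB, h1]
    rw [Complex.re_add_im]; simp [Arc.germ]
  have hφB : ∀ k, ∀ s : unitInterval, (φ ((a k).pt s) : ℂ) = B k s := by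
    intro k s
    rw [hφH]
    change H 1 ((a k).germ s) - Complex.I = B k s
    by_cases hs : (s : ℝ) ∈ Ioc (0 : ℝ) 1 ∧ ((a k).germ s).im ≤ δ
    · have hpos := (a k).germ_im_pos hs.1
      have hy : ((a k).germ s).im ∈ Ioc 0 δ := ⟨hpos, hs.2⟩
      have hθ : θ k ((a k).germ s).im = s :=
        (h k).inv ⟨s.2.1, hT k s s.2 hs.2⟩ (Ioc_subset_Icc_self hy)
      have h1 := hHnode (k + 1) (by omega) _ hy
      rw [nodeS, nodeS] at h1
      simp only [hg, hf, hθ, Complex.re_add_im] at h1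
      rw [h1]
    · have h1 : H 1 ((a k).germ s) = (a k).germ s := by
        apply hHout
        rintro ⟨h2, h3, -⟩
        refine hs ⟨⟨lt_of_le_of_ne s.2.1 fun h0 => ?_, s.2.2⟩, h3.le⟩
        rw [← h0, (a k).germ_zero] at h2
        exact lt_irrefl _ h2
      rw [h1]
      rcases s.2.1.eq_or_lt with h0 | h0
      · rw [← h0]
        simp [hB, hw, (a k).germ_zero]
      · have : δ < ((a k).germ s).im := not_le.1 fun h' => hs ⟨⟨h0, s.2.2⟩, h'⟩
        rw [hBfar k s (by linarith)]
        simp [Arc.germ]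
  have hwim : ∀ k, ContDiffOn ℝ (⊤ : ℕ∞) (fun s => ((a k).germ s).im) (Icc 0 1) := fun k =>
    Complex.imCLM.contDiff.comp_contDiffOn (a k).germ_smooth
  have hwre : ∀ k, ContDiffOn ℝ (⊤ : ℕ∞) (fun s => ((a k).germ s).re) (Icc 0 1) := fun k =>
    Complex.reCLM.contDiff.comp_contDiffOn (a k).germ_smooth
  have hBs : ∀ k, ContDiffOn ℝ (⊤ : ℕ∞) (B k) (Icc 0 1) := fun k => by
    have h1 : ContDiffOn ℝ (⊤ : ℕ∞) (w k) (Icc 0 1) :=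
      (hwre k).sub ((hχs.comp_contDiffOn (hwim k)).mul
        ((hwre k).sub (contDiffOn_const.mul (hwim k))))
    exact ((Complex.ofRealCLM.contDiff.comp_contDiffOn h1).add
      ((Complex.ofRealCLM.contDiff.comp_contDiffOn (hwim k)).mul contDiffOn_const)).sub
      contDiffOn_const
  have hBd : ∀ k, ∀ s ∈ Icc (0 : ℝ) 1, (derivWithin (B k) (Icc 0 1) s).im =
      (derivWithin (a k).toFun (Icc 0 1) s).im := fun k s hs => by
    have h1 : HasDerivWithinAt (fun s => (B k s).im) (derivWithin (B k) (Icc 0 1) s).im (Icc 0 1) s :=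
      Complex.imCLM.hasFDerivAt.comp_hasDerivWithinAt s
        ((hBs k).differentiableOn (by simp) s hs).hasDerivWithinAt
    have h2 : HasDerivWithinAt (fun s => ((a k).toFun s).im)
        (derivWithin (a k).toFun (Icc 0 1) s).im (Icc 0 1) s :=
      Complex.imCLM.hasFDerivAt.comp_hasDerivWithinAt s ((a k).hasDerivWithinAt hs)
    have h3 : (fun s => (B k s).im) = fun s => ((a k).toFun s).im := funext fun s => by
      have := hBim k s
      simpa [Arc.germ] using this
    rw [h3] at h1
    exact (uniqueDiffOn_Icc zero_lt_one s hs).eq_deriv _ h1 h2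
  -- The isotopy preserves heights. Where the height is at most `δ` the unchanged vertical velocity
  -- is positive; higher up the arc itself is unchanged. Hence the new curve is immersed.
  have hnew : ∀ k, ∃ b : Arc Δ, b.toFun = B k ∧ φ '' (a k).carrier = b.carrier := fun k => by
    refine exists_arc_of_isotopy (a k) hφ (hφB k) (hBs k) (fun s hs h0 => ?_) ?_
    · rcases le_or_gt ((a k).germ s).im δ with h1 | h1
      · have h2 := (h k).deriv_pos s ⟨hs.1, hT k s hs h1⟩
        rw [(a k).derivWithin_germ, ← hBd k s hs, h0] at h2
        simp at h2
      · have hev : B k =ᶠ[nhdsWithin s (Icc 0 1)] (a k).toFun := by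
          have h2 := (Complex.continuous_im.comp_continuousOn (a k).germ_smooth.continuousOn) s hs
          filter_upwards [h2.eventually (lt_mem_nhds h1)] with u hu
          exact hBfar k u (by simp only [Function.comp_apply] at hu; linarith)
        rw [hev.derivWithin_eq_of_mem hs] at h0
        exact (a k).immersion s hs h0
    · rw [hBd k 0 (by simp)]
      exact (a k).tangent_im_pos.ne'
  choose b hb hbφ using hnew
  refine ⟨φ, hφ, b, δ / 4, by positivity, hbφ, fun k => ?_⟩
  have hbim : ∀ s, ((b k).germ s).im = ((a k).germ s).im := fun s => by
    rw [Arc.germ, hb, hBim]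
  have hδ4 : δ / 4 ∈ Ioc 0 δ := ⟨by positivity, by linarith⟩
  have hδ4' := Ioc_subset_Icc_self hδ4
  have hs0 := hθpos k _ hδ4
  have hθlt : θ k (δ / 4) < 1 := by
    have h1 := (h k).lt_of_lt hδ4' (Ioc_subset_Icc_self hδmem) (by linarith)
    exact h1.trans_le (hIcc k ((h k).mem _ (Ioc_subset_Icc_self hδmem))).2
  refine ⟨θ k (δ / 4), ⟨hs0.1, hθlt⟩, ?_, ?_, fun s hs => ?_, fun s hs => ?_⟩
  · simp only [hbim]
    exact (h k).mono.mono (Icc_subset_Icc_right ((h k).mem _ hδ4').2)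
  · rw [hbim, (h k).eq _ hδ4']
  · have hmono := (h k).mono.monotoneOn (show s ∈ Icc 0 (T k) from
      ⟨hs.1, hs.2.trans ((h k).mem _ hδ4').2⟩) ((h k).mem _ hδ4') hs.2
    simp only [(h k).eq _ hδ4'] at hmono
    rw [hbim, Arc.germ, hb, hBre]
    simp only [hw, hχ1 _ hmono]
    ring
  · rw [hbim]
    have hs1 : s ∈ Icc (0 : ℝ) 1 := ⟨hs0.1.le.trans hs.1.le, hs.2⟩
    by_contra hle
    have h1 := hT k s hs1 ((not_lt.1 hle).trans (by linarith))
    have h2 := (h k).mono ((h k).mem _ hδ4') ⟨hs1.1, h1⟩ hs.1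
    simp only [(h k).eq _ hδ4'] at h2
    exact hle h2

end PlantComplex

end

noncomputable section

namespace PlantComplex

variable {t : ℕ} {Δ : MarkedPoints t} {ξ : Fin t → ℕ}

/-! ### Straightening an arc near its end point -/

/-- Near its end point the arc is a segment. -/
def StraightEnd (b : Arc Δ) : Prop :=
  ∃ u : ℂ, u ≠ 0 ∧ ∃ s₁ ∈ Ioo (0 : ℝ) 1,
    StrictMonoOn (fun s => ((b.toFun s - b.toFun 1) / u).re) (Icc s₁ 1) ∧
    ∀ s ∈ Icc s₁ 1, ((b.toFun s - b.toFun 1) / u).im = 0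

theorem exists_ball_marked (Δ : MarkedPoints t) {p : ℂ} (hp : ‖p‖ < 1) {r : ℝ} (hr : 0 < r) :
    ∃ R > 0, R ≤ r ∧ ∀ z, ‖z - p‖ < R → ‖z‖ < 1 ∧ ∀ i, z ∈ Δ.pts i → z = p := by
  have : Finite {z : ℂ // (∃ i, z ∈ Δ.pts i) ∧ z ≠ p} :=
    ((finite_marked Δ).subset fun z hz => hz.1 : {z : ℂ | (∃ i, z ∈ Δ.pts i) ∧ z ≠ p}.Finite)
  obtain ⟨m, hm, hm'⟩ := exists_min_pos
    (f := fun z : {z : ℂ // (∃ i, z ∈ Δ.pts i) ∧ z ≠ p} => ‖z.1 - p‖)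
    fun z => norm_pos_iff.2 (sub_ne_zero.2 z.2.2)
  refine ⟨min m (min r (1 - ‖p‖)), lt_min hm (lt_min hr (sub_pos.2 hp)),
    (min_le_right _ _).trans (min_le_left _ _), fun z hz => ⟨?_, fun i hi => ?_⟩⟩
  · have h1 := hz.trans_le ((min_le_right _ _).trans (min_le_right _ _))
    have h2 := norm_add_le (z - p) p
    rw [sub_add_cancel] at h2
    linarith
  · by_contra hne
    have := hm' ⟨z, ⟨i, hi⟩, hne⟩
    exact (hz.trans_le (min_le_left _ _)).not_ge this

/-- An arc can be straightened near its end point by an isotopy supported near the end point. -/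
theorem exists_straightEnd (a : Arc Δ) {r : ℝ} (hr : 0 < r) :
    ∃ φ ∈ isotopyGroup Δ, ∃ b : Arc Δ, φ '' a.carrier = b.carrier ∧
      (∀ s, φ (a.pt s) = b.pt s) ∧
      (∀ z : Disk, r ≤ ‖(z : ℂ) - a.toFun 1‖ → φ z = z) ∧ StraightEnd b := by
  have h11 : (1 : ℝ) ∈ Icc (0 : ℝ) 1 := by simp
  have h01 : (0 : ℝ) ∈ Icc (0 : ℝ) 1 := by simp
  set p := a.toFun 1 with hp
  set v := derivWithin a.toFun (Icc 0 1) 1 with hv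
  have hv0 : v ≠ 0 := a.immersion 1 h11
  -- In the coordinate `(z - p) / u` the reversed arc leaves the origin with velocity `I`, so the
  -- graph construction at the base point applies to the end point as well.
  set u := Complex.I * v with hu
  have hu0 : u ≠ 0 := mul_ne_zero Complex.I_ne_zero hv0
  set γ : ℝ → ℂ := fun s => (a.toFun (1 - s) - p) / u with hγ
  have hflip : MapsTo (fun s : ℝ => 1 - s) (Icc 0 1) (Icc 0 1) := fun s hs =>
    ⟨by linarith [hs.2], by linarith [hs.1]⟩
  have hflipd : ∀ s : ℝ, HasDerivWithinAt (fun s : ℝ => 1 - s) (-1) (Icc 0 1) s := fun s => by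
    simpa using (hasDerivWithinAt_id s (Icc 0 1)).const_sub 1
  have hγs : ContDiffOn ℝ (⊤ : ℕ∞) γ (Icc 0 1) :=
    ((a.smooth.comp (contDiff_const.sub contDiff_id).contDiffOn hflip).sub
      contDiffOn_const).div_const u
  have hγd : ∀ s ∈ Icc (0 : ℝ) 1, HasDerivWithinAt γ
      ((-1 : ℝ) • derivWithin a.toFun (Icc 0 1) (1 - s) / u) (Icc 0 1) s := fun s hs =>
    (((a.hasDerivWithinAt (hflip hs)).scomp s (hflipd s) hflip).sub_const p).div_const u
  have hud := uniqueDiffOn_Icc (zero_lt_one (α := ℝ))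
  have hγ0 : γ 0 = 0 := by simp [hγ, hp]
  have hγ' : 0 < (derivWithin γ (Icc 0 1) 0).im := by
    rw [(hγd 0 h01).derivWithin (hud 0 h01), sub_zero, ← hv]
    have : (-1 : ℝ) • v / u = Complex.I := by
      rw [hu, div_eq_iff (mul_ne_zero Complex.I_ne_zero hv0), ← mul_assoc, Complex.I_mul_I]
      simp
    rw [this]; simp
  have hγinj : ∀ s ∈ Icc (0 : ℝ) 1, γ s = 0 → s = 0 := fun s hs h => by
    have h1 := (div_eq_zero_iff.1 h).resolve_right hu0
    have h2 := a.injOn (hflip hs) h11 (sub_eq_zero.1 h1)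
    linarith
  have hγa : ∀ s, p + u * γ (1 - s) = a.toFun s := fun s => by
    simp only [hγ, sub_sub_cancel]
    rw [mul_div_cancel₀ _ hu0]; ring
  -- The bound `T ≤ 1/2` keeps the initial half of the arc unchanged, hence also its transversality
  -- at the base point.
  obtain ⟨δ₁, C₁, T, θ, hT, hG₁⟩ := exists_isGraph hγs hγ0 hγ' one_half_pos
  have hT0 := hG₁.T_mem.1
  have hTIcc : Icc 0 T ⊆ Icc (0 : ℝ) 1 := Icc_subset_Icc_right hG₁.T_mem.2
  obtain ⟨m, hm, hmγ⟩ : ∃ m > 0, ∀ s ∈ Icc T 1, m ≤ ‖γ s‖ := by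
    obtain ⟨s₀, hs₀, hmin⟩ := isCompact_Icc.exists_isMinOn ⟨T, le_rfl, hG₁.T_mem.2⟩
      (hγs.continuousOn.mono (Icc_subset_Icc_left hT0.le)).norm
    refine ⟨‖γ s₀‖, norm_pos_iff.2 fun h => ?_, fun s hs => hmin hs⟩
    have := hγinj s₀ ⟨hT0.le.trans hs₀.1, hs₀.2⟩ h
    linarith [hs₀.1]
  obtain ⟨R, hR, hRr, hRm⟩ := exists_ball_marked Δ (p := p) (by
    obtain ⟨i, hi⟩ := a.finish; exact Δ.norm_lt_one i _ hi) hr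
  obtain ⟨C, hCdef⟩ : ∃ C, C = C₁ + 1 := ⟨_, rfl⟩
  have hC₁ := hG₁.C_pos
  have hC0 : 0 < C := by linarith
  have hun : 0 < ‖u‖ := norm_pos_iff.2 hu0
  -- The wedge lies in the ball of radius `(C + 1) δ`. The bound by `m` keeps the part of the arc
  -- beyond parameter `T` out of it; the bound by `R` keeps out other marked points and everything
  -- at distance `r` or more.
  obtain ⟨δ, hδ0, hδ1, hδm, hδR⟩ : ∃ δ > 0, δ ≤ δ₁ ∧ (C + 1) * δ ≤ m ∧ (C + 1) * δ * ‖u‖ ≤ R := by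
    have hδ₁ := hG₁.δ_pos
    refine ⟨min δ₁ (min (m / (C + 1)) (R / ((C + 1) * ‖u‖))), by positivity, min_le_left _ _, ?_, ?_⟩
    · have := (min_le_right δ₁ _).trans (min_le_left (m / (C + 1)) (R / ((C + 1) * ‖u‖)))
      rw [le_div_iff₀ (by linarith)] at this
      linarith
    · have := (min_le_right δ₁ _).trans (min_le_right (m / (C + 1)) (R / ((C + 1) * ‖u‖)))
      rw [le_div_iff₀ (by positivity)] at this
      linarith
  have hG := hG₁.shrink hδ0 hδ1 le_rfl
  set f : ℝ → ℝ := fun y => (γ (θ y)).re with hf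
  have hfb : ∀ y ∈ Icc 0 δ, |f y| ≤ C₁ * y := fun y hy => by
    have := hG.bound _ (hG.mem y hy)
    rwa [hG.eq y hy] at this
  have hfc : ContinuousOn f (Icc 0 δ) :=
    Complex.continuous_re.comp_continuousOn (hγs.continuousOn.comp hG.cont
      fun y hy => hTIcc (hG.mem y hy))
  have hδh : δ / 2 ∈ Icc 0 δ := ⟨by positivity, by linarith⟩
  have hδδ : δ ∈ Icc 0 δ := ⟨hδ0.le, le_rfl⟩
  set c := θ (δ / 2) with hc
  have hc0 : 0 < c := lt_of_le_of_ne (hG.mem _ hδh).1 fun h => by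
    have h1 := hG.eq _ hδh
    rw [← hc, ← h, hγ0] at h1
    simp at h1; linarith
  have hcδ : c < θ δ := hG.lt_of_lt hδh hδδ (by linarith)
  have hcT : c < T := hcδ.trans_le (hG.mem _ hδδ).2
  -- the cut-off function
  set χ : ℝ → ℝ := fun s => Real.smoothTransition ((c - s) / (c / 2)) with hχ
  have hχs : ContDiff ℝ (⊤ : ℕ∞) χ := by
    refine Real.smoothTransition.contDiff.comp ?_
    exact (contDiff_const.sub contDiff_id).div_const _
  have hχ1 : ∀ s, s ≤ c / 2 → χ s = 1 := fun s hs => Real.smoothTransition.one_of_one_le (by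
    rw [one_le_div (by positivity)]; linarith)
  have hχ0 : ∀ s, c ≤ s → χ s = 0 := fun s hs => Real.smoothTransition.zero_of_nonpos
    (div_nonpos_of_nonpos_of_nonneg (by linarith) (by positivity))
  have hχm : ∀ s, 0 ≤ χ s ∧ χ s ≤ 1 := fun s =>
    ⟨Real.smoothTransition.nonneg _, Real.smoothTransition.le_one _⟩
  -- The cut-off is by parameter, not by height. For parameters at most `c / 2` the new graph is the
  -- vertical axis, a segment in the direction of `v`.
  set g : ℝ → ℝ := fun y => (1 - χ (θ y)) * f y with hg
  have hgc : ContinuousOn g (Icc 0 δ) :=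
    (continuousOn_const.sub (hχs.continuous.comp_continuousOn hG.cont)).mul hfc
  have hgb : ∀ y ∈ Ioc 0 δ, |f y| < C * y ∧ |g y| < C * y := fun y hy => by
    have h1 := hfb y (Ioc_subset_Icc_self hy)
    have h2 : |f y| < C * y := by rw [hCdef, add_mul]; linarith [hy.1]
    refine ⟨h2, lt_of_le_of_lt ?_ h2⟩
    have h3 := hχm (θ y)
    simp only [hg]
    rw [abs_mul, abs_of_nonneg (sub_nonneg.2 h3.2)]
    exact mul_le_of_le_one_left (abs_nonneg _) (by linarith)
  let node : (ℝ → ℝ) → ℕ → ℝ → ℝ := fun f j y =>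
    if j = 0 then -(C * y) else if j = 1 then f y else C * y
  have hnodec : ∀ f : ℝ → ℝ, ContinuousOn f (Icc 0 δ) →
      ∀ j ≤ 2, ContinuousOn (node f j) (Ioc 0 δ) := by
    intro f hf j hj
    have hlin : ContinuousOn (fun y : ℝ => C * y) (Ioc 0 δ) := by fun_prop
    interval_cases j
    · exact hlin.neg
    · exact hf.mono Ioc_subset_Icc_self
    · exact hlin
  have hnodem : ∀ f : ℝ → ℝ, (∀ y ∈ Ioc 0 δ, |f y| < C * y) →
      ∀ y ∈ Ioc 0 δ, ∀ j < 2, node f j y < node f (j + 1) y := by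
    intro f hb y hy j hj
    have := abs_lt.1 (hb y hy)
    interval_cases j
    · exact this.1
    · exact this.2
  obtain ⟨H, hHc, hHb, hH0, hHout, hHnode⟩ := exists_wedge_isotopy 2 hδ0 hC0 (node f) (node g)
    (hnodec f hfc) (hnodec g hgc) (hnodem f fun y hy => (hgb y hy).1)
    (hnodem g fun y hy => (hgb y hy).2) (fun _ _ => rfl) (fun _ _ => rfl)
    (fun _ _ => rfl) (fun _ _ => rfl) (fun j hj => by
      interval_cases j
      · rfl
      · change f δ = g δ
        simp only [hg, hχ0 _ hcδ.le]; ring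
      · rfl)
  set W : Set ℂ := {z | 0 < ((z - p) / u).im ∧ ((z - p) / u).im < δ ∧
    |((z - p) / u).re| < C * ((z - p) / u).im} with hW
  have hWn : ∀ w : ℂ, 0 < w.im → w.im < δ → |w.re| < C * w.im → ‖w‖ < (C + 1) * δ := by
    intro w h1 h2 h3
    have h4 := Complex.norm_le_abs_re_add_abs_im w
    rw [abs_of_pos h1] at h4
    nlinarith
  have hWball : ∀ z ∈ W, ‖z - p‖ < R := fun z hz => by
    have h1 := hWn _ hz.1 hz.2.1 hz.2.2
    rw [norm_div, div_lt_iff₀ hun] at h1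
    exact h1.trans_le hδR
  obtain ⟨φ, hφ, hφH⟩ := exists_isotopy_of_plane (Δ := Δ) (W := W)
    (H := fun τ z => p + u * H τ ((z - p) / u))
    (fun z hz => mem_ball_zero_iff.2 (hRm z (hWball z hz)).1) (fun i z hz hzW => by
      have h1 := (hRm z (hWball z hzW)).2 i hz
      have h2 := hzW.1
      rw [h1] at h2
      simp at h2)
    (continuous_const.add (continuous_const.mul (hHc.comp (continuous_fst.prodMk
      ((continuous_snd.sub continuous_const).div_const u)))))
    (fun τ => ⟨fun z w hzw => by
      have h1 := (hHb τ).1 (mul_left_cancel₀ hu0 (add_left_cancel hzw))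
      exact sub_left_injective ((div_left_inj' hu0).1 h1), fun w => by
      obtain ⟨z, hz⟩ := (hHb τ).2 ((w - p) / u)
      refine ⟨p + u * z, ?_⟩
      simp only [add_sub_cancel_left, mul_div_cancel_left₀ _ hu0, hz]
      rw [mul_div_cancel₀ _ hu0]; ring⟩)
    (by
      funext z
      simp only [hH0, id_eq]
      rw [mul_div_cancel₀ _ hu0]; ring)
    (fun τ z hz => by
      rw [hHout τ _ hz, mul_div_cancel₀ _ hu0]; ring)
  -- the new arc
  set B : ℝ → ℂ := fun s => γ s - ((χ s * (γ s).re : ℝ) : ℂ) with hB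
  have hBim : ∀ s, (B s).im = (γ s).im := fun s => by simp [hB]
  have hBre : ∀ s, (B s).re = (1 - χ s) * (γ s).re := fun s => by simp [hB]; ring
  have hBfar : ∀ s, c ≤ s → B s = γ s := fun s hs => by simp [hB, hχ0 s hs]
  have hHB : ∀ s ∈ Icc (0 : ℝ) 1, H 1 (γ s) = B s := by
    intro s hs
    rcases hs.1.eq_or_lt with h0 | h0
    · rw [← h0, hγ0, hHout 1 0 (by simp)]
      simp [hB, hγ0]
    rcases le_or_gt s T with hsT | hsT
    · have hsT' : s ∈ Icc 0 T := ⟨h0.le, hsT⟩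
      have hpos : 0 < (γ s).im := by
        have := hG.mono ⟨le_rfl, hT0.le⟩ hsT' h0
        simpa [hγ0] using this
      rcases le_or_gt (γ s).im δ with hle | hlt
      · have hθ := hG.inv hsT' ⟨hpos.le, hle⟩
        have h1 := hHnode 1 one_le_two _ ⟨hpos, hle⟩
        change H 1 ((f (γ s).im : ℂ) + _) = (g (γ s).im : ℂ) + _ at h1
        simp only [hg, hf, hθ, Complex.re_add_im] at h1
        rw [h1]
        apply Complex.ext
        · rw [hBre]; simp
        · rw [hBim]; simp
      · rw [hHout 1 _ fun h => hlt.not_gt h.2.1, hBfar]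
        by_contra hle
        have h1 := hG.mono.monotoneOn hsT' (hG.mem _ hδδ) ((not_le.1 hle).le.trans hcδ.le)
        simp only [hG.eq _ hδδ] at h1
        exact h1.not_gt hlt
    · rw [hHout 1 _ fun h => ?_, hBfar s (hcT.trans hsT).le]
      exact (hWn _ h.1 h.2.1 h.2.2).not_ge (hδm.trans (hmγ s ⟨hsT.le, hs.2⟩))
  have hBs : ContDiffOn ℝ (⊤ : ℕ∞) B (Icc 0 1) :=
    hγs.sub (Complex.ofRealCLM.contDiff.comp_contDiffOn (hχs.contDiffOn.mul
      (Complex.reCLM.contDiff.comp_contDiffOn hγs)))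
  -- Up to parameter `T` the vertical velocity is unchanged and positive; from `c < T` on the curve
  -- is unchanged.
  have hBd : ∀ s ∈ Icc (0 : ℝ) 1, derivWithin B (Icc 0 1) s ≠ 0 := by
    intro s hs h0
    have hBder := (hBs.differentiableOn (by simp) s hs).hasDerivWithinAt
    rcases le_or_gt s T with h1 | h1
    · have e1 : HasDerivWithinAt (fun s => (B s).im) (derivWithin B (Icc 0 1) s).im (Icc 0 1) s :=
        Complex.imCLM.hasFDerivAt.comp_hasDerivWithinAt s hBder
      have e2 : HasDerivWithinAt (fun s => (γ s).im) (derivWithin γ (Icc 0 1) s).im (Icc 0 1) s :=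
        Complex.imCLM.hasFDerivAt.comp_hasDerivWithinAt s
          (hγs.differentiableOn (by simp) s hs).hasDerivWithinAt
      rw [funext hBim] at e1
      have e3 := (hud s hs).eq_deriv _ e1 e2
      have e4 := hG.deriv_pos s ⟨hs.1, h1⟩
      rw [← e3, h0] at e4
      simp at e4
    · have hev : B =ᶠ[nhdsWithin s (Icc 0 1)] γ := by
        filter_upwards [mem_nhdsWithin_of_mem_nhds (lt_mem_nhds (hcT.trans h1))] with x hx
        exact hBfar x (le_of_lt hx)
      rw [hev.derivWithin_eq_of_mem hs, (hγd s hs).derivWithin (hud s hs)] at h0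
      have h2 := (div_eq_zero_iff.1 h0).resolve_right hu0
      exact a.immersion _ (hflip hs) ((smul_eq_zero.1 h2).resolve_left (by norm_num))
  set b : ℝ → ℂ := fun s => p + u * B (1 - s) with hb
  have hbs : ContDiffOn ℝ (⊤ : ℕ∞) b (Icc 0 1) :=
    contDiffOn_const.add (contDiffOn_const.mul
      (hBs.comp (contDiff_const.sub contDiff_id).contDiffOn hflip))
  have hbd : ∀ s ∈ Icc (0 : ℝ) 1, HasDerivWithinAt b
      (u * ((-1 : ℝ) • derivWithin B (Icc 0 1) (1 - s))) (Icc 0 1) s := fun s hs =>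
    (((hBs.differentiableOn (by simp) _ (hflip hs)).hasDerivWithinAt.scomp s (hflipd s)
      hflip).const_mul u).const_add p
  have hφb : ∀ s : unitInterval, (φ (a.pt s) : ℂ) = b s := fun s => by
    rw [hφH]
    change p + u * H 1 ((a.toFun s - p) / u) = p + u * B (1 - s)
    rw [← hHB _ (hflip s.2)]
    simp only [hγ, sub_sub_cancel]
  have hba : b =ᶠ[nhdsWithin 0 (Icc 0 1)] a.toFun := by
    filter_upwards [mem_nhdsWithin_of_mem_nhds (gt_mem_nhds (show (0 : ℝ) < 1 / 2 by norm_num))]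
      with s hs
    have hs : s < 1 / 2 := hs
    simp only [hb]
    rw [hBfar _ (by linarith), hγa]
  obtain ⟨a', ha', hφa'⟩ := exists_arc_of_isotopy a hφ hφb hbs (fun s hs => by
      rw [(hbd s hs).derivWithin (hud s hs)]
      exact mul_ne_zero hu0 (smul_ne_zero (by norm_num) (hBd _ (hflip hs))))
    (by rw [hba.derivWithin_eq_of_mem h01]; exact a.transverse)
  refine ⟨φ, hφ, a', hφa', fun s => Subtype.ext ((hφb s).trans (by rw [← ha']; rfl)),
    fun z hz => Subtype.ext ?_, v, hv0, 1 - c / 2, ⟨by linarith [hG₁.T_mem.2], by linarith⟩, ?_⟩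
  · rw [hφH]
    rw [hHout 1 _ fun h => ?_, mul_div_cancel₀ _ hu0]
    · ring
    · exact ((hWball z h).trans_le hRr).not_ge hz
  have hB0 : B 0 = 0 := by simp [hB, hγ0]
  have hquot : ∀ s ∈ Icc (1 - c / 2) 1, (a'.toFun s - a'.toFun 1) / v = ((-(γ (1 - s)).im : ℝ) : ℂ) := by
    intro s hs
    rw [ha']
    simp only [hb, sub_self, hB0, mul_zero, add_zero, add_sub_cancel_left]
    have h1 : B (1 - s) = (γ (1 - s)).im * Complex.I := by
      apply Complex.ext
      · rw [hBre, hχ1 _ (by linarith [hs.1])]; simp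
      · rw [hBim]; simp
    rw [h1, hu, div_eq_iff hv0]
    push_cast
    linear_combination (γ (1 - s)).im * v * Complex.I_mul_I
  refine ⟨fun s hs s' hs' hlt => ?_, fun s hs => by rw [hquot s hs]; simp⟩
  simp only [hquot s hs, hquot s' hs', Complex.ofReal_re, neg_lt_neg_iff]
  exact hG.mono ⟨by linarith [hs'.2], by linarith [hs'.1]⟩ ⟨by linarith [hs.2], by linarith [hs.1]⟩
    (by linarith)

theorem StraightStart.im_le {b : Arc Δ} {δ : ℝ} {s₀ : ℝ} (hs₀ : s₀ ∈ Ioo (0 : ℝ) 1)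
    (hm : StrictMonoOn (fun s => (b.germ s).im) (Icc 0 s₀)) (he : (b.germ s₀).im = δ) :
    ∀ s ∈ Icc 0 s₀, (b.germ s).im ≤ δ := fun s hs => by
  rw [← he]
  exact hm.monotoneOn hs ⟨hs₀.1.le, le_rfl⟩ hs.2

theorem StraightStart.congr {b b' : Arc Δ} {c δ : ℝ} (h : StraightStart b c δ)
    (hbb' : ∀ s ∈ Icc (0 : ℝ) 1, b'.toFun s = b.toFun s ∨
      (δ < (b.germ s).im ∧ δ < (b'.germ s).im)) : StraightStart b' c δ := by
  obtain ⟨s₀, hs₀, hm, he, hl, hg⟩ := h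
  have hle := StraightStart.im_le hs₀ hm he
  have heq : ∀ s ∈ Icc 0 s₀, b'.germ s = b.germ s := fun s hs => by
    rcases hbb' s ⟨hs.1, hs.2.trans hs₀.2.le⟩ with h | h
    · rw [Arc.germ, h, Arc.germ]
    · exact absurd h.1 (hle s hs).not_gt
  refine ⟨s₀, hs₀, fun s hs s' hs' hlt => ?_, ?_, fun s hs => ?_, fun s hs => ?_⟩
  · simp only [heq s hs, heq s' hs']
    exact hm hs hs' hlt
  · rw [heq s₀ ⟨hs₀.1.le, le_rfl⟩, he]
  · rw [heq s hs, hl s hs]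
  · rcases hbb' s ⟨hs₀.1.le.trans hs.1.le, hs.2⟩ with h | h
    · rw [Arc.germ, h]; exact hg s hs
    · exact h.2

/-- The end points of disjoint arcs with straight starts can be straightened. -/
theorem exists_straightEnds {ι : Type*} [Finite ι] {a : ι → Arc Δ} {c : ι → ℝ} {δ : ℝ}
    (hd : ∀ k l, k ≠ l → (a k).carrier ∩ (a l).carrier = {base})
    (h : ∀ k, StraightStart (a k) (c k) δ) : ∃ φ ∈ isotopyGroup Δ, ∃ b : ι → Arc Δ,
      (∀ k, φ '' (a k).carrier = (b k).carrier) ∧ (∀ k, StraightStart (b k) (c k) δ) ∧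
      ∀ k, StraightEnd (b k) := by
  classical
  have := Fintype.ofFinite ι
  suffices ∀ S : Finset ι, ∃ φ ∈ isotopyGroup Δ, ∃ b : ι → Arc Δ,
      (∀ k, φ '' (a k).carrier = (b k).carrier) ∧ (∀ k, StraightStart (b k) (c k) δ) ∧
      ∀ k ∈ S, StraightEnd (b k) by
    obtain ⟨φ, hφ, b, h1, h2, h3⟩ := this Finset.univ
    exact ⟨φ, hφ, b, h1, h2, fun k => h3 k (Finset.mem_univ k)⟩
  intro S
  induction S using Finset.induction_on with
  | empty => exact ⟨1, one_mem _, a, fun k => image_id _, h, fun k hk => by simp at hk⟩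
  | insert k S hk ih =>
    obtain ⟨φ, hφ, b, h1, h2, h3⟩ := ih
    have hdb : ∀ k l, k ≠ l → (b k).carrier ∩ (b l).carrier = {base} := fun k l hkl => by
      rw [← h1, ← h1, ← image_inter φ.injective, hd k l hkl, image_singleton, isotopy_base hφ]
    have hclosed : IsClosed (⋃ l ∈ {l | l ≠ k}, (b l).carrier) :=
      (Set.toFinite _).isClosed_biUnion fun l _ => (b l).isClosed_carrier
    have htip : (b k).tip ∉ ⋃ l ∈ {l | l ≠ k}, (b l).carrier := fun hmem => by
      obtain ⟨l, hl, hl'⟩ := mem_iUnion₂.1 hmem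
      have h4 : (b k).tip ∈ (b k).carrier ∩ (b l).carrier := ⟨(b k).tip_mem, hl'⟩
      rw [hdb k l (Ne.symm hl)] at h4
      exact (b k).tip_ne_base h4
    obtain ⟨r₁, hr₁, hr₁'⟩ := Metric.isOpen_iff.1 hclosed.isOpen_compl _ htip
    have htipδ : δ < ((b k).germ 1).im := by
      obtain ⟨s₀, hs₀, -, -, -, hg⟩ := h2 k
      exact hg 1 ⟨hs₀.2, le_rfl⟩
    -- The support near the tip must miss the other arcs and stay above height `δ`, so that the
    -- straight starts survive.
    set r := min r₁ (((b k).germ 1).im - δ) with hr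
    have hr0 : 0 < r := lt_min hr₁ (sub_pos.2 htipδ)
    obtain ⟨ψ, hψ, b', e1, e2, e3, e4⟩ := exists_straightEnd (b k) hr0
    have hfix : ∀ l, l ≠ k → ψ '' (b l).carrier = (b l).carrier := fun l hl => by
      refine (image_congr fun z hz => e3 z ?_).trans (image_id _)
      by_contra hlt
      refine hr₁' (show z ∈ Metric.ball (b k).tip r₁ from ?_) (mem_biUnion (show l ∈ {l | l ≠ k} from hl) hz)
      rw [Metric.mem_ball, Subtype.dist_eq, dist_eq_norm]
      exact (not_le.1 hlt).trans_le (min_le_left _ _)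
    have hin : ∀ z : Disk, ‖(z : ℂ) - (b k).toFun 1‖ < r → δ < ((z : ℂ) + Complex.I).im := by
      intro z hz
      have h4 := (Complex.abs_im_le_norm ((z : ℂ) - (b k).toFun 1)).trans_lt
        (hz.trans_le (min_le_right _ _))
      have h5 := (abs_lt.1 h4).1
      simp only [Arc.germ, Complex.add_im, Complex.I_im, Complex.sub_im] at h5 ⊢
      linarith
    refine ⟨ψ * φ, mul_mem hψ hφ, Function.update b k b', fun l => ?_, fun l => ?_, fun l hl => ?_⟩
    · have h5 : ⇑(ψ * φ) '' (a l).carrier = ψ '' (b l).carrier := by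
        rw [← h1, ← image_comp]; rfl
      rw [h5]
      by_cases hlk : l = k
      · subst hlk; rw [Function.update_self, e1]
      · rw [Function.update_of_ne hlk, hfix l hlk]
    · by_cases hlk : l = k
      · subst hlk
        rw [Function.update_self]
        refine (h2 l).congr fun s hs => ?_
        have h6 := e2 ⟨s, hs⟩
        by_cases hfar : r ≤ ‖(b l).toFun s - (b l).toFun 1‖
        · left
          rw [e3 _ hfar] at h6
          exact (congrArg Subtype.val h6).symm
        · right
          refine ⟨hin ((b l).pt ⟨s, hs⟩) (not_le.1 hfar), hin (b'.pt ⟨s, hs⟩) ?_⟩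
          by_contra hle
          have h7 := e3 _ (not_lt.1 hle)
          rw [← h6] at h7
          have h8 := ψ.injective h7
          rw [← h6, h8] at hle
          exact hle (not_le.1 hfar)
      · rw [Function.update_of_ne hlk]; exact h2 l
    · by_cases hlk : l = k
      · subst hlk; rw [Function.update_self]; exact e4
      · rw [Function.update_of_ne hlk]
        exact h3 l ((Finset.mem_insert.1 hl).resolve_left hlk)

end PlantComplex

end

noncomputable section

namespace PlantComplex

variable {t : ℕ} {Δ : MarkedPoints t} {ξ : Fin t → ℕ}

/-! ### Diffeomorphisms of the plane with prescribed support -/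

/-- The diffeomorphisms of the plane which are the identity outside `U`. -/
def diffGroup (U : Set ℂ) : Subgroup (Equiv.Perm ℂ) where
  carrier := {φ | ContDiff ℝ (⊤ : ℕ∞) φ ∧ ContDiff ℝ (⊤ : ℕ∞) φ.symm ∧ ∀ z, z ∉ U → φ z = z}
  one_mem' := ⟨contDiff_id, contDiff_id, fun _ _ => rfl⟩
  mul_mem' := by
    rintro φ ψ ⟨a1, a2, a3⟩ ⟨b1, b2, b3⟩
    refine ⟨a1.comp b1, b2.comp a2, fun z hz => ?_⟩
    rw [Equiv.Perm.mul_apply, b3 z hz, a3 z hz]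
  inv_mem' := by
    rintro φ ⟨a1, a2, a3⟩
    refine ⟨a2, a1, fun z hz => ?_⟩
    rw [Equiv.Perm.inv_eq_iff_eq, a3 z hz]

theorem diffGroup_mono {U V : Set ℂ} (h : U ⊆ V) : diffGroup U ≤ diffGroup V :=
  fun _ hφ => ⟨hφ.1, hφ.2.1, fun z hz => hφ.2.2 z fun hz' => hz (h hz')⟩

theorem diffGroup_mem_iff {U : Set ℂ} {φ : Equiv.Perm ℂ} (hφ : φ ∈ diffGroup U) (z : ℂ) :
    φ z ∈ U ↔ z ∈ U := by
  constructor
  · intro h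
    by_contra hz
    rw [hφ.2.2 z hz] at h
    exact hz h
  · intro h
    by_contra hz
    have := φ.injective (hφ.2.2 _ hz)
    rw [this] at hz
    exact hz h

/-- Pushing the plane along the vector field `ρ w`. -/
theorem exists_push (z₀ : ℂ) {r : ℝ} (hr : 0 < r) : ∃ ε > 0, ∃ ρ : ℂ → ℝ, ρ z₀ = 1 ∧
    (∀ z, z ∉ Metric.closedBall z₀ (r / 2) → ρ z = 0) ∧
    ∀ w : ℂ, ‖w‖ < ε → (∀ z z', |ρ z - ρ z'| * ‖w‖ ≤ ‖z - z'‖ / 2) ∧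
      ∃ φ ∈ diffGroup (Metric.ball z₀ r), ∀ z, φ z = z + ρ z • w := by
  let β : ContDiffBump z₀ := ⟨r / 4, r / 2, by positivity, by linarith⟩
  have hβs : ContDiff ℝ (⊤ : ℕ∞) (β : ℂ → ℝ) := β.contDiff
  obtain ⟨L, hL⟩ := hβs.lipschitzWith_of_hasCompactSupport β.hasCompactSupport (by simp)
  have hβ0 : ∀ z, z ∉ Metric.closedBall z₀ (r / 2) → β z = 0 := fun z hz =>
    β.zero_of_le_dist (not_le.1 hz).le
  -- For such `w` the displacement `β • w` has Lipschitz constant at most `1/2`. So `z + β z • w` is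
  -- a homeomorphism of the plane, and its derivatives are invertible by the Neumann series.
  have hLw : ∀ w : ℂ, ‖w‖ < 1 / (2 * (L + 1)) → (L : ℝ) * ‖w‖ ≤ 1 / 2 := fun w hw => by
    rw [lt_div_iff₀ (by positivity)] at hw
    nlinarith [norm_nonneg w, L.2]
  refine ⟨1 / (2 * (L + 1)), by positivity, β, β.one_of_mem_closedBall (Metric.mem_closedBall_self β.rIn_pos.le), hβ0,
    fun w hw => ⟨fun z z' => ?_, ?_⟩⟩
  · have h1 := hL.dist_le_mul z z'
    rw [Real.dist_eq, dist_eq_norm] at h1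
    have h2 := mul_le_mul_of_nonneg_right h1 (norm_nonneg w)
    nlinarith [hLw w hw, norm_nonneg (z - z')]
  · set f : ℂ → ℂ := fun z => z + β z • w with hf
    have hfs : ContDiff ℝ (⊤ : ℕ∞) f := contDiff_id.add (hβs.smul contDiff_const)
    have happ : ApproximatesLinearOn f ((ContinuousLinearEquiv.refl ℝ ℂ : ℂ ≃L[ℝ] ℂ) : ℂ →L[ℝ] ℂ)
        univ (1 / 2) := by
      intro z _ z' _
      have h1 := hL.dist_le_mul z z'
      rw [Real.dist_eq, dist_eq_norm] at h1
      have h2 : f z - f z' - ((ContinuousLinearEquiv.refl ℝ ℂ : ℂ ≃L[ℝ] ℂ) : ℂ →L[ℝ] ℂ) (z - z') =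
          (β z - β z') • w := by
        simp [hf, sub_mul]; ring
      rw [h2, norm_smul, Real.norm_eq_abs]
      have h3 := mul_le_mul_of_nonneg_right h1 (norm_nonneg w)
      have h4 := hLw w hw
      push_cast
      nlinarith [norm_nonneg (z - z')]
    have hc : Subsingleton ℂ ∨ (1 / 2 : NNReal) <
        ‖((ContinuousLinearEquiv.refl ℝ ℂ).symm : ℂ →L[ℝ] ℂ)‖₊⁻¹ := by
      right
      have : ‖((ContinuousLinearEquiv.refl ℝ ℂ).symm : ℂ →L[ℝ] ℂ)‖₊ = 1 := by
        apply NNReal.eq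
        exact ContinuousLinearMap.norm_id
      rw [this, inv_one]
      exact NNReal.half_lt_self one_ne_zero
    let Φ := happ.toHomeomorph f hc
    have hΦ : ∀ z, Φ z = f z := fun z => rfl
    have hder : ∀ z, ∃ A : ℂ ≃L[ℝ] ℂ, HasFDerivAt Φ (A : ℂ →L[ℝ] ℂ) z := by
      intro z
      set B : ℂ →L[ℝ] ℂ := (fderiv ℝ (β : ℂ → ℝ) z).smulRight w with hB
      have h1 : HasFDerivAt Φ (ContinuousLinearMap.id ℝ ℂ + B) z :=
        (hasFDerivAt_id z).add ((hβs.differentiable (by simp) z).hasFDerivAt.smul_const w)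
      have h2 : ‖-B‖ < 1 := by
        rw [norm_neg, hB, ContinuousLinearMap.norm_smulRight_apply]
        have h3 := norm_fderiv_le_of_lipschitz ℝ (x₀ := z) hL
        have h4 := mul_le_mul_of_nonneg_right h3 (norm_nonneg w)
        linarith [hLw w hw]
      refine ⟨ContinuousLinearEquiv.unitsEquiv ℝ ℂ (Units.oneSub (-B) h2), ?_⟩
      convert h1 using 1
      ext x; simp
    choose A hA using hder
    refine ⟨Φ.toEquiv, ⟨hfs, Φ.contDiff_symm hA hfs, fun z hz => ?_⟩, fun z => rfl⟩
    change z + β z • w = z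
    rw [hβ0 z fun h => hz (lt_of_le_of_lt (Metric.mem_closedBall.1 h) (by linarith)), zero_smul,
      add_zero]

/-- Conjugation of a diffeomorphism with a chart. -/
theorem exists_transport (e : OpenPartialHomeomorph ℂ ℂ) (he : ContDiffOn ℝ (⊤ : ℕ∞) e e.source)
    (he' : ContDiffOn ℝ (⊤ : ℕ∞) e.symm e.target) {z₀ : ℂ} {r r' : ℝ} (hr : r' < r)
    (hs : Metric.ball z₀ r ⊆ e.source) {h : Equiv.Perm ℂ} (hh : h ∈ diffGroup (Metric.ball z₀ r))
    (hsupp : ∀ z, z ∉ Metric.closedBall z₀ r' → h z = z) :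
    ∃ g ∈ diffGroup (e '' Metric.ball z₀ r), ∀ z ∈ Metric.ball z₀ r, g (e z) = e (h z) := by
  classical
  have hcl : Metric.closedBall z₀ r' ⊆ Metric.ball z₀ r := Metric.closedBall_subset_ball hr
  set E := e '' Metric.ball z₀ r with hE
  have hEo : IsOpen E := e.isOpen_image_of_subset_source Metric.isOpen_ball hs
  have hEt : E ⊆ e.target := by
    rintro _ ⟨z, hz, rfl⟩; exact e.map_source (hs hz)
  -- The support of the conjugate lies in this compact set, so extending by the identity outside `E`
  -- is smooth.
  have hKc : IsClosed (e '' Metric.closedBall z₀ r') :=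
    ((isCompact_closedBall z₀ r').image_of_continuousOn
      (e.continuousOn.mono (hcl.trans hs))).isClosed
  let G : Equiv.Perm ℂ → ℂ → ℂ := fun h z => if z ∈ E then e (h (e.symm z)) else z
  have hGe : ∀ h : Equiv.Perm ℂ, ∀ z ∈ Metric.ball z₀ r, G h (e z) = e (h z) := fun h z hz => by
    simp only [G, e.left_inv (hs hz)]
    exact if_pos (mem_image_of_mem e hz)
  have hGout : ∀ h : Equiv.Perm ℂ, ∀ z, z ∉ E → G h z = z := fun h z hz => if_neg hz
  have hGs : ∀ h ∈ diffGroup (Metric.ball z₀ r), (∀ z, z ∉ Metric.closedBall z₀ r' → h z = z) →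
      ContDiff ℝ (⊤ : ℕ∞) (G h) := by
    intro h hh hsupp
    rw [contDiff_iff_contDiffAt]
    intro z
    by_cases hz : z ∈ E
    · have h1 : ContDiffOn ℝ (⊤ : ℕ∞) (fun z => e (h (e.symm z))) E := by
        refine he.comp (hh.1.comp_contDiffOn (he'.mono hEt)) ?_
        rintro _ ⟨w, hw, rfl⟩
        simp only [e.left_inv (hs hw)]
        exact hs ((diffGroup_mem_iff hh w).2 hw)
      refine (h1.contDiffAt (hEo.mem_nhds hz)).congr_of_eventuallyEq ?_
      filter_upwards [hEo.mem_nhds hz] with w hw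
      exact if_pos hw
    · refine contDiffAt_id.congr_of_eventuallyEq ?_
      filter_upwards [hKc.isOpen_compl.mem_nhds fun hK => hz (image_mono hcl hK)] with w hw
      by_cases hwE : w ∈ E
      · obtain ⟨x, hx, rfl⟩ := hwE
        rw [hGe h x hx, hsupp x fun h => hw (mem_image_of_mem e h)]; rfl
      · exact hGout h w hwE
  have hinv : ∀ h ∈ diffGroup (Metric.ball z₀ r), ∀ z, G h⁻¹ (G h z) = z := by
    intro h hh z
    by_cases hz : z ∈ E
    · obtain ⟨x, hx, rfl⟩ := hz
      rw [hGe h x hx, hGe _ _ ((diffGroup_mem_iff hh x).2 hx)]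
      exact congrArg e (h.symm_apply_apply x)
    · rw [hGout h z hz, hGout _ z hz]
  have hsupp' : ∀ z, z ∉ Metric.closedBall z₀ r' → h⁻¹ z = z := fun z hz => by
    rw [Equiv.Perm.inv_eq_iff_eq, hsupp z hz]
  refine ⟨⟨G h, G h⁻¹, hinv h hh, fun z => ?_⟩, ⟨hGs h hh hsupp, hGs h⁻¹ (inv_mem hh) hsupp',
    hGout h⟩, hGe h⟩
  simpa using hinv h⁻¹ (inv_mem hh) z

/-! ### Moving points -/

/-- Being related by such a diffeomorphism is an equivalence relation, and a small push shows that
its classes are open; a connected set is a single class. -/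
theorem exists_move {U : Set ℂ} (hU : IsOpen U) (hc : IsPreconnected U) {x y : ℂ} (hx : x ∈ U)
    (hy : y ∈ U) : ∃ g ∈ diffGroup U, g x = y := by
  refine hc.induction₂ (fun x y => ∃ g ∈ diffGroup U, g x = y) (fun x hx => ?_) ?_ ?_ hx hy
  · obtain ⟨r, hr, hrU⟩ := Metric.isOpen_iff.1 hU x hx
    obtain ⟨ε, hε, ρ, hρ, -, h⟩ := exists_push x hr
    filter_upwards [mem_nhdsWithin_of_mem_nhds (Metric.ball_mem_nhds x hε)] with y hy
    obtain ⟨-, g, hg, hg'⟩ := h (y - x) (by rwa [Metric.mem_ball, dist_eq_norm] at hy)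
    exact ⟨g, diffGroup_mono hrU hg, by rw [hg', hρ, one_smul]; ring⟩
  · rintro x y z - - - ⟨g, hg, rfl⟩ ⟨g', hg', rfl⟩
    exact ⟨g' * g, mul_mem hg' hg, rfl⟩
  · rintro x y - - ⟨g, hg, rfl⟩
    exact ⟨g⁻¹, inv_mem hg, by simp⟩

/-- The ball is homeomorphic to the plane, where the complement of a countable set is connected. -/
theorem isPreconnected_ball_diff {r : ℝ} (hr : 0 < r) {F : Set ℂ} (hF : F.Finite) :
    IsPreconnected (Metric.ball (0 : ℂ) r \ F) := by
  set e := OpenPartialHomeomorph.univBall (0 : ℂ) r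
  have hinj : Function.Injective e := injOn_univ.1 (by
    have := e.injOn
    rwa [OpenPartialHomeomorph.univBall_source] at this)
  have himg : e '' (e ⁻¹' F)ᶜ = Metric.ball 0 r \ F := by
    have h1 : e '' univ = Metric.ball 0 r := by
      rw [← OpenPartialHomeomorph.univBall_target (0 : ℂ) hr, ← e.image_source_eq_target,
        OpenPartialHomeomorph.univBall_source]
    rw [← preimage_compl, image_preimage_eq_inter_range, ← image_univ, h1, inter_comm]
    rfl
  rw [← himg]
  refine IsPreconnected.image ?_ _ (OpenPartialHomeomorph.continuous_univBall (0 : ℂ) r).continuousOn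
  refine (Set.Countable.isConnected_compl_of_one_lt_rank ?_
    (hF.preimage hinj.injOn).countable).isPreconnected
  rw [Complex.rank_real_complex]
  exact Cardinal.one_lt_two

/-- Diffeomorphisms act transitively on tuples of distinct points of a disk. -/
theorem exists_move_tuple {ι : Type*} [Finite ι] {r : ℝ} {x y : ι → ℂ}
    (hx : Function.Injective x) (hy : Function.Injective y) (hxr : ∀ k, x k ∈ Metric.ball (0 : ℂ) r)
    (hyr : ∀ k, y k ∈ Metric.ball (0 : ℂ) r) :
    ∃ g ∈ diffGroup (Metric.ball 0 r), ∀ k, g (x k) = y k := by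
  classical
  have := Fintype.ofFinite ι
  suffices ∀ S : Finset ι, ∃ g ∈ diffGroup (Metric.ball 0 r), ∀ k ∈ S, g (x k) = y k by
    obtain ⟨g, hg, h⟩ := this Finset.univ
    exact ⟨g, hg, fun k => h k (Finset.mem_univ k)⟩
  intro S
  induction S using Finset.induction_on with
  | empty => exact ⟨1, one_mem _, fun k hk => by simp at hk⟩
  | insert k S hk ih =>
    obtain ⟨g, hg, h⟩ := ih
    have hF : (y '' (S : Set ι)).Finite := S.finite_toSet.image y
    have hr : 0 < r := Metric.pos_of_mem_ball (hxr k)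
    -- The next point is moved in the complement of the targets already reached, so those stay
    -- fixed.
    obtain ⟨g', hg', h'⟩ := exists_move (Metric.isOpen_ball.sdiff hF.isClosed)
      (isPreconnected_ball_diff hr hF) (x := g (x k)) (y := y k)
      ⟨(diffGroup_mem_iff hg _).2 (hxr k), by
        rintro ⟨l, hl, hl'⟩
        rw [← h l hl] at hl'
        exact hk (hx (g.injective hl') ▸ hl)⟩
      ⟨hyr k, by
        rintro ⟨l, hl, hl'⟩
        exact hk (hy hl' ▸ hl)⟩
    refine ⟨g' * g, mul_mem (diffGroup_mono sdiff_subset hg') hg, fun l hl => ?_⟩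
    rw [Equiv.Perm.mul_apply]
    rcases Finset.mem_insert.1 hl with rfl | hl
    · exact h'
    · rw [h l hl]
      exact hg'.2.2 _ fun h => h.2 (mem_image_of_mem y hl)

end PlantComplex

end

noncomputable section

namespace PlantComplex

variable {t : ℕ} {Δ : MarkedPoints t} {ξ : Fin t → ℕ}

/-! ### Shrinking arcs -/

/-- In a chart in which two sets are half lines, a push along the half lines maps one set to the
other. -/
theorem exists_push_image (e : OpenPartialHomeomorph ℂ ℂ) (he : ContDiffOn ℝ (⊤ : ℕ∞) e e.source)
    (he' : ContDiffOn ℝ (⊤ : ℕ∞) e.symm e.target) {r : ℝ} (hr : 0 < r)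
    (hs : Metric.ball 0 r ⊆ e.source) : ∃ ε₀ > 0, ∀ ε : ℝ, |ε| < ε₀ → ∀ A A' : Set ℂ,
      (∀ w ∈ Metric.ball (0 : ℂ) r, e w ∈ A ↔ w.im = 0 ∧ w.re ≤ 0) →
      (∀ w ∈ Metric.ball (0 : ℂ) r, e w ∈ A' ↔ w.im = 0 ∧ w.re ≤ ε) →
      (∀ z, z ∉ e '' Metric.ball 0 r → (z ∈ A ↔ z ∈ A')) →
      ∃ g ∈ diffGroup (e '' Metric.ball 0 r), g '' A = A' ∧ g (e 0) = e (ε : ℂ) := by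
  obtain ⟨ε₀, hε₀, ρ, hρ0, hρ, hpush⟩ := exists_push 0 hr
  refine ⟨ε₀, hε₀, fun ε hε A A' hA hA' hAA' => ?_⟩
  obtain ⟨hlip, h, hh, hhz⟩ := hpush (ε : ℂ) (by rwa [Complex.norm_real])
  have hre : ∀ z, (h z).re = z.re + ρ z * ε := fun z => by rw [hhz]; simp
  have him : ∀ z, (h z).im = z.im := fun z => by rw [hhz]; simp
  obtain ⟨g, hg, hge⟩ := exists_transport e he he' (half_lt_self hr) hs hh fun z hz => by
    rw [hhz, hρ z hz, zero_smul, add_zero]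
  -- The Lipschitz bound compares `ρ w * ε` with `ρ 0 * ε = ε` up to `|w.re| / 2`; so the push
  -- preserves the order of `w` and the origin on the real axis.
  have hord : ∀ w : ℂ, w.im = 0 → (w.re + ρ w * ε ≤ ε ↔ w.re ≤ 0) := by
    intro w hw
    have h1 := hlip w 0
    have h2 : ‖w‖ = |w.re| := by
      rw [show w = (w.re : ℂ) from Complex.ext rfl (by simpa using hw), Complex.norm_real]
      simp
    rw [hρ0, sub_zero, h2, Complex.norm_real, Real.norm_eq_abs, ← abs_mul] at h1
    have h3 := abs_le.1 h1
    have h4 : (ρ w - 1) * ε = ρ w * ε - ε := by ring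
    rw [h4] at h3
    constructor
    · intro h5
      by_contra hlt
      rw [abs_of_pos (not_le.1 hlt)] at h3
      linarith [not_le.1 hlt, h3.1]
    · intro h5
      rw [abs_of_nonpos h5] at h3
      linarith [h3.2]
  have key : ∀ z, g z ∈ A' ↔ z ∈ A := by
    intro z
    by_cases hz : z ∈ e '' Metric.ball 0 r
    · obtain ⟨w, hw, rfl⟩ := hz
      rw [hge w hw, hA' _ ((diffGroup_mem_iff hh w).2 hw), hA w hw, him, hre]
      constructor
      · rintro ⟨h1, h2⟩; exact ⟨h1, (hord w h1).1 h2⟩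
      · rintro ⟨h1, h2⟩; exact ⟨h1, (hord w h1).2 h2⟩
    · rw [hg.2.2 z hz]; exact (hAA' z hz).symm
  refine ⟨g, hg, ext fun z => ⟨?_, fun hz => ⟨g.symm z, (key _).1 ?_, g.apply_symm_apply z⟩⟩, ?_⟩
  · rintro ⟨w, hw, rfl⟩; exact (key w).2 hw
  · rwa [g.apply_symm_apply]
  · rw [hge 0 (Metric.mem_ball_self hr), hhz, hρ0]; simp

/-- An injective continuous image of a compact interval is embedded: the curve does not come back
near `γ x` at distant parameters. -/
theorem exists_mem_of_near {γ : ℝ → ℂ} (hc : ContinuousOn γ (Icc 0 1)) (hi : InjOn γ (Icc 0 1))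
    {x : ℝ} (hx : x ∈ Icc (0 : ℝ) 1) {N : Set ℝ} (hN : N ∈ nhdsWithin x (Icc 0 1)) :
    ∃ m > 0, ∀ s ∈ Icc (0 : ℝ) 1, ‖γ s - γ x‖ < m → s ∈ N := by
  obtain ⟨O, hO, hxO, hON⟩ := mem_nhdsWithin.1 hN
  have hK : IsClosed (γ '' (Icc 0 1 \ O)) :=
    ((isCompact_Icc.diff hO).image_of_continuousOn (hc.mono sdiff_subset)).isClosed
  have hxK : γ x ∉ γ '' (Icc 0 1 \ O) := by
    rintro ⟨s, hs, h⟩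
    rw [hi hs.1 hx h] at hs
    exact hs.2 hxO
  obtain ⟨m, hm, hm'⟩ := Metric.isOpen_iff.1 hK.isOpen_compl _ hxK
  refine ⟨m, hm, fun s hs hlt => ?_⟩
  by_contra hsN
  refine hm' (show γ s ∈ Metric.ball (γ x) m by rwa [Metric.mem_ball, dist_eq_norm])
    (mem_image_of_mem γ ⟨hs, fun hsO => hsN (hON ⟨hsO, hs⟩)⟩)

/-- A curve which is a coordinate line in a chart can be shrunk a bit. -/
theorem eventually_shrink {γ : ℝ → ℂ} (hc : ContinuousOn γ (Icc 0 1)) (hi : InjOn γ (Icc 0 1))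
    {U : Set ℂ} (hU : IsOpen U) {x j₀ j₁ : ℝ} (hxU : γ x ∈ U) (hj₀ : 0 ≤ j₀) (hx₀ : j₀ < x)
    (hx₁ : x ≤ j₁) (hj₁ : j₁ ≤ 1) (hJ : Icc j₀ j₁ ∈ nhdsWithin x (Icc 0 1))
    (e : OpenPartialHomeomorph ℂ ℂ) (he : ContDiffOn ℝ (⊤ : ℕ∞) e e.source)
    (he' : ContDiffOn ℝ (⊤ : ℕ∞) e.symm e.target) (h0 : (0 : ℂ) ∈ e.source) {τ : ℝ → ℝ}
    (hτc : ContinuousOn τ (Icc j₀ j₁)) (hτm : StrictMonoOn τ (Icc j₀ j₁)) (hτ0 : τ x = 0)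
    (hτe : ∀ s ∈ Icc j₀ j₁, e (τ s) = γ s) :
    ∀ᶠ y in nhdsWithin x (Icc 0 1), ∃ g ∈ diffGroup U,
      g '' (γ '' Icc 0 x) = γ '' Icc 0 y ∧ g (γ x) = γ y := by
  have hxJ : x ∈ Icc j₀ j₁ := ⟨hx₀.le, hx₁⟩
  have hx01 : x ∈ Icc (0 : ℝ) 1 := ⟨hj₀.trans hx₀.le, hx₁.trans hj₁⟩
  obtain ⟨r₀, hr₀, hr₀s⟩ := Metric.isOpen_iff.1 e.open_source 0 h0
  have hNr : ∀ r > 0, {s | s ∈ Icc j₀ j₁ ∧ |τ s| < r} ∈ nhdsWithin x (Icc 0 1) := by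
    intro r hr
    have h1 : {s | |τ s| < r} ∈ nhdsWithin x (Icc j₀ j₁) := by
      have h2 := (hτc x hxJ).eventually (Metric.ball_mem_nhds (τ x) hr)
      filter_upwards [h2] with s hs
      rwa [hτ0, Real.dist_0_eq_abs] at hs
    exact Filter.inter_mem hJ (nhdsWithin_le_iff.2 hJ h1)
  obtain ⟨m, hm, hmN⟩ := exists_mem_of_near hc hi hx01 (hNr r₀ hr₀)
  have he0 : e 0 = γ x := by rw [← hτe x hxJ, hτ0]; simp
  have hτj : τ j₀ < 0 := by
    rw [← hτ0]; exact hτm ⟨le_rfl, hx₀.le.trans hx₁⟩ hxJ hx₀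
  obtain ⟨r₁, hr₁, hr₁'⟩ : ∃ r₁ > 0, ∀ w ∈ Metric.ball (0 : ℂ) r₁, e w ∈ U ∩ Metric.ball (γ x) m := by
    have h1 : U ∩ Metric.ball (γ x) m ∈ nhds (e 0) := by
      rw [he0]; exact Filter.inter_mem (hU.mem_nhds hxU) (Metric.ball_mem_nhds _ hm)
    exact Metric.eventually_nhds_iff_ball.1 ((e.continuousAt h0).eventually h1)
  -- In the ball of radius `r` the curve consists only of its piece in the chart (`r₁`, through
  -- `m`), and by `r ≤ -τ j₀` that piece covers the axis all the way to the left edge, so it is a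
  -- half line there.
  set r := min (min r₀ r₁) (-τ j₀) with hr
  have hrpos : 0 < r := lt_min (lt_min hr₀ hr₁) (neg_pos.2 hτj)
  have hrr₀ : r ≤ r₀ := (min_le_left _ _).trans (min_le_left _ _)
  have hrr₁ : r ≤ r₁ := (min_le_left _ _).trans (min_le_right _ _)
  have hrτ : r ≤ -τ j₀ := min_le_right _ _
  have hrs : Metric.ball (0 : ℂ) r ⊆ e.source := (Metric.ball_subset_ball hrr₀).trans hr₀s
  have hEU : e '' Metric.ball 0 r ⊆ U := by
    rintro _ ⟨w, hw, rfl⟩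
    exact (hr₁' w (Metric.ball_subset_ball hrr₁ hw)).1
  have hball : ∀ a r : ℝ, |a| < r → (a : ℂ) ∈ Metric.ball (0 : ℂ) r := fun a r h => by
    rwa [mem_ball_zero_iff, Complex.norm_real]
  have hside : ∀ y ∈ Icc j₀ j₁, ∀ w ∈ Metric.ball (0 : ℂ) r,
      e w ∈ γ '' Icc 0 y ↔ w.im = 0 ∧ w.re ≤ τ y := by
    intro y hy w hw
    constructor
    · rintro ⟨s, hs, hsw⟩
      have hs01 : s ∈ Icc (0 : ℝ) 1 := ⟨hs.1, (hs.2.trans hy.2).trans hj₁⟩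
      have h1 := (hr₁' w (Metric.ball_subset_ball hrr₁ hw)).2
      rw [Metric.mem_ball, dist_eq_norm, ← hsw] at h1
      have h2 := hmN s hs01 h1
      have h3 : w = τ s := by
        refine e.injOn (hrs hw) (hr₀s (hball _ _ h2.2)) ?_
        rw [hτe s h2.1, hsw]
      rw [h3]
      exact ⟨Complex.ofReal_im _, hτm.monotoneOn h2.1 hy hs.2⟩
    · rintro ⟨h1, h2⟩
      have h3 : |w.re| < r := (Complex.abs_re_le_norm w).trans_lt (mem_ball_zero_iff.1 hw)
      have h4 := (abs_lt.1 h3).1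
      obtain ⟨s, hs, hs'⟩ := intermediate_value_Icc hy.1
        (hτc.mono (Icc_subset_Icc_right hy.2)) (show w.re ∈ Icc _ _ from ⟨by linarith, h2⟩)
      refine ⟨s, ⟨hj₀.trans hs.1, hs.2⟩, ?_⟩
      rw [← hτe s ⟨hs.1, hs.2.trans hy.2⟩, hs']
      congr 1
      exact Complex.ext rfl (by simp [h1])
  have hsub : ∀ y ∈ Icc j₀ j₁, ∀ y' ∈ Icc j₀ j₁, |τ y| < r → |τ y'| < r →
      ∀ z, z ∉ e '' Metric.ball 0 r → z ∈ γ '' Icc 0 y → z ∈ γ '' Icc 0 y' := by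
    rintro y hy y' hy' hyr hyr' z hz ⟨s, hs, rfl⟩
    refine ⟨s, ⟨hs.1, ?_⟩, rfl⟩
    by_contra hlt
    have hsJ : s ∈ Icc j₀ j₁ := ⟨hy'.1.trans (not_le.1 hlt).le, hs.2.trans hy.2⟩
    refine hz ⟨τ s, hball _ _ ?_, hτe s hsJ⟩
    have h1 := hτm.monotoneOn hsJ hy hs.2
    have h2 := hτm.monotoneOn hy' hsJ (not_le.1 hlt).le
    rw [abs_lt] at hyr hyr' ⊢
    exact ⟨by linarith, by linarith⟩
  obtain ⟨ε₀, hε₀, hpush⟩ := exists_push_image e he he' hrpos hrs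
  filter_upwards [hNr (min r ε₀) (lt_min hrpos hε₀)] with y hy
  obtain ⟨hyJ, hyτ⟩ := hy
  have hxτ : |τ x| < r := by rwa [hτ0, abs_zero]
  have hyτ' := hyτ.trans_le (min_le_left _ _)
  obtain ⟨g, hg, hg', hg''⟩ := hpush (τ y) (hyτ.trans_le (min_le_right _ _)) (γ '' Icc 0 x) (γ '' Icc 0 y)
    (fun w hw => by rw [hside x hxJ w hw, hτ0]) (hside y hyJ)
    fun z hz => ⟨hsub x hxJ y hyJ hxτ hyτ' z hz, hsub y hyJ x hxJ hyτ' hxτ z hz⟩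
  exact ⟨g, diffGroup_mono hEU hg, hg', by rwa [he0, hτe y hyJ] at hg''⟩

/-- A chart along a smooth immersed curve. -/
theorem exists_chart {γ : ℝ → ℂ} (hγ : ContDiffOn ℝ (⊤ : ℕ∞) γ (Icc 0 1)) {x : ℝ}
    (hx : x ∈ Ioo (0 : ℝ) 1) (hd : derivWithin γ (Icc 0 1) x ≠ 0) :
    ∃ e : OpenPartialHomeomorph ℂ ℂ, (0 : ℂ) ∈ e.source ∧ ContDiffOn ℝ (⊤ : ℕ∞) e e.source ∧
      ContDiffOn ℝ (⊤ : ℕ∞) e.symm e.target ∧ ∀ a : ℝ, e a = γ (x + a) := by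
  set c := derivWithin γ (Icc 0 1) x with hc
  -- The curve is thickened in the normal direction, so the derivative at `0` is multiplication by
  -- `c`.
  set F : ℂ → ℂ := fun w => γ (x + w.re) + w.im * (Complex.I * c) with hF
  set V : Set ℂ := {w | x + w.re ∈ Ioo (0 : ℝ) 1} with hV
  have hVo : IsOpen V := isOpen_Ioo.preimage (continuous_const.add Complex.continuous_re)
  have h0V : (0 : ℂ) ∈ V := by simpa [hV] using hx
  have hcd : ContDiff ℝ (⊤ : ℕ∞) fun w : ℂ => x + w.re := contDiff_const.add Complex.reCLM.contDiff
  have hFs : ContDiffOn ℝ (⊤ : ℕ∞) F V :=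
    (hγ.comp hcd.contDiffOn fun w hw => Ioo_subset_Icc_self hw).add
      (((Complex.ofRealCLM.contDiff.comp Complex.imCLM.contDiff).mul contDiff_const).contDiffOn)
  have hFd : HasFDerivAt F (ContinuousLinearMap.mul ℝ ℂ c) 0 := by
    have h1 : HasFDerivAt γ (ContinuousLinearMap.toSpanSingleton ℝ c) (x + (0 : ℂ).re) := by
      have := ((hγ.differentiableOn (by simp) x (Ioo_subset_Icc_self hx)).hasDerivWithinAt).hasDerivAt
        (Icc_mem_nhds hx.1 hx.2)
      simpa using this.hasFDerivAt
    have h2 : HasFDerivAt (fun w : ℂ => x + w.re) Complex.reCLM 0 :=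
      Complex.reCLM.hasFDerivAt.const_add x
    have h3 : HasFDerivAt (fun w : ℂ => (w.im : ℂ) * (Complex.I * c))
        ((Complex.ofRealCLM.comp Complex.imCLM).smulRight (Complex.I * c)) 0 :=
      ((Complex.ofRealCLM.comp Complex.imCLM).smulRight (Complex.I * c)).hasFDerivAt
    refine ((h1.comp (0 : ℂ) h2).add h3).congr_fderiv ?_
    ext w
    simp
    linear_combination c * Complex.re_add_im w
  have hinv : ∀ c : ℂ, c ≠ 0 → ∃ A : ℂ ≃L[ℝ] ℂ, (A : ℂ →L[ℝ] ℂ) = ContinuousLinearMap.mul ℝ ℂ c :=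
    fun c hc => ⟨ContinuousLinearEquiv.equivOfInverse (ContinuousLinearMap.mul ℝ ℂ c)
      (ContinuousLinearMap.mul ℝ ℂ c⁻¹) (fun z => by simp [hc]) (fun z => by simp [hc]), rfl⟩
  obtain ⟨A, hA⟩ := hinv c hd
  have hFs0 : ContDiffAt ℝ (⊤ : ℕ∞) F 0 := hFs.contDiffAt (hVo.mem_nhds h0V)
  have hFd' : HasFDerivAt F (A : ℂ →L[ℝ] ℂ) 0 := by rw [hA]; exact hFd
  let e₀ := hFs0.toOpenPartialHomeomorph F hFd' (by simp)
  have he₀ : ∀ w, e₀ w = F w := fun w => rfl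
  -- Invertibility of the derivative is an open condition; restricting the chart to where it holds
  -- makes the inverse smooth on the whole target.
  have hnear : {w | ∃ B : ℂ ≃L[ℝ] ℂ, (B : ℂ →L[ℝ] ℂ) = fderiv ℝ F w} ∈ nhds (0 : ℂ) := by
    have h1 : ContinuousAt (fderiv ℝ F) 0 :=
      (hFs.continuousOn_fderiv_of_isOpen hVo (by simp)).continuousAt (hVo.mem_nhds h0V)
    have h2 := A.nhds
    rw [hA, ← hFd.fderiv] at h2
    exact h1.preimage_mem_nhds h2
  obtain ⟨O, hOs, hO, h0O⟩ := mem_nhds_iff.1 (Filter.inter_mem hnear (hVo.mem_nhds h0V))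
  let e := e₀.restrOpen O hO
  have hesrc : e.source = e₀.source ∩ O := e₀.restrOpen_source O hO
  have he : ∀ w, e w = F w := fun w => rfl
  refine ⟨e, ?_, ?_, ?_, fun a => ?_⟩
  · rw [hesrc]
    exact ⟨hFs0.mem_toOpenPartialHomeomorph_source hFd' (by simp), h0O⟩
  · rw [hesrc]
    exact hFs.mono fun w hw => (hOs hw.2).2
  · intro z hz
    have h1 := e.map_target hz
    rw [hesrc] at h1
    obtain ⟨⟨B, hB⟩, h2⟩ := hOs h1.2
    have h3 : ContDiffAt ℝ (⊤ : ℕ∞) F (e.symm z) := hFs.contDiffAt (hVo.mem_nhds h2)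
    refine (e.contDiffAt_symm hz (f₀' := B) ?_ h3).contDiffWithinAt
    rw [hB]
    exact (h3.differentiableAt (by simp)).hasFDerivAt
  · rw [he]; simp [hF]

/-- An arc with a straight end can be shrunk by diffeomorphisms supported near the arc. -/
theorem exists_shrink {b : Arc Δ} (hb : StraightEnd b) {U : Set ℂ} (hU : IsOpen U)
    (hbU : ∀ s ∈ Ioc (0 : ℝ) 1, b.toFun s ∈ U) {s s' : ℝ} (hs : s ∈ Ioc (0 : ℝ) 1)
    (hs' : s' ∈ Ioc (0 : ℝ) 1) :
    ∃ g ∈ diffGroup U, g '' (b.toFun '' Icc 0 s) = b.toFun '' Icc 0 s' ∧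
      g (b.toFun s) = b.toFun s' := by
  refine isPreconnected_Ioc.induction₂
    (fun s s' => ∃ g ∈ diffGroup U, g '' (b.toFun '' Icc 0 s) = b.toFun '' Icc 0 s' ∧
      g (b.toFun s) = b.toFun s')
    (fun x hx => ?_) ?_ ?_ hs hs'
  · refine Filter.Eventually.filter_mono (nhdsWithin_mono x Ioc_subset_Icc_self) ?_
    -- At interior parameters there is a chart along the curve. At the tip the arc stops, and the
    -- chart must reach beyond it: the straight end allows an affine one.
    rcases hx.2.lt_or_eq with hx1 | rfl
    · obtain ⟨e, h0, he, he', hτ⟩ := exists_chart b.smooth ⟨hx.1, hx1⟩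
        (b.immersion x ⟨hx.1.le, hx.2⟩)
      refine eventually_shrink b.continuousOn b.injOn hU (hbU x hx) (j₀ := 0) (j₁ := 1) le_rfl hx.1
        hx.2 le_rfl self_mem_nhdsWithin e he he' h0 (τ := fun s => s - x) (by fun_prop)
        (fun s _ s' _ h => sub_lt_sub_right h x) (sub_self x) fun s _ => ?_
      rw [hτ]; simp
    · obtain ⟨u, hu, s₁, hs₁, hm, him⟩ := hb
      set p := b.toFun 1
      let h : ℂ ≃ₜ ℂ := (Homeomorph.mulLeft₀ u hu).trans (Homeomorph.addLeft p)
      have hh : ∀ z, h z = p + u * z := fun z => rfl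
      have hh' : ∀ z, h.symm z = u⁻¹ * (-p + z) := fun z => rfl
      refine eventually_shrink b.continuousOn b.injOn hU (hbU 1 hx) (j₀ := s₁) (j₁ := 1) hs₁.1.le
        hs₁.2 le_rfl le_rfl ?_ h.toOpenPartialHomeomorph ?_ ?_ (mem_univ _)
        (τ := fun s => ((b.toFun s - p) / u).re) ?_ hm (by simp [p]) fun s hs => ?_
      · refine Filter.mem_of_superset (Filter.inter_mem (mem_nhdsWithin_of_mem_nhds
          (Ici_mem_nhds hs₁.2)) self_mem_nhdsWithin) fun s hs => ⟨hs.1, hs.2.2⟩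
      · exact (contDiff_const.add (contDiff_const.mul contDiff_id)).contDiffOn
      · exact (contDiff_const.mul (contDiff_const.add contDiff_id)).contDiffOn
      · exact Complex.continuous_re.comp_continuousOn (((b.continuousOn.mono
          (Icc_subset_Icc_left hs₁.1.le)).sub continuousOn_const).div_const u)
      · have h1 : ((((b.toFun s - p) / u).re : ℝ) : ℂ) = (b.toFun s - p) / u :=
          Complex.ext rfl (him s hs).symm
        change p + u * _ = _
        rw [h1, mul_div_cancel₀ _ hu]; ring
  · rintro x y z - - - ⟨g, hg, h, h1⟩ ⟨g', hg', h', h1'⟩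
    refine ⟨g' * g, mul_mem hg' hg, ?_, by rw [Equiv.Perm.mul_apply, h1, h1']⟩
    rw [← h', ← h]
    exact image_comp g' g _
  · rintro x y - - ⟨g, hg, h, h1⟩
    refine ⟨g⁻¹, inv_mem hg, ?_, by rw [← h1]; exact g.symm_apply_apply _⟩
    rw [← h]
    exact (image_comp g.symm g _).symm.trans
      ((image_congr fun z _ => g.symm_apply_apply z).trans (image_id _))

end PlantComplex

end

noncomputable section

namespace PlantComplex

variable {t : ℕ} {Δ : MarkedPoints t} {ξ : Fin t → ℕ}

/-! ### Families of arcs with the same colors are related by diffeomorphisms -/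

theorem image_carrier_disjoint {a b a' b' : Arc Δ} (hab : a.carrier ∩ b.carrier = {base})
    {φ : Disk ≃ₜ Disk} (hφ : φ ∈ isotopyGroup Δ) (ha : φ '' a.carrier = a'.carrier)
    (hb : φ '' b.carrier = b'.carrier) : a'.carrier ∩ b'.carrier = {base} := by
  rw [← ha, ← hb, ← image_inter φ.injective, hab, image_singleton, isotopy_base hφ]

/-- Every family of arcs ordered at the base point is isotopic to a family of arcs which are
straight near both ends. -/
theorem exists_normal_form {N : ℕ} {a : Fin N → Arc Δ}
    (hd : ∀ k l, k ≠ l → (a k).carrier ∩ (a l).carrier = {base}) (ho : OrderedAtBase a)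
    {c : Fin N → ℝ} (hc : StrictMono c) : ∃ φ ∈ isotopyGroup Δ, ∃ b : Fin N → Arc Δ, ∃ δ > 0,
      (∀ k, φ '' (a k).carrier = (b k).carrier) ∧ (∀ k, StraightStart (b k) (c k) δ) ∧
      ∀ k, StraightEnd (b k) := by
  obtain ⟨φ, hφ, b, δ, hδ, h1, h2⟩ := exists_straightStart ho hc
  obtain ⟨ψ, hψ, b', h3, h4, h5⟩ := exists_straightEnds
    (fun k l hkl => image_carrier_disjoint (hd k l hkl) hφ (h1 k) (h1 l)) h2
  refine ⟨ψ * φ, mul_mem hψ hφ, b', δ, hδ, fun k => ?_, h4, h5⟩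
  rw [← h3, ← h1, ← image_comp]; rfl

theorem coe_image_carrier (a : Arc Δ) : (fun z : Disk => (z : ℂ)) '' a.carrier =
    a.toFun '' Icc 0 1 := by
  ext z
  constructor
  · rintro ⟨w, ⟨s, hs, h⟩, rfl⟩; exact ⟨s, hs, h⟩
  · rintro ⟨s, hs, rfl⟩; exact ⟨a.pt ⟨s, hs⟩, a.pt_mem _, rfl⟩

/-- The points of the line `x = c y` up to the height `δ`. -/
def segmentAtBase (c δ : ℝ) : Set ℂ :=
  (fun y : ℝ => (c * y : ℂ) + y * Complex.I - Complex.I) '' Icc 0 δ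

theorem StraightStart.exists_image_eq {b : Arc Δ} {c δ : ℝ} (h : StraightStart b c δ) :
    ∃ s ∈ Ioc (0 : ℝ) 1, b.toFun '' Icc 0 s = segmentAtBase c δ ∧
      b.toFun s = (c * δ : ℂ) + δ * Complex.I - Complex.I := by
  obtain ⟨s₀, hs₀, hm, he, hl, -⟩ := h
  have heq : ∀ s ∈ Icc 0 s₀, b.toFun s =
      (c * (b.germ s).im : ℂ) + (b.germ s).im * Complex.I - Complex.I := fun s hs => by
    have h1 : b.toFun s = b.germ s - Complex.I := by simp [Arc.germ]
    rw [h1, ← Complex.ofReal_mul, ← hl s hs, Complex.re_add_im]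
  have hle := StraightStart.im_le hs₀ hm he
  have h01 : s₀ ∈ Icc 0 s₀ := ⟨hs₀.1.le, le_rfl⟩
  refine ⟨s₀, ⟨hs₀.1, hs₀.2.le⟩, Subset.antisymm ?_ ?_, by rw [heq s₀ h01, he]⟩
  · rintro _ ⟨s, hs, rfl⟩
    exact ⟨_, ⟨b.germ_im_nonneg ⟨hs.1, hs.2.trans hs₀.2.le⟩, hle s hs⟩, (heq s hs).symm⟩
  · rintro _ ⟨y, hy, rfl⟩
    have hc : ContinuousOn (fun s => (b.germ s).im) (Icc 0 s₀) :=
      Complex.continuous_im.comp_continuousOn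
        (b.germ_smooth.continuousOn.mono (Icc_subset_Icc_right hs₀.2.le))
    obtain ⟨s, hs, hs'⟩ := intermediate_value_Icc hs₀.1.le hc
      (show y ∈ Icc _ _ by rw [b.germ_zero, he]; exact hy)
    refine ⟨s, hs, ?_⟩
    rw [heq s hs]
    simp only at hs' ⊢
    rw [hs']

theorem notMem_ball_of_mem_segmentAtBase {c δ δ' : ℝ} (hδ : δ ≤ δ') {z : ℂ}
    (hz : z ∈ segmentAtBase c δ) : z ∉ Metric.ball (0 : ℂ) (1 - δ') := by
  obtain ⟨y, hy, rfl⟩ := hz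
  rw [mem_ball_zero_iff, not_lt]
  have h1 := Complex.abs_im_le_norm ((c * y : ℂ) + y * Complex.I - Complex.I)
  have h2 : ((c * y : ℂ) + y * Complex.I - Complex.I).im = y - 1 := by simp
  rw [h2] at h1
  have := neg_abs_le (y - 1)
  linarith [hy.2]

/-- Simultaneous shrinking of disjoint arcs. -/
theorem exists_shrink_family {ι : Type*} [Finite ι] {b : ι → Arc Δ}
    (hd : ∀ k l, k ≠ l → (b k).carrier ∩ (b l).carrier = {base}) (hb : ∀ k, StraightEnd (b k))
    {s : ι → ℝ} (hs : ∀ k, s k ∈ Ioc (0 : ℝ) 1) : ∃ g ∈ diffGroup (Metric.ball 0 1),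
      (∀ k, g '' ((b k).toFun '' Icc 0 1) = (b k).toFun '' Icc 0 (s k)) ∧
      (∀ k, g ((b k).toFun 1) = (b k).toFun (s k)) ∧
      ∀ i, ∀ z ∈ Δ.pts i, (∀ k, z ≠ (b k).toFun 1) → g z = z := by
  classical
  have := Fintype.ofFinite ι
  suffices ∀ S : Finset ι, ∃ g ∈ diffGroup (Metric.ball 0 1),
      (∀ k ∈ S, g '' ((b k).toFun '' Icc 0 1) = (b k).toFun '' Icc 0 (s k)) ∧
      (∀ k ∈ S, g ((b k).toFun 1) = (b k).toFun (s k)) ∧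
      (∀ k, k ∉ S → ∀ u ∈ Icc (0 : ℝ) 1, g ((b k).toFun u) = (b k).toFun u) ∧
      ∀ i, ∀ z ∈ Δ.pts i, (∀ k, z ≠ (b k).toFun 1) → g z = z by
    obtain ⟨g, hg, h1, h2, -, h3⟩ := this Finset.univ
    exact ⟨g, hg, fun k => h1 k (Finset.mem_univ k), fun k => h2 k (Finset.mem_univ k), h3⟩
  intro S
  induction S using Finset.induction_on with
  | empty =>
    exact ⟨1, one_mem _, fun k hk => by simp at hk, fun k hk => by simp at hk, fun _ _ _ _ => rfl,
      fun _ _ _ _ => rfl⟩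
  | insert k S hk ih =>
    obtain ⟨g, hg, h1, h2, h3, h4⟩ := ih
    -- Arc `k` without the base point avoids the other arcs and the other marked points, so it can
    -- be retracted by a diffeomorphism fixing all of these.
    set A : Set ℂ := ⋃ l ∈ {l | l ≠ k}, (b l).toFun '' Icc 0 1 with hA
    set M : Set ℂ := {z | (∃ i, z ∈ Δ.pts i) ∧ z ≠ (b k).toFun 1} with hM
    have hAc : IsClosed A := (Set.toFinite _).isClosed_biUnion fun l _ =>
      (isCompact_Icc.image_of_continuousOn (b l).continuousOn).isClosed
    have hMc : IsClosed M := ((finite_marked Δ).subset fun z hz => hz.1).isClosed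
    have hbU : ∀ u ∈ Ioc (0 : ℝ) 1, (b k).toFun u ∈ Metric.ball 0 1 \ (A ∪ M) := by
      intro u hu
      have hu' : u ∈ Icc (0 : ℝ) 1 := ⟨hu.1.le, hu.2⟩
      refine ⟨mem_ball_zero_iff.2 ?_, ?_⟩
      · rcases hu.2.lt_or_eq with h | rfl
        · exact ((b k).interior u ⟨hu.1, h⟩).1
        · obtain ⟨i, hi⟩ := (b k).finish
          exact Δ.norm_lt_one i _ hi
      · rintro (h | ⟨⟨i, hi⟩, hne⟩)
        · obtain ⟨l, hl, w, hw, hw'⟩ := mem_iUnion₂.1 h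
          exact hu.1.ne' (Arc.eq_zero_of_eq (hd k l (Ne.symm hl)) hu' hw hw'.symm).1
        · have h5 : (⟨u, hu'⟩ : unitInterval) = 1 := (b k).pt_marked (s := ⟨u, hu'⟩) hi
          rw [show u = 1 from congrArg Subtype.val h5] at hne
          exact hne rfl
    obtain ⟨f, hf, e1, e2⟩ := exists_shrink (hb k) (Metric.isOpen_ball.sdiff (hAc.union hMc)) hbU
      ⟨zero_lt_one, le_rfl⟩ (hs k)
    have hfb : ∀ l, l ≠ k → ∀ u ∈ Icc (0 : ℝ) 1, f ((b l).toFun u) = (b l).toFun u :=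
      fun l hl u hu => hf.2.2 _ fun h => h.2 (Or.inl (mem_biUnion (show l ∈ {l | l ≠ k} from hl)
        (mem_image_of_mem _ hu)))
    -- First `f` retracts arc `k` and fixes the other arcs, still of full length. Then `g` retracts
    -- those of `S`; it fixes arc `k` pointwise because `k ∉ S`.
    refine ⟨g * f, mul_mem hg (diffGroup_mono sdiff_subset hf), fun l hl => ?_, fun l hl => ?_,
      fun l hl u hu => ?_, fun i z hz hne => ?_⟩
    · have h5 : ⇑(g * f) '' ((b l).toFun '' Icc 0 1) = g '' (f '' ((b l).toFun '' Icc 0 1)) :=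
        image_comp g f _
      rw [h5]
      rcases Finset.mem_insert.1 hl with rfl | hl
      · rw [e1, ← image_comp]
        exact image_congr fun u hu => h3 l hk u ⟨hu.1, hu.2.trans (hs l).2⟩
      · have hlk : l ≠ k := fun h => hk (h ▸ hl)
        have h6 : f '' ((b l).toFun '' Icc 0 1) = (b l).toFun '' Icc 0 1 := by
          rw [← image_comp]
          exact image_congr (hfb l hlk)
        rw [h6, h1 l hl]
    · rw [Equiv.Perm.mul_apply]
      rcases Finset.mem_insert.1 hl with rfl | hl
      · rw [e2, h3 l hk _ ⟨(hs l).1.le, (hs l).2⟩]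
      · rw [hfb l (fun h => hk (h ▸ hl)) 1 (by simp), h2 l hl]
    · rw [Finset.mem_insert, not_or] at hl
      rw [Equiv.Perm.mul_apply, hfb l hl.1 u hu, h3 l hl.2 u hu]
    · rw [Equiv.Perm.mul_apply, hf.2.2 z fun h => h.2 (Or.inr ⟨⟨i, hz⟩, hne k⟩), h4 i z hz hne]

/-- A diffeomorphism of the plane supported in the open disk restricts to the disk. -/
theorem exists_coloredDiffeo {G : Equiv.Perm ℂ} (hG : G ∈ diffGroup (Metric.ball 0 1))
    (hc : ∀ i, ∀ z ∈ Δ.pts i, G z ∈ Δ.pts i) :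
    ∃ g : coloredDiffeo Δ, ∀ z : Disk, (g.1 z : ℂ) = G z := by
  have hmaps : ∀ G ∈ diffGroup (Metric.ball 0 1), ∀ z : Disk, G z ∈ Metric.closedBall (0 : ℂ) 1 := by
    intro G hG z
    by_cases hz : (z : ℂ) ∈ Metric.ball 0 1
    · exact Metric.ball_subset_closedBall ((diffGroup_mem_iff hG _).2 hz)
    · rw [hG.2.2 _ hz]; exact z.2
  let φ : Disk ≃ₜ Disk :=
    { toFun := fun z => ⟨G z, hmaps G hG z⟩
      invFun := fun z => ⟨G⁻¹ z, hmaps G⁻¹ (inv_mem hG) z⟩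
      left_inv := fun z => Subtype.ext (G.symm_apply_apply z)
      right_inv := fun z => Subtype.ext (G.apply_symm_apply z)
      continuous_toFun := (hG.1.continuous.comp continuous_subtype_val).subtype_mk _
      continuous_invFun := (hG.2.1.continuous.comp continuous_subtype_val).subtype_mk _ }
  refine ⟨⟨φ, ⟨G, hG.1.contDiffOn, fun z => rfl⟩, ⟨G.symm, hG.2.1.contDiffOn, fun z => rfl⟩,
    fun z hz => Subtype.ext (hG.2.2 z fun h => ?_), fun i z => ⟨fun h => ?_, hc i z⟩⟩, fun z => rfl⟩
  · rw [mem_ball_zero_iff] at h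
    exact h.ne hz
  -- An injective self-map of a finite set is onto, so `G` also reflects membership in `Δ.pts i`.
  · obtain ⟨w, hw, hw'⟩ := Finset.surjOn_of_injOn_of_card_le G (s := Δ.pts i) (t := Δ.pts i)
      (fun z hz => hc i z hz) G.injective.injOn le_rfl h
    rwa [← G.injective hw']

/-- Two families of disjoint arcs with the same colors and the same order at the base point are
related by a diffeomorphism and an isotopy. -/
theorem exists_diffeo_family {N : ℕ} {a a' : Fin N → Arc Δ}
    (hd : ∀ k l, k ≠ l → (a k).carrier ∩ (a l).carrier = {base})
    (hd' : ∀ k l, k ≠ l → (a' k).carrier ∩ (a' l).carrier = {base})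
    (ho : OrderedAtBase a) (ho' : OrderedAtBase a') {j : Fin N → Fin t}
    (hj : ∀ k, (a k).HasColor (j k)) (hj' : ∀ k, (a' k).HasColor (j k)) :
    ∃ g : coloredDiffeo Δ, ∃ ψ ∈ isotopyGroup Δ,
      ∀ k, ψ '' (g.1 '' (a k).carrier) = (a' k).carrier := by
  classical
  -- The common slopes `0, 1, …, N - 1` make the initial segments of both normal forms literally
  -- equal.
  have hcm : StrictMono fun k : Fin N => (k : ℝ) := fun k l h => Nat.cast_lt.2 (Fin.lt_def.1 h)
  obtain ⟨φ, hφ, b, δ₁, hδ₁, h1, h2, h3⟩ := exists_normal_form hd ho hcm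
  obtain ⟨φ', hφ', b', δ₂, hδ₂, h1', h2', h3'⟩ := exists_normal_form hd' ho' hcm
  have htip : ∀ k, (b k).toFun 1 = (a k).toFun 1 := fun k =>
    congrArg Subtype.val (tip_eq_of_image hφ (h1 k))
  have htip' : ∀ k, (b' k).toFun 1 = (a' k).toFun 1 := fun k =>
    congrArg Subtype.val (tip_eq_of_image hφ' (h1' k))
  have hdb := fun k l hkl => image_carrier_disjoint (hd k l hkl) hφ (h1 k) (h1 l)
  have hdb' := fun k l hkl => image_carrier_disjoint (hd' k l hkl) hφ' (h1' k) (h1' l)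
  have hbj : ∀ k, (b k).toFun 1 ∈ Δ.pts (j k) := fun k => by rw [htip]; exact hj k
  have hbj' : ∀ k, (b' k).toFun 1 ∈ Δ.pts (j k) := fun k => by rw [htip']; exact hj' k
  -- All marked points lie in the ball of radius `1 - δ₃`, which a segment at `-i` of height at most
  -- `δ₃` does not meet.
  obtain ⟨δ₃, hδ₃, hδ₃'⟩ : ∃ δ₃ > 0, ∀ i, ∀ z ∈ Δ.pts i, ‖z‖ < 1 - δ₃ := by
    have : Finite {z : ℂ // ∃ i, z ∈ Δ.pts i} := finite_marked Δ
    obtain ⟨m, hm, hm'⟩ := exists_min_pos (f := fun z : {z : ℂ // ∃ i, z ∈ Δ.pts i} => 1 - ‖z.1‖)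
      fun z => by
        obtain ⟨i, hi⟩ := z.2
        exact sub_pos.2 (Δ.norm_lt_one i _ hi)
    exact ⟨m / 2, by positivity, fun i z hz => by linarith [hm' ⟨z, i, hz⟩]⟩
  set δ := min (min δ₁ δ₂) δ₃ with hδ
  have hδ0 : 0 < δ := lt_min (lt_min hδ₁ hδ₂) hδ₃
  have hδ1 : δ ≤ δ₁ := (min_le_left _ _).trans (min_le_left _ _)
  have hδ2 : δ ≤ δ₂ := (min_le_left _ _).trans (min_le_right _ _)
  have hδ3 : δ ≤ δ₃ := min_le_right _ _
  choose s hs hsi hse using fun k => ((h2 k).shrink hδ0 hδ1).exists_image_eq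
  choose s' hs' hsi' hse' using fun k => ((h2' k).shrink hδ0 hδ2).exists_image_eq
  obtain ⟨f, hf, f1, f2, f3⟩ := exists_shrink_family hdb h3 hs
  obtain ⟨f', hf', f1', f2', f3'⟩ := exists_shrink_family hdb' h3' hs'
  -- the remaining marked points
  let R : (Fin N → Arc Δ) → Fin t → Finset ℂ := fun b i =>
    (Δ.pts i).filter fun z => ∀ k, z ≠ (b k).toFun 1
  -- Both families use the same number of marked points of each color, so the unused ones can be
  -- matched.
  have hRcard : ∀ b : Fin N → Arc Δ, (∀ k l, k ≠ l → (b k).carrier ∩ (b l).carrier = {base}) →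
      (∀ k, (b k).toFun 1 ∈ Δ.pts (j k)) → ∀ i,
      (R b i).card + (Finset.univ.filter fun k => j k = i).card = (Δ.pts i).card := by
    intro b hdb hbj i
    have hinj : Function.Injective fun k => (b k).toFun 1 := fun k l h => by
      by_contra hkl
      exact tip_ne_tip (hdb k l hkl) (Subtype.ext h)
    rw [← Finset.card_filter_add_card_filter_not (s := Δ.pts i) fun z => ∀ k, z ≠ (b k).toFun 1,
      ← Finset.card_image_of_injective _ hinj]
    congr 2
    ext z
    simp only [Finset.mem_image, Finset.mem_filter, Finset.mem_univ, true_and, not_forall, not_not]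
    constructor
    · rintro ⟨k, hk, rfl⟩
      exact ⟨hk ▸ hbj k, k, rfl⟩
    · rintro ⟨hz, k, rfl⟩
      exact ⟨k, color_unique (hbj k) hz, rfl⟩
  have hRR : ∀ i, (R b i).card = (R b' i).card := fun i => by
    have e1 := hRcard b hdb hbj i
    have e2 := hRcard b' hdb' hbj' i
    omega
  have hRball : ∀ b i, ∀ z ∈ R b i, z ∈ Metric.ball (0 : ℂ) (1 - δ) := fun b i z hz =>
    mem_ball_zero_iff.2 ((hδ₃' i z (Finset.mem_filter.1 hz).1).trans_le (by linarith))
  let E : ∀ i, R b i ≃ R b' i := fun i => Finset.equivOfCardEq (hRR i)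
  obtain ⟨m, hm, hm'⟩ := exists_move_tuple (ι := Σ i, R b i) (r := 1 - δ) (x := fun z => z.2)
    (y := fun z => E z.1 z.2) (by
      rintro ⟨i, z⟩ ⟨i', z'⟩ h
      obtain rfl := color_unique (Finset.mem_filter.1 z.2).1
        ((show (z : ℂ) = z' from h) ▸ (Finset.mem_filter.1 z'.2).1)
      rw [Subtype.ext (show (z : ℂ) = z' from h)]) (by
      rintro ⟨i, z⟩ ⟨i', z'⟩ h
      have h : (E i z : ℂ) = E i' z' := h
      obtain rfl := color_unique (Finset.mem_filter.1 (E i z).2).1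
        (h ▸ (Finset.mem_filter.1 (E i' z').2).1)
      rw [(E i).injective (Subtype.ext h)]) (fun z => hRball b _ _ z.2.2)
    (fun z => hRball b' _ _ (E z.1 z.2).2)
  have hmseg : ∀ c, ∀ z ∈ segmentAtBase c δ, m z = z := fun c z hz =>
    hm.2.2 z (notMem_ball_of_mem_segmentAtBase le_rfl hz)
  have hend : ∀ c : ℝ, (c * δ : ℂ) + δ * Complex.I - Complex.I ∈ segmentAtBase c δ := fun c =>
    ⟨δ, ⟨hδ0.le, le_rfl⟩, rfl⟩
  have hfinv : ∀ k : Fin N, f'.symm '' segmentAtBase (k : ℕ) δ = (b' k).toFun '' Icc 0 1 := fun k => by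
    rw [← hsi', ← f1', ← image_comp]
    exact (image_congr fun z _ => f'.symm_apply_apply z).trans (image_id _)
  -- Retract the first family to the segments, match the unused marked points away from the
  -- segments, and expand along the second family.
  obtain ⟨g, hg⟩ := exists_coloredDiffeo (Δ := Δ) (G := f'⁻¹ * m * f)
    (mul_mem (mul_mem (inv_mem hf') (diffGroup_mono (Metric.ball_subset_ball (by linarith)) hm)) hf)
    (fun i z hz => by
      rw [Equiv.Perm.mul_apply, Equiv.Perm.mul_apply]
      by_cases hzk : ∀ k, z ≠ (b k).toFun 1
      · have hzR : z ∈ R b i := Finset.mem_filter.2 ⟨hz, hzk⟩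
        rw [f3 i z hz hzk, hm' ⟨i, z, hzR⟩]
        have h5 := Finset.mem_filter.1 (E i ⟨z, hzR⟩).2
        have h6 := f3' i _ h5.1 h5.2
        change f'⁻¹ (E i ⟨z, hzR⟩ : ℂ) ∈ _
        rw [Equiv.Perm.inv_eq_iff_eq.2 h6.symm]
        exact h5.1
      · push Not at hzk
        obtain ⟨k, rfl⟩ := hzk
        rw [f2, hse, hmseg _ _ (hend k), ← hse', ← f2']
        change f'.symm (f' _) ∈ _
        rw [f'.symm_apply_apply]
        have := color_unique (hbj k) hz
        exact this ▸ hbj' k)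
  have hgb : ∀ k, g.1 '' (b k).carrier = (b' k).carrier := fun k => by
    apply Subtype.val_injective.image_injective
    rw [← image_comp]
    have h5 : (fun z : Disk => (z : ℂ)) '' (b' k).carrier = _ := coe_image_carrier (b' k)
    have h6 : (fun z : Disk => (z : ℂ)) '' (b k).carrier = _ := coe_image_carrier (b k)
    rw [h5, ← hfinv]
    have h7 : (Subtype.val ∘ g.1 : Disk → ℂ) = f'.symm ∘ m ∘ f ∘ (fun z : Disk => (z : ℂ)) :=
      funext hg
    rw [h7, image_comp, image_comp, image_comp, h6, f1, hsi]
    congr 1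
    exact (image_congr (hmseg k)).trans (image_id _)
  -- Here `g` carries `φ a` to `φ' a'`. Conjugating `φ` by `g` moves both isotopies to the left of
  -- `g`.
  refine ⟨g, φ'⁻¹ * (g.1 * φ * g.1⁻¹),
    mul_mem (inv_mem hφ') (conj_mem_isotopyGroup hφ g.2), fun k => ?_⟩
  have h5 : ⇑(φ'⁻¹ * (g.1 * φ * g.1⁻¹)) '' (g.1 '' (a k).carrier) =
      φ'.symm '' (g.1 '' (φ '' (a k).carrier)) := by
    rw [← image_comp, ← image_comp, ← image_comp]
    refine image_congr fun z _ => ?_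
    change φ'.symm (g.1 (φ (g.1.symm (g.1 z)))) = φ'.symm (g.1 (φ z))
    rw [Homeomorph.symm_apply_apply]
  rw [h5, h1, hgb, ← h1', ← image_comp]
  exact (image_congr fun z _ => φ'.symm_apply_apply z).trans (image_id _)

end PlantComplex

end

noncomputable section

namespace PlantComplex

variable {t : ℕ} {Δ : MarkedPoints t} {ξ : Fin t → ℕ}

/-! ### Existence of arcs -/

theorem fderiv_injective_of_mem_diffGroup {U : Set ℂ} {m : Equiv.Perm ℂ} (hm : m ∈ diffGroup U)
    (z v : ℂ) (h : fderiv ℝ m z v = 0) : v = 0 := by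
  have h1 : HasFDerivAt (m.symm ∘ m) ((fderiv ℝ m.symm (m z)).comp (fderiv ℝ m z)) z :=
    (hm.2.1.differentiable (by simp) _).hasFDerivAt.comp z
      (hm.1.differentiable (by simp) z).hasFDerivAt
  have h2 : m.symm ∘ m = id := funext m.symm_apply_apply
  rw [h2] at h1
  have h3 := congrArg (fun L : ℂ →L[ℝ] ℂ => L v) (h1.unique (hasFDerivAt_id z))
  simpa [h] using h3.symm

/-- There are disjoint arcs, in any given order at the base point, to distinct marked points. -/
theorem exists_arcs {N : ℕ} {p : Fin N → ℂ} (hp : Function.Injective p) {j : Fin N → Fin t}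
    (hpj : ∀ k, p k ∈ Δ.pts (j k)) : ∃ a : Fin N → Arc Δ,
      (∀ k l, k ≠ l → (a k).carrier ∩ (a l).carrier = {base}) ∧
      StrictAnti (fun k => (a k).tangent.arg) ∧ ∀ k, (a k).HasColor (j k) := by
  obtain ⟨μ, hμ, hμ'⟩ := exists_lt_im_marked Δ
  set C : ℝ := N + 1 with hC
  obtain ⟨δ, hδ0, hδμ, hδC⟩ : ∃ δ > 0, δ ≤ μ ∧ 2 * δ * (1 + C ^ 2) < 2 := by
    refine ⟨min μ (1 / (2 * (1 + C ^ 2))), by positivity, min_le_left _ _, ?_⟩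
    have h1 := mul_le_mul_of_nonneg_right (min_le_right μ (1 / (2 * (1 + C ^ 2))))
      (show 0 ≤ 2 * (1 + C ^ 2) by positivity)
    rw [one_div_mul_cancel (by positivity)] at h1
    linarith
  -- The model arcs are segments from `-i` of slopes `0, …, N - 1`, too low to meet any marked
  -- point.
  let v : Fin N → ℂ := fun k => δ * ((k : ℕ) + Complex.I)
  have hvre : ∀ k, (v k).re = δ * (k : ℕ) := fun k => by simp [v]
  have hvim : ∀ k, (v k).im = δ := fun k => by simp [v]
  have hv0 : ∀ k, v k ≠ 0 := fun k h => by
    have := hvim k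
    rw [h] at this
    exact hδ0.ne this
  let σ : Fin N → ℝ → ℂ := fun k s => s • v k - Complex.I
  have hσim : ∀ k s, (σ k s).im = s * δ - 1 := fun k s => by simp [σ, hvim]
  have hσre : ∀ k s, (σ k s).re = s * (δ * (k : ℕ)) := fun k s => by simp [σ, hvre]
  have hσ1 : ∀ k, ∀ s ∈ Ioc (0 : ℝ) 1, ‖σ k s‖ < 1 := fun k s hs => by
    have h1 : 0 < s * δ := mul_pos hs.1 hδ0
    refine norm_lt_one_of_wedge hδC (z := s • v k) ?_ ?_ ?_
    · simpa [hvim] using h1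
    · simp only [Complex.smul_im, hvim, smul_eq_mul]
      nlinarith [hs.2]
    · have h2 : ((k : ℕ) : ℝ) < C := by
        have : ((k : ℕ) : ℝ) < N := Nat.cast_lt.2 k.2
        linarith
      simp only [Complex.smul_im, Complex.smul_re, hvim, hvre, smul_eq_mul]
      rw [abs_of_nonneg (mul_nonneg hs.1.le (mul_nonneg hδ0.le (Nat.cast_nonneg _)))]
      nlinarith
  have hσeq : ∀ k l s u, σ k s = σ l u → s = u ∧ s * (k : ℕ) = s * (l : ℕ) := fun k l s u h => by
    have h1 := congrArg Complex.im h
    have h2 := congrArg Complex.re h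
    rw [hσim, hσim] at h1
    rw [hσre, hσre] at h2
    have h3 : s = u := mul_right_cancel₀ hδ0.ne' (sub_left_injective h1)
    subst h3
    refine ⟨rfl, mul_left_cancel₀ hδ0.ne' ?_⟩
    linarith
  have hσmark : ∀ k, ∀ s ∈ Icc (0 : ℝ) 1, ∀ i, σ k s ∉ Δ.pts i := fun k s hs i h => by
    have h1 := hμ' i _ h
    rw [hσim] at h1
    nlinarith [hs.2]
  let Q := {z : ℂ // (∃ i, z ∈ Δ.pts i) ∧ ∀ k, z ≠ p k}
  have hQ : Finite Q := (finite_marked Δ).subset fun z hz => hz.1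
  let x : Fin N ⊕ Q → ℂ := Sum.elim (fun k => σ k 1) Subtype.val
  let y : Fin N ⊕ Q → ℂ := Sum.elim p Subtype.val
  have h11 : (1 : ℝ) ∈ Icc (0 : ℝ) 1 := ⟨zero_le_one, le_rfl⟩
  have hx : Function.Injective x := by
    rintro (k | z) (l | z') h
    · have h1 := (hσeq k l 1 1 h).2
      rw [one_mul, one_mul] at h1
      rw [Fin.ext (Nat.cast_injective h1)]
    · obtain ⟨i, hi⟩ := z'.2.1
      rw [← show σ k 1 = z' from h] at hi
      exact absurd hi (hσmark k 1 h11 i)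
    · obtain ⟨i, hi⟩ := z.2.1
      rw [show (z : ℂ) = σ l 1 from h] at hi
      exact absurd hi (hσmark l 1 h11 i)
    · rw [Subtype.ext (show (z : ℂ) = z' from h)]
  have hy : Function.Injective y := by
    rintro (k | z) (l | z') h
    · rw [hp h]
    · exact absurd h.symm (z'.2.2 k)
    · exact absurd h (z.2.2 l)
    · rw [Subtype.ext (show (z : ℂ) = z' from h)]
  have hx1 : ∀ k, ‖x k‖ < 1 := by
    rintro (k | z)
    · exact hσ1 k 1 ⟨zero_lt_one, le_rfl⟩
    · obtain ⟨i, hi⟩ := z.2.1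
      exact Δ.norm_lt_one i _ hi
  have hy1 : ∀ k, ‖y k‖ < 1 := by
    rintro (k | z)
    · exact Δ.norm_lt_one _ _ (hpj k)
    · obtain ⟨i, hi⟩ := z.2.1
      exact Δ.norm_lt_one i _ hi
  obtain ⟨r₁, hr₁, hr₁'⟩ := exists_min_pos (f := fun k => 1 - ‖x k‖) fun k => sub_pos.2 (hx1 k)
  obtain ⟨r₂, hr₂, hr₂'⟩ := exists_min_pos (f := fun k => 1 - ‖y k‖) fun k => sub_pos.2 (hy1 k)
  obtain ⟨r, hr1, hxr, hyr⟩ : ∃ r < 1, (∀ k, x k ∈ Metric.ball (0 : ℂ) r) ∧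
      ∀ k, y k ∈ Metric.ball (0 : ℂ) r := by
    refine ⟨1 - min r₁ r₂ / 2, by linarith [lt_min hr₁ hr₂], fun k => ?_, fun k => ?_⟩
    · rw [mem_ball_zero_iff]
      linarith [hr₁' k, min_le_left r₁ r₂, lt_min hr₁ hr₂]
    · rw [mem_ball_zero_iff]
      linarith [hr₂' k, min_le_right r₁ r₂, lt_min hr₁ hr₂]
  -- The diffeomorphism sends the ends of the segments to the `p k` and fixes the other marked
  -- points. Since `r < 1` it is the identity near the base point, so directions there do not
  -- change.
  obtain ⟨m, hm, hmxy⟩ := exists_move_tuple hx hy hxr hyr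
  have hmp : ∀ k, m (σ k 1) = p k := fun k => hmxy (Sum.inl k)
  have hmq : ∀ i, ∀ z ∈ Δ.pts i, (∀ k, z ≠ p k) → m z = z := fun i z hz hne =>
    hmxy (Sum.inr ⟨z, ⟨i, hz⟩, hne⟩)
  have hmbase : m (-Complex.I) = -Complex.I := hm.2.2 _ fun h => by
    rw [mem_ball_zero_iff] at h
    simp at h
    linarith
  have hσ0 : ∀ k, σ k 0 = -Complex.I := fun k => by simp [σ]
  have hσs : ∀ k, ContDiff ℝ (⊤ : ℕ∞) (σ k) := fun k =>
    (contDiff_id.smul contDiff_const).sub contDiff_const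
  have hσd : ∀ k s, HasDerivAt (σ k) (v k) s := fun k s => by
    have := ((hasDerivAt_id s).smul_const (v k)).sub_const Complex.I
    rw [one_smul] at this
    exact this
  have hud := uniqueDiffOn_Icc (zero_lt_one (α := ℝ))
  have hder : ∀ k, ∀ s ∈ Icc (0 : ℝ) 1, derivWithin (m ∘ σ k) (Icc 0 1) s =
      fderiv ℝ m (σ k s) (v k) := fun k s hs =>
    (((hm.1.differentiable (by simp) _).hasFDerivAt.comp_hasDerivAt s
      (hσd k s)).hasDerivWithinAt).derivWithin (hud s hs)
  have hder0 : ∀ k, derivWithin (m ∘ σ k) (Icc 0 1) 0 = v k := fun k => by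
    have h1 : (m : ℂ → ℂ) =ᶠ[nhds (-Complex.I)] id := by
      have h2 : (-Complex.I) ∈ (Metric.closedBall (0 : ℂ) r)ᶜ := fun h => by
        rw [mem_closedBall_zero_iff] at h
        simp at h
        linarith
      filter_upwards [Metric.isClosed_closedBall.isOpen_compl.mem_nhds h2] with z hz
      exact hm.2.2 z fun h => hz (Metric.ball_subset_closedBall h)
    rw [hder k 0 ⟨le_rfl, zero_le_one⟩, hσ0, h1.fderiv_eq, fderiv_id]
    rfl
  let a : Fin N → Arc Δ := fun k =>
    { toFun := m ∘ σ k
      smooth := (hm.1.comp (hσs k)).contDiffOn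
      injOn := fun s _ u _ h => (hσeq k k s u (m.injective h)).1
      immersion := fun s hs h => by
        rw [hder k s hs] at h
        exact hv0 k (fderiv_injective_of_mem_diffGroup hm _ _ h)
      start := by rw [Function.comp_apply, hσ0, hmbase]
      finish := ⟨j k, by rw [Function.comp_apply, hmp]; exact hpj k⟩
      transverse := by rw [hder0, hvim]; exact hδ0.ne'
      interior := fun s hs => by
        have hs' : s ∈ Ioc (0 : ℝ) 1 := Ioo_subset_Ioc_self hs
        refine ⟨mem_ball_zero_iff.1 ((diffGroup_mem_iff
          (diffGroup_mono (Metric.ball_subset_ball hr1.le) hm) _).2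
          (mem_ball_zero_iff.2 (hσ1 k s hs'))), fun i hi => ?_⟩
        rw [Function.comp_apply] at hi
        -- A marked point on the new arc is either fixed by `m`, hence on a segment, which is
        -- impossible, or some `p l`, whose preimage is the end of a segment.
        by_cases hz : ∀ l, m (σ k s) ≠ p l
        · have h1 := m.injective (hmq i _ hi hz)
          rw [h1] at hi
          exact hσmark k s ⟨hs'.1.le, hs'.2⟩ i hi
        · push Not at hz
          obtain ⟨l, hl⟩ := hz
          rw [← hmp l] at hl
          exact hs.2.ne (hσeq k l s 1 (m.injective hl)).1 }
  have htan : ∀ k, (a k).tangent = v k := hder0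
  refine ⟨a, fun k l hkl => Subset.antisymm ?_ ?_, fun k l hkl => ?_, fun k => ?_⟩
  · rintro z ⟨⟨s, hs, h⟩, ⟨u, hu, h'⟩⟩
    have h1 : m (σ k s) = m (σ l u) := h.trans h'.symm
    obtain ⟨rfl, h2⟩ := hσeq k l s u (m.injective h1)
    have h3 : s = 0 := by
      by_contra h0
      exact hkl (Fin.ext (Nat.cast_injective (mul_left_cancel₀ h0 h2)))
    rw [h3] at h
    exact Subtype.ext (h.symm.trans (a k).start)
  · rintro z rfl
    exact ⟨(a k).base_mem, (a l).base_mem⟩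
  · change (a l).tangent.arg < (a k).tangent.arg
    rw [arg_lt_arg_iff (a l).tangent_im_pos (a k).tangent_im_pos, htan, htan, hvim, hvim, hvre, hvre]
    have : ((k : ℕ) : ℝ) < (l : ℕ) := Nat.cast_lt.2 (Fin.lt_def.1 hkl)
    nlinarith [mul_pos hδ0 hδ0]
  · change m (σ k 1) ∈ _
    rw [hmp]; exact hpj k

/-! ### IC-sequences and orbits -/

/-- Every simplex has an IC-sequence. -/
theorem exists_isICSequence {q : ℕ} (hξ : 0 < ∑ j, ξ j) (α : Simplex Δ ξ q) :
    ∃ ω : ICSequence ξ q, IsICSequence α ω := by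
  classical
  obtain ⟨⟨s, hs⟩, ⟨hne, r, hr, hdis⟩, hcard⟩ : ∃ β : {s : Finset (PlantClass Δ ξ) // s = α.1},
      β.1 ∈ (coloredPlantComplex Δ ξ).faces ∧ β.1.card = q + 1 := ⟨⟨α.1, rfl⟩, α.2⟩
  simp only at hne hr hdis hcard
  let e : Fin (q + 1) ≃ s := (Finset.equivFinOfCardEq hcard).symm
  choose a ha1 ha2 ha3 using fun i => (r (e i)).2
  let κ := Fin (q + 1) × Σ j : Fin t, Fin (ξ j)
  let A : κ → Arc Δ := fun x => a x.1 x.2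
  have hA : ∀ x y, x ≠ y → (A x).carrier ∩ (A y).carrier = {base} := by
    rintro ⟨i, x⟩ ⟨i', y⟩ hxy
    by_cases hii : i = i'
    · subst hii
      exact ha2 i x y fun h => hxy (by rw [h])
    · refine Subset.antisymm (fun z hz => ?_) ?_
      · refine hdis _ (e i).2 _ (e i').2 (fun h => hii (e.injective (Subtype.ext h))) ⟨?_, ?_⟩
        · rw [ha3]; exact mem_iUnion_of_mem x hz.1
        · rw [ha3]; exact mem_iUnion_of_mem y hz.2
      · rintro z rfl
        exact ⟨Arc.base_mem _, Arc.base_mem _⟩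
  have hκ : Fintype.card κ = (q + 1) * ∑ i, ξ i := by simp [κ]
  let E : Fin ((q + 1) * ∑ i, ξ i) ≃ κ := (Fintype.equivFinOfCardEq hκ).symm
  -- The representatives from the complex may have arcs tangent to each other at `*`; they are
  -- ordered near `*` first and only then straightened to distinct slopes.
  obtain ⟨τ, hτ⟩ := exists_perm_orderedAtBase (A ∘ E) fun k l hkl =>
    hA _ _ fun h => hkl (E.injective h)
  set F : Fin ((q + 1) * ∑ i, ξ i) ≃ κ := τ.trans E with hF
  have hcm : StrictMono fun k : Fin ((q + 1) * ∑ i, ξ i) => (k : ℝ) :=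
    fun k l h => Nat.cast_lt.2 (Fin.lt_def.1 h)
  obtain ⟨φ, hφ, b, δ, -, hb, hbs⟩ := exists_straightStart (a := A ∘ F) hτ hcm
  have hbd : ∀ k l, k ≠ l → (b k).carrier ∩ (b l).carrier = {base} := fun k l hkl =>
    image_carrier_disjoint (hA _ _ fun h => hkl (F.injective h)) hφ (hb k) (hb l)
  have hbcol : ∀ k, (b k).HasColor (F k).2.1 := fun k => by
    have h1 := congrArg (Subtype.val) (tip_eq_of_image hφ (hb k))
    have h2 := ha1 (F k).1 (F k).2
    change (b k).toFun 1 ∈ _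
    rw [← Arc.coe_tip, h1]
    exact h2
  have hsurj : Function.Surjective fun k => (F k).1 := fun i => by
    obtain ⟨j, -, hj⟩ := Finset.exists_ne_zero_of_sum_ne_zero hξ.ne'
    exact ⟨F.symm (i, ⟨j, ⟨0, Nat.pos_of_ne_zero hj⟩⟩), by simp⟩
  -- The numbering of the vertices by `e` was arbitrary; `σ` renumbers the plants by their first
  -- arcs.
  obtain ⟨σ, hσ, -⟩ := existsUnique_firstOrdered hsurj
  have hplant : ∀ i, IsColoredPlant Δ ξ (φ '' (r (e i)).1) := fun i => by
    refine ⟨fun x => b (F.symm (i, x)), fun x => ?_, fun x y hxy => hbd _ _ fun h => ?_, ?_⟩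
    · have := hbcol (F.symm (i, x))
      rwa [F.apply_symm_apply] at this
    · have := F.symm.injective h
      exact hxy (congrArg Prod.snd this)
    · rw [ha3, image_iUnion]
      refine iUnion_congr fun x => ?_
      rw [← hb, Function.comp_apply, F.apply_symm_apply]
  let P : Fin (q + 1) → Plant Δ ξ := fun i => ⟨φ '' (r (e i)).1, hplant i⟩
  have hPcls : ∀ i, (P i).cls = e i := fun i => by
    rw [← hr _ (e i).2]
    exact (Quotient.sound ⟨φ, hφ, rfl⟩ : (r (e i)).cls = (P i).cls).symm
  refine ⟨fun k => (σ (F k).1, (F k).2.1), fun i => P (σ.symm i), b, ?_, hbd,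
    strictAnti_arg_of_straightStart hcm hbs, fun i => ?_, hbcol, hσ⟩
  · subst hs
    ext v
    simp only [hPcls, mem_range]
    constructor
    · intro hv
      exact ⟨σ (e.symm ⟨v, hv⟩), by simp⟩
    · rintro ⟨i, rfl⟩
      exact (e _).2
  · change φ '' (r (e (σ.symm i))).1 = _
    rw [ha3, image_iUnion]
    ext z
    simp only [mem_iUnion]
    constructor
    · rintro ⟨x, hx⟩
      refine ⟨F.symm (σ.symm i, x), by simp, ?_⟩
      rw [← hb, Function.comp_apply, F.apply_symm_apply]
      exact hx
    · rintro ⟨k, hk, hz⟩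
      refine ⟨(F k).2, ?_⟩
      rw [← hb] at hz
      have : σ.symm i = (F k).1 := by rw [← hk, σ.symm_apply_apply]
      rw [this]
      exact hz

/-- Since `q < n`, the `(q + 1) ξ_j` end points of color `j` fit into the `n ξ_j` marked points.
Disjoint arcs with these ends in the given order are grouped into plants by the indices. -/
theorem exists_simplex {q : ℕ} (hξ : 0 < ∑ j, ξ j) {n : ℕ} (hq : q < n)
    (hΔ : ∀ i, (Δ.pts i).card = n * ξ i) {ω : ICSequence ξ q} (hω : IsFeasible ω) :
    ∃ α : Simplex Δ ξ q, IsICSequence α ω := by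
  classical
  obtain ⟨hcount, hfirst⟩ := (isFeasible_iff hξ ω).1 hω
  have hcol : ∀ j, Fintype.card {k // (ω k).2 = j} ≤ Fintype.card (Δ.pts j) := fun j => by
    have h1 : Fintype.card {k // (ω k).2 = j} = ∑ i : Fin (q + 1), Nat.card {k // ω k = (i, j)} := by
      simp only [Nat.card_eq_fintype_card, Fintype.card_subtype]
      rw [← Finset.card_biUnion]
      · congr 1
        ext k
        simp [Prod.ext_iff]
      · intro i _ i' _ hii
        simp only [Function.onFun]
        rw [Finset.disjoint_filter]
        intro k _ h h'
        exact hii (congrArg Prod.fst (h.symm.trans h'))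
    rw [h1, Finset.sum_congr rfl fun i _ => hcount i j, Fintype.card_coe, hΔ]
    simp only [Finset.sum_const, Finset.card_univ, Fintype.card_fin, smul_eq_mul]
    exact Nat.mul_le_mul_right _ hq
  let f : ∀ j, {k // (ω k).2 = j} ↪ Δ.pts j := fun j =>
    Classical.choice (Function.Embedding.nonempty_of_card_le (hcol j))
  let p : Fin ((q + 1) * ∑ i, ξ i) → ℂ := fun k => f (ω k).2 ⟨k, rfl⟩
  have hpj : ∀ k, p k ∈ Δ.pts (ω k).2 := fun k => (f (ω k).2 ⟨k, rfl⟩).2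
  have hpf : ∀ k j (h : (ω k).2 = j), p k = f j ⟨k, h⟩ := fun k j h => by subst h; rfl
  have hp : Function.Injective p := fun k l h => by
    have h1 : (ω k).2 = (ω l).2 := color_unique (hpj k) (h ▸ hpj l)
    rw [hpf k _ h1, hpf l _ rfl] at h
    exact congrArg Subtype.val ((f _).injective (Subtype.ext h))
  obtain ⟨a, had, harg, hac⟩ := exists_arcs hp hpj
  have hplant : ∀ i, IsColoredPlant Δ ξ (⋃ (k) (_ : (ω k).1 = i), (a k).carrier) := fun i => by
    have hE : ∀ j, Nonempty (Fin (ξ j) ≃ {k // ω k = (i, j)}) := fun j => by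
      rw [← hcount i j]
      exact ⟨(Finite.equivFin _).symm⟩
    let E := fun j => Classical.choice (hE j)
    have hEω : ∀ x : Σ j, Fin (ξ j), ω (E x.1 x.2) = (i, x.1) := fun x => (E x.1 x.2).2
    refine ⟨fun x => a (E x.1 x.2), fun x => ?_, fun x y hxy => had _ _ fun h => hxy ?_, ?_⟩
    · have := hac (E x.1 x.2)
      rwa [hEω] at this
    · obtain ⟨j, x⟩ := x
      obtain ⟨j', y⟩ := y
      have h1 := hEω ⟨j, x⟩
      have h2 := hEω ⟨j', y⟩
      simp only at h h1 h2
      rw [h, h2] at h1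
      obtain rfl : j' = j := congrArg Prod.snd h1
      rw [(E j').injective (Subtype.ext h)]
    · ext z
      simp only [mem_iUnion]
      constructor
      · rintro ⟨k, hk, hz⟩
        refine ⟨⟨(ω k).2, (E (ω k).2).symm ⟨k, Prod.ext hk rfl⟩⟩, ?_⟩
        rwa [Equiv.apply_symm_apply]
      · rintro ⟨x, hx⟩
        exact ⟨_, by rw [hEω], hx⟩
  let v : Fin (q + 1) → Plant Δ ξ := fun i => ⟨_, hplant i⟩
  have hv : ∀ i, (v i).1 = ⋃ (k) (_ : (ω k).1 = i), (a k).carrier := fun i => rfl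
  -- Different plants end in different marked points, which isotopies fix; so the `q + 1` classes
  -- are distinct and span a simplex of the right dimension.
  have hvinj : Function.Injective fun i => (v i).cls := by
    intro i i' h
    obtain ⟨φ, hφ, h1⟩ : v i ≈ v i' := Quotient.exact h
    obtain ⟨k, hk⟩ := hcount.surjective hξ i
    obtain ⟨c, hc⟩ := (a k).tip_marked
    have h2 : φ (a k).tip = (a k).tip := isotopy_fixesMarked hφ c _ hc
    have h3 : (a k).tip ∈ (v i').1 := by
      rw [← h1, ← h2, hv]
      exact mem_image_of_mem _ (mem_iUnion₂.2 ⟨k, hk, (a k).tip_mem⟩)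
    rw [hv] at h3
    obtain ⟨l, hl, hl'⟩ := mem_iUnion₂.1 h3
    have h4 := (a l).eq_tip hl' hc
    have hkl : k = l := by
      by_contra hkl
      exact tip_ne_tip (had k l hkl) h4
    rw [← hk, ← hl, hkl]
  have hex : ∀ w ∈ Finset.univ.image (fun i => (v i).cls), ∃ i, (v i).cls = w := fun w hw => by
    obtain ⟨i, -, h⟩ := Finset.mem_image.1 hw
    exact ⟨i, h⟩
  choose! ι hι using hex
  refine ⟨⟨Finset.univ.image fun i => (v i).cls, ⟨⟨(v 0).cls, Finset.mem_image_of_mem _ (Finset.mem_univ _)⟩,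
    fun w => v (ι w), hι, ?_⟩, ?_⟩, v, a, by simp, had, harg, hv, hac, hfirst⟩
  · intro w hw w' hw' hne z hz
    have hii : ι w ≠ ι w' := fun h => hne (by rw [← hι w hw, ← hι w' hw', h])
    obtain ⟨hz1, hz2⟩ := hz
    rw [hv] at hz1 hz2
    obtain ⟨k, hk, hk'⟩ := mem_iUnion₂.1 hz1
    obtain ⟨l, hl, hl'⟩ := mem_iUnion₂.1 hz2
    rw [← had k l fun h => hii (by rw [← hk, ← hl, h])]
    exact ⟨hk', hl'⟩
  · rw [Finset.card_image_of_injective _ hvinj, Finset.card_univ, Fintype.card_fin]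

/-- The sequence records the order and colors of all arcs, so `exists_diffeo_family` matches the
arcs one by one up to an isotopy; equal indices make it match the plants. -/
theorem IsICSequence.exists_smul_eq {q : ℕ} {α α' : Simplex Δ ξ q} {ω : ICSequence ξ q}
    (h : IsICSequence α ω) (h' : IsICSequence α' ω) : ∃ g : coloredDiffeo Δ, g • α = α' := by
  obtain ⟨v, a, hα, hd, harg, hv, hc, -⟩ := h
  obtain ⟨v', a', hα', hd', harg', hv', hc', -⟩ := h'
  obtain ⟨g, ψ, hψ, hg⟩ := exists_diffeo_family hd hd' (orderedAtBase_of_strictAnti harg)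
    (orderedAtBase_of_strictAnti harg') hc hc'
  have hcls : ∀ i, g • (v i).cls = (v' i).cls := fun i => by
    rw [smul_cls]
    refine Quotient.sound ⟨ψ, hψ, ?_⟩
    rw [smul_plant_val, hv, hv']
    simp only [image_iUnion, hg]
  refine ⟨g, Subtype.ext (Finset.coe_injective ?_)⟩
  change ((α.1.map (MulAction.toPerm g).toEmbedding : Finset (PlantClass Δ ξ)) :
    Set (PlantClass Δ ξ)) = _
  rw [Finset.coe_map, hα, hα', ← range_comp]
  exact congrArg range (funext hcls)

end PlantComplex

end

/-! ### The main theorem. -/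

theorem mainTheorem5 {t : ℕ} (ht : 0 < t) (n q : ℕ) (hq : q < n)
    (ξ : Fin t → ℕ) (hξ : ∀ i, 0 < ξ i)
    (Δ : PlantComplex.MarkedPoints t) (hΔ : ∀ i, (Δ.pts i).card = n * ξ i) :
    (Nat.card (PlantComplex.Orbits Δ ξ q) : ℚ) =
        (Nat.factorial ((∑ i, ξ i) * (q + 1)) : ℚ) /
          ((Nat.factorial (q + 1) : ℚ) * (∏ i, (Nat.factorial (ξ i) : ℚ)) ^ (q + 1)) ∧
    {ω : PlantComplex.ICSequence ξ q |
        ∃ α : PlantComplex.Simplex Δ ξ q, PlantComplex.IsICSequence α ω} =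
      {ω | PlantComplex.IsFeasible ω} ∧
    ∃ Φ : PlantComplex.Orbits Δ ξ q ≃ {ω : PlantComplex.ICSequence ξ q // PlantComplex.IsFeasible ω},
      ∀ (α : PlantComplex.Simplex Δ ξ q) (ω : PlantComplex.ICSequence ξ q),
        PlantComplex.IsICSequence α ω ↔ (Φ (PlantComplex.orbitOf α)).1 = ω := by
  have hpos : 0 < ∑ j, ξ j := (hξ ⟨0, ht⟩).trans_le
    (Finset.single_le_sum (fun _ _ => Nat.zero_le _) (Finset.mem_univ (⟨0, ht⟩ : Fin t)))
  -- By uniqueness `W α` is the only IC-sequence of `α`. It is constant on orbits and separates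
  -- them, and every feasible sequence is a value.
  choose W hW using PlantComplex.exists_isICSequence (Δ := Δ) (ξ := ξ) (q := q) hpos
  have hWiff : ∀ α ω, PlantComplex.IsICSequence α ω ↔ W α = ω := fun α ω =>
    ⟨fun h => (hW α).unique hpos h, fun h => h ▸ hW α⟩
  have hinv : ∀ (g : PlantComplex.coloredDiffeo Δ) α, W (g • α) = W α := fun g α =>
    (hWiff _ _).1 ((hW α).smul g)
  let Φ : PlantComplex.Orbits Δ ξ q →
      {ω : PlantComplex.ICSequence ξ q // PlantComplex.IsFeasible ω} :=
    Quotient.lift (fun α => ⟨W α, (hW α).feasible hpos⟩) fun α β h => by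
      obtain ⟨x, hx⟩ := MulAction.orbitRel_apply.1 h
      obtain ⟨g, rfl⟩ := QuotientGroup.mk_surjective x
      refine Subtype.ext ?_
      rw [← hx]
      exact hinv g β
  have hΦ : Function.Bijective Φ := by
    constructor
    · intro x y
      refine Quotient.inductionOn₂ x y fun α β h => ?_
      have h1 : W α = W β := congrArg Subtype.val h
      obtain ⟨g, hg⟩ := (hW β).exists_smul_eq (h1 ▸ hW α)
      exact Quotient.sound (MulAction.orbitRel_apply.2 ⟨QuotientGroup.mk g, hg⟩)
    · rintro ⟨ω, hω⟩
      obtain ⟨α, hα⟩ := PlantComplex.exists_simplex hpos hq hΔ hω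
      exact ⟨PlantComplex.orbitOf α, Subtype.ext ((hWiff α ω).1 hα)⟩
  refine ⟨?_, Set.ext fun ω => ⟨?_, fun hω => PlantComplex.exists_simplex hpos hq hΔ hω⟩,
    Equiv.ofBijective Φ hΦ, hWiff⟩
  · have h1 := PlantComplex.card_hasPairCounts ξ q
    rw [← PlantComplex.card_feasible q hpos, ← Nat.card_congr (Equiv.ofBijective Φ hΦ)] at h1
    have hprod : (∏ i, ((ξ i).factorial : ℚ)) ≠ 0 :=
      Finset.prod_ne_zero_iff.2 fun i _ => by exact_mod_cast (ξ i).factorial_ne_zero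
    rw [eq_div_iff (mul_ne_zero (by exact_mod_cast (q + 1).factorial_ne_zero)
      (pow_ne_zero _ hprod)), mul_comm (∑ i, ξ i), ← h1]
    push_cast
    ring
  · rintro ⟨α, hα⟩
    exact hα.feasible hpos
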